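/- Edit operations over an alphabet $\Sigma$ are the pairs $(x/y)$ with $x,y\in\Sigma\cup\{\varepsilon\}$, not both empty. The weight of an edit string (a word of edit operations) is the number of its operations with $x\neq y$. The edit distance $\delta(u,v)$ of two words is the least weight of an edit string with input part $u$ and output part $v$. For a language $L$ with at least two words, $\delta(L)=\min\{\delta(u,v): u,v\in L,\ u\ne v\}$. Let $A$ be an NFA (no empty transitions, one start state, finitely many states and transitions) whose language $L(A)$ contains at least two words. Let $|A|$ be the number of states plus the number of transitions, and let $\Sigma_A$ be the set of the $r$ symbols that label transitions of $A$. Two shortest words of $L(A)$ are a shortest word $u$ of $L(A)$ and a shortest word $v$ of $L(A)\setminus\{u\}$. Let $D_A=\delta(u,v)$, where $u,v$ are two shortest words of $L(A)$ (if there are several choices, those used by the algorithm). For $k\ge 0$ let $T_k$ be the transducer with states $0,\dots,k$, start state $0$, all states final, the transitions $i\xrightarrow{a/a}i$ for $a\in\Sigma_A$, $0\le i\le k$, and the transitions $i\xrightarrow{x/y}i+1$ for $0\le i<k$ and all $x\ne y$ in $\Sigma_A\cup\{\varepsilon\}$; it realizes the channel of at most $k$ substitutions, insertions and deletions over $\Sigma_A$.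 For a transducer $T$ in standard form (each input or output label is a symbol or $\varepsilon$), $(T\downarrow A\uparrow A)$ is the product transducer with states $(i,p,q)$, start state the triple of start states, final states the triples of final states, and a transition $(i,p,q)\xrightarrow{x/y}(i',p',q')$ whenever $i\xrightarrow{x/y}i'$ in $T$, $p\xrightarrow{x}p'$ in $A$ (or $p=p'$ if $x=\varepsilon$), and $q\xrightarrow{y}q'$ in $A$ (or $q=q'$ if $y=\varepsilon$). A transducer is functional if every input word has at most one output word. Algorithm DistErrDetect, on input $A$: 1. Compute $D_A$. 2. Let $\min\leftarrow1$ and $\max\leftarrow D_A-1$. 3. While $\min\le\max$: let $k\leftarrow\lfloor(\min+\max)/2\rfloor$; construct $T_k$; construct $T'=(T_k\downarrow A\uparrow A)$; test whether $T'$ is functional; if it is, let $\min\leftarrow k+1$, and otherwise let $\max\leftarrow k-1$. 4. Return $\min$. The machine model is a random access machine with registers and arrays of natural numbers, a fixed finite program, and unit cost for every addition, truncated subtraction, halving, comparison, and access to a register or an array cell. Automata and transducers are given in memory by a numbering of the states, the start state, the final states, and a list of the transitions without repetition; symbols are natural numbers. **Corollary.** The four subroutines of DistErrDetect (computing the edit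 distance of two shortest words of $L(A)$; constructing $T_k$; constructing $(T\downarrow A\uparrow A)$ from any transducer $T$ in standard form and $A$; deciding whether any given transducer in standard form is functional) can be implemented correctly on this machine so that, for every NFA $A$ accepting at least two words, the algorithm halts, returns $\delta(L(A))$, and runs in time $$O\bigl(|A|^4\,r^4\,D_A^2\,\log(D_A+1)\bigr),$$ with an absolute constant. -/

import Mathlib

/-! ### Edit strings and the edit distance -/

/-- A basic edit operation `(x/y)` over the alphabet `α`: `x` and `y` are symbols or the empty
word (`none`), and at least one of them is a symbol. -/
abbrev EditOp (α : Type) : Type := {p : Option α × Option α // p ≠ (none, none)}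

/-- The input part of an edit string. -/
def editInp {α : Type} (h : List (EditOp α)) : List α := h.filterMap (fun e => e.1.1)

/-- The output part of an edit string. -/
def editOut {α : Type} (h : List (EditOp α)) : List α := h.filterMap (fun e => e.1.2)

/-- The weight of an edit string: the number of its operations `(x/y)` with `x ≠ y`. -/
def editWeight {α : Type} [DecidableEq α] (h : List (EditOp α)) : ℕ :=
  h.countP (fun e => decide (e.1.1 ≠ e.1.2))

/-- The edit (Levenshtein) distance of two words: the least weight of an edit string with input
part `u` and output part `v` (there always is one). -/
noncomputable def editDist {α : Type} [DecidableEq α] (u v : List α) : ℕ :=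
  sInf {n | ∃ h : List (EditOp α), editInp h = u ∧ editOut h = v ∧ editWeight h = n}

/-- The edit distance of a language with at least two words: the least distance of two different
words in it. -/
noncomputable def languageEditDist {α : Type} [DecidableEq α] (L : Language α) : ℕ :=
  sInf {n | ∃ u ∈ L, ∃ v ∈ L, u ≠ v ∧ editDist u v = n}

/-- `u` and `v` are two shortest words of `L`: `u` is a shortest word of `L`, and `v` is a shortest
one among the words of `L` other than `u`. -/
def AreTwoShortest {α : Type} (L : Language α) (u v : List α) : Prop :=
  u ∈ L ∧ v ∈ L ∧ v ≠ u ∧ (∀ w ∈ L, u.length ≤ w.length) ∧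
    (∀ w ∈ L, w ≠ u → v.length ≤ w.length)

/-- `d` is the edit distance of two shortest words of `L`. -/
def IsShortestWordsBound {α : Type} [DecidableEq α] (L : Language α) (d : ℕ) : Prop :=
  ∃ u v, AreTwoShortest L u v ∧ editDist u v = d

/-! ### Automata and transducers -/

/-- A finite automaton without empty transitions, with one start state and an explicit finite set
of transitions. Alphabet symbols are natural numbers. -/
structure Automaton (Q : Type) where
  start : Q
  final : Finset Q
  trans : Finset (Q × ℕ × Q)

namespace Automaton

variable {Q : Type}

/-- The automaton as an `NFA` of Mathlib. -/
def toNFA (A : Automaton Q) : NFA ℕ Q where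
  step p a := {q | (p, a, q) ∈ A.trans}
  start := {A.start}
  accept := {q | q ∈ A.final}

/-- The accepted language. -/
def language (A : Automaton Q) : Language ℕ := A.toNFA.accepts

/-- The size: the number of states plus the number of transitions. -/
def size [Fintype Q] (A : Automaton Q) : ℕ := Fintype.card Q + A.trans.card

/-- The alphabet used in `A`: the symbols that label its transitions. -/
def alphabet (A : Automaton Q) : Finset ℕ := A.trans.image (fun t => t.2.1)

/-- `A` can go from `p` to `q` reading `x`, where `x` is one symbol or the empty word; on the empty
word `A` stays where it is. -/
def Moves (A : Automaton Q) (p : Q) (x : Option ℕ) (q : Q) : Prop :=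
  match x with
  | none => p = q
  | some a => (p, a, q) ∈ A.trans

end Automaton

/-- A finite transducer in standard form: the input label and the output label of a transition are
a symbol or the empty word (`none`). A transition `(p, x, y, q)` is `p --x/y--> q`. -/
structure Transducer (P : Type) where
  start : P
  final : Finset P
  trans : Finset (P × Option ℕ × Option ℕ × P)

namespace Transducer

variable {P : Type}

/-- `T.Path p u v q`: there is a path of `T` from `p` to `q` whose label is `(u, v)`. -/
inductive Path (T : Transducer P) : P → List ℕ → List ℕ → P → Prop
  | nil (p : P) : Path T p [] [] p
  | cons {p q s : P} {x y : Option ℕ} {u v : List ℕ} (ht : (p, x, y, q) ∈ T.trans)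
      (h : Path T q u v s) : Path T p (x.toList ++ u) (y.toList ++ v) s

/-- The relation realized by `T`. -/
def Realizes (T : Transducer P) (u v : List ℕ) : Prop := ∃ f ∈ T.final, T.Path T.start u v f

/-- `T` is functional: every input has at most one output. -/
def Functional (T : Transducer P) : Prop :=
  ∀ u v w, T.Realizes u v → T.Realizes u w → v = w

open Classical in
/-- The product transducer `(T ↓ A ↑ A)`: a path is a path of `T` whose input part is read by a
first copy of `A` and whose output part is read by a second copy of `A`. -/
noncomputable def restrict [Fintype P] {Q : Type} [Fintype Q] (T : Transducer P)
    (A : Automaton Q) : Transducer (P × Q × Q) where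
  start := (T.start, A.start, A.start)
  final := T.final ×ˢ A.final ×ˢ A.final
  trans := ((T.trans ×ˢ (Finset.univ : Finset ((Q × Q) × (Q × Q)))).filter (fun z =>
      A.Moves z.2.1.1 z.1.2.1 z.2.2.1 ∧ A.Moves z.2.1.2 z.1.2.2.1 z.2.2.2)).image (fun z =>
      ((z.1.1, z.2.1), z.1.2.1, z.1.2.2.1, (z.1.2.2.2, z.2.2)))

end Transducer

/-- The input-preserving transducer that realizes the channel of at most `k` substitutions,
insertions and deletions over the alphabet `S`. The states are `0, …, k`, all final; there is a loop
`i --a/a--> i` for every state `i` and symbol `a`, and a transition `i --x/y--> i + 1` for every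
`i < k` and all different `x` and `y`, each a symbol or the empty word. -/
def sidTransducer (S : Finset ℕ) (k : ℕ) : Transducer (Fin (k + 1)) where
  start := 0
  final := Finset.univ
  trans :=
    ((Finset.univ : Finset (Fin (k + 1))) ×ˢ S).image
        (fun z => (z.1, some z.2, some z.2, z.1)) ∪
      ((Finset.univ : Finset (Fin k)) ×ˢ
          ((Finset.insertNone S ×ˢ Finset.insertNone S).filter (fun xy => xy.1 ≠ xy.2))).image
        (fun z => (z.1.castSucc, z.2.1, z.2.2, z.1.succ))

/-! ### The machine model: programs over registers and arrays of natural numbers, with unit cost -/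

/-- The objects that the algorithm keeps in memory: the given automaton, the channel transducer,
and the product transducer. -/
inductive Obj
  | input
  | channel
  | product
  deriving DecidableEq

/-- Names of registers. -/
inductive Reg
  | numStates (o : Obj)
  | start (o : Obj)
  | numTrans (o : Obj)
  | bound
  | min
  | max
  | k
  | verdict
  | result
  | scratch (n : ℕ)
  deriving DecidableEq

/-- Names of arrays. -/
inductive Arr
  | final (o : Obj)
  | src (o : Obj)
  | inp (o : Obj)
  | out (o : Obj)
  | dst (o : Obj)
  | scratch (n : ℕ)
  deriving DecidableEq

/-- The memory of the machine: the contents of the registers and of the array cells. -/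
structure Mem where
  reg : Reg → ℕ
  arr : Arr → ℕ → ℕ

/-- Set a register. -/
def Mem.setReg (σ : Mem) (x : Reg) (n : ℕ) : Mem :=
  { σ with reg := Function.update σ.reg x n }

/-- Set an array cell. -/
def Mem.setArr (σ : Mem) (a : Arr) (i n : ℕ) : Mem :=
  { σ with arr := Function.update σ.arr a (Function.update (σ.arr a) i n) }

/-- Expressions: constants, registers, array cells, addition, truncated subtraction, halving
(rounded down), and comparison. -/
inductive Exp
  | const (n : ℕ)
  | reg (x : Reg)
  | arr (a : Arr) (i : Exp)
  | add (e f : Exp)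
  | sub (e f : Exp)
  | half (e : Exp)
  | le (e f : Exp)

/-- The value of an expression; the value of a comparison is `1` if it holds and `0` if not. -/
def Exp.eval (σ : Mem) : Exp → ℕ
  | const n => n
  | reg x => σ.reg x
  | arr a i => σ.arr a (i.eval σ)
  | add e f => e.eval σ + f.eval σ
  | sub e f => e.eval σ - f.eval σ
  | half e => e.eval σ / 2
  | le e f => if e.eval σ ≤ f.eval σ then 1 else 0

/-- The number of steps that the evaluation of an expression takes: one for every operation, and
one for every access to a constant, a register or an array cell. -/
def Exp.cost : Exp → ℕ
  | const _ => 1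
  | reg _ => 1
  | arr _ i => i.cost + 1
  | add e f => e.cost + f.cost + 1
  | sub e f => e.cost + f.cost + 1
  | half e => e.cost + 1
  | le e f => e.cost + f.cost + 1

/-- Programs. A test succeeds if its value is not `0`. -/
inductive Prog
  | skip
  | set (x : Reg) (e : Exp)
  | write (a : Arr) (i e : Exp)
  | seq (c d : Prog)
  | ite (e : Exp) (c d : Prog)
  | while (e : Exp) (c : Prog)

/-- `c.Runs σ τ t`: the program `c`, started in memory `σ`, halts in memory `τ` after `t` steps. -/
inductive Prog.Runs : Prog → Mem → Mem → ℕ → Prop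
  | skip (σ : Mem) : Runs .skip σ σ 1
  | set (σ : Mem) (x : Reg) (e : Exp) :
      Runs (.set x e) σ (σ.setReg x (e.eval σ)) (e.cost + 1)
  | write (σ : Mem) (a : Arr) (i e : Exp) :
      Runs (.write a i e) σ (σ.setArr a (i.eval σ) (e.eval σ)) (i.cost + e.cost + 1)
  | seq {c d : Prog} {σ τ υ : Mem} {s t : ℕ} (hc : Runs c σ τ s) (hd : Runs d τ υ t) :
      Runs (.seq c d) σ υ (s + t)
  | ite_true {e : Exp} {c d : Prog} {σ τ : Mem} {t : ℕ} (he : e.eval σ ≠ 0) (h : Runs c σ τ t) :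
      Runs (.ite e c d) σ τ (e.cost + t + 1)
  | ite_false {e : Exp} {c d : Prog} {σ τ : Mem} {t : ℕ} (he : e.eval σ = 0) (h : Runs d σ τ t) :
      Runs (.ite e c d) σ τ (e.cost + t + 1)
  | while_true {e : Exp} {c : Prog} {σ τ υ : Mem} {s t : ℕ} (he : e.eval σ ≠ 0)
      (hc : Runs c σ τ s) (hw : Runs (.while e c) τ υ t) :
      Runs (.while e c) σ υ (e.cost + s + t + 1)
  | while_false {e : Exp} {c : Prog} {σ : Mem} (he : e.eval σ = 0) :
      Runs (.while e c) σ σ (e.cost + 1)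

/-! ### Automata and transducers in memory -/

/-- The memory `σ` holds the automaton `A` as the input object: the states are numbered
`0, 1, …` in some order, and the transitions are listed in some order without repetition. -/
def Mem.HoldsAutomaton (σ : Mem) {Q : Type} [Fintype Q] (A : Automaton Q) : Prop :=
  ∃ (num : Q ≃ Fin (Fintype.card Q)) (l : List (Q × ℕ × Q)),
    l.Nodup ∧ (∀ t, t ∈ l ↔ t ∈ A.trans) ∧
    σ.reg (.numStates .input) = Fintype.card Q ∧
    σ.reg (.start .input) = num A.start ∧
    (∀ q, (q ∈ A.final → σ.arr (.final .input) (num q) = 1) ∧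
      (q ∉ A.final → σ.arr (.final .input) (num q) = 0)) ∧
    σ.reg (.numTrans .input) = l.length ∧
    ∀ (i : ℕ) (hi : i < l.length),
      σ.arr (.src .input) i = num l[i].1 ∧
      σ.arr (.inp .input) i = l[i].2.1 ∧
      σ.arr (.dst .input) i = num l[i].2.2

/-- The code of a transition label: `0` for the empty word, `a + 1` for the symbol `a`. -/
def labelCode : Option ℕ → ℕ
  | none => 0
  | some a => a + 1

/-- The memory `σ` holds the transducer `T` as the object `o`. -/
def Mem.HoldsTransducer (σ : Mem) (o : Obj) {P : Type} [Fintype P] (T : Transducer P) : Prop :=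
  ∃ (num : P ≃ Fin (Fintype.card P)) (l : List (P × Option ℕ × Option ℕ × P)),
    l.Nodup ∧ (∀ t, t ∈ l ↔ t ∈ T.trans) ∧
    σ.reg (.numStates o) = Fintype.card P ∧
    σ.reg (.start o) = num T.start ∧
    (∀ p, (p ∈ T.final → σ.arr (.final o) (num p) = 1) ∧
      (p ∉ T.final → σ.arr (.final o) (num p) = 0)) ∧
    σ.reg (.numTrans o) = l.length ∧
    ∀ (i : ℕ) (hi : i < l.length),
      σ.arr (.src o) i = num l[i].1 ∧
      σ.arr (.inp o) i = labelCode l[i].2.1 ∧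
      σ.arr (.out o) i = labelCode l[i].2.2.1 ∧
      σ.arr (.dst o) i = num l[i].2.2.2

/-- The memories `σ` and `τ` agree on the input object. -/
def Mem.SameInput (σ τ : Mem) : Prop :=
  τ.reg (.numStates .input) = σ.reg (.numStates .input) ∧
  τ.reg (.start .input) = σ.reg (.start .input) ∧
  τ.reg (.numTrans .input) = σ.reg (.numTrans .input) ∧
  τ.arr (.final .input) = σ.arr (.final .input) ∧
  τ.arr (.src .input) = σ.arr (.src .input) ∧
  τ.arr (.inp .input) = σ.arr (.inp .input) ∧
  τ.arr (.dst .input) = σ.arr (.dst .input)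

/-- The memories `σ` and `τ` agree on the registers of the binary search. -/
def Mem.SameControl (σ τ : Mem) : Prop :=
  τ.reg .bound = σ.reg .bound ∧ τ.reg .min = σ.reg .min ∧ τ.reg .max = σ.reg .max ∧
  τ.reg .k = σ.reg .k

/-! ### The algorithm -/

/-- `c` computes the edit distance of two shortest words accepted by the given automaton. -/
def ComputesBound (c : Prog) : Prop :=
  ∀ (Q : Type) [Fintype Q] (A : Automaton Q), (∃ u ∈ A.language, ∃ v ∈ A.language, u ≠ v) →
    ∀ σ : Mem, σ.HoldsAutomaton A →
      ∃ τ t, c.Runs σ τ t ∧ σ.SameInput τ ∧ IsShortestWordsBound A.language (τ.reg .bound)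

/-- `c` constructs the channel transducer for the current `k` and the alphabet used in the given
automaton. -/
def ConstructsChannel (c : Prog) : Prop :=
  ∀ (Q : Type) [Fintype Q] (A : Automaton Q) (σ : Mem), σ.HoldsAutomaton A →
    ∃ τ t, c.Runs σ τ t ∧ σ.SameInput τ ∧ σ.SameControl τ ∧
      τ.HoldsTransducer .channel (sidTransducer A.alphabet (σ.reg .k))

/-- `c` constructs `(T ↓ A ↑ A)` from the transducer `T` in memory and the given automaton `A`. -/
def ConstructsProduct (c : Prog) : Prop :=
  ∀ (Q : Type) [Fintype Q] (A : Automaton Q) (P : Type) [Fintype P] (T : Transducer P) (σ : Mem),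
    σ.HoldsAutomaton A → σ.HoldsTransducer .channel T →
      ∃ τ t, c.Runs σ τ t ∧ σ.SameInput τ ∧ σ.SameControl τ ∧
        τ.HoldsTransducer .product (T.restrict A)

/-- `c` decides whether the product transducer in memory, which may be any transducer, is
functional. -/
def DecidesFunctional (c : Prog) : Prop :=
  ∀ (P : Type) [Fintype P] (T : Transducer P) (σ : Mem), σ.HoldsTransducer .product T →
    ∃ τ t, c.Runs σ τ t ∧ σ.SameInput τ ∧ σ.SameControl τ ∧ (τ.reg .verdict ≠ 0 ↔ T.Functional)

/-- Algorithm `DistErrDetect`, with its four subroutines as parameters: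
compute the bound; `min ← 1`; `max ← bound - 1`; while `min ≤ max`: `k ← ⌊(min + max) / 2⌋`,
construct the channel transducer, construct the product, test it for functionality,
and let `min ← k + 1` if it is functional, `max ← k - 1` if not; return `min`. -/
def distErrDetect (computeBound constructChannel constructProduct testFunctional : Prog) : Prog :=
  .seq computeBound <|
  .seq (.set .min (.const 1)) <|
  .seq (.set .max (.sub (.reg .bound) (.const 1))) <|
  .seq
    (.while (.le (.reg .min) (.reg .max)) <|
      .seq (.set .k (.half (.add (.reg .min) (.reg .max)))) <|
      .seq constructChannel <|
      .seq constructProduct <|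
      .seq testFunctional <|
      .ite (.reg .verdict)
        (.set .min (.add (.reg .k) (.const 1)))
        (.set .max (.sub (.reg .k) (.const 1))))
    (.set .result (.reg .min))

/-! ### Reasoning about programs -/

/-! Correctness. The states of the channel transducer count errors, so `(T_k ↓ A ↑ A)` realizes
exactly the pairs `(u, v)` of words of the language with `editDist u v ≤ k`
(`restrict_sidTransducer_realizes_iff`). Every accepted `u` has itself as an output; hence the
product is functional iff no other accepted word lies within distance `k`, that is, iff `k <
languageEditDist A.language` (`restrict_sidTransducer_functional_iff`). The distance of the language
is positive and at most the distance `D` of two shortest words, so the search in `[1, D - 1]` keeps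
`min ≤ distance ≤ max + 1` and stops at the distance.

Functionality. Two runs on the same input are a walk in the graph of pairs of states, each edge
carrying two outputs. Output words are embedded in a group: the symbol numbered `j > 0` becomes the
permutation `t ↦ 2 ^ j * t + 1` of `ℚ`, and a product of such maps determines the word
(`wordMap_injective`). Two runs with outputs `v`, `v'` yield the group element of `v` times the
inverse of that of `v'`, and functionality says that every walk from the start pair to a sink behind
the pairs of final states yields `1` (`Transducer.functional_iff`). Group elements can be cancelled,
so it suffices to define a potential along a search tree and to check one equation for each edge
from a reachable vertex to one that can reach the sink (`walkStep_unique_iff`). The maps are kept as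
a few natural numbers; the machine charges one step for an addition or a halving, however large the
numbers are.

Shortest words. A pumping argument bounds two shortest words by twice the number of states. For each
length and state, at most two words leading to a final state are kept, each coded by the number
`wordVal`; two are enough, because prefixing a symbol is injective. The distance is then found with
the usual table.

Time. Arbitrary symbols are first replaced by small numbers (`Prog.dedupe`), so that handling a
symbol takes `O(r)` steps. A transition of the product is determined by a channel state, one bit and
two moves of `A`, so there are `O(D |A|^2)` of them (`card_restrict_sidTransducer_trans_le`). The
graph of pairs has quadratically many edges, each treated in `O(r)` steps, and this test dominates
one of the `O(log (D + 1))` rounds. Programs are verified in a small Hoare logic, `Prog.Ter`, which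
carries an explicit bound on the number of steps. -/

@[simp] theorem Mem.setReg_reg (σ : Mem) (x y : Reg) (n : ℕ) :
    (σ.setReg x n).reg y = if y = x then n else σ.reg y := by
  simp [Mem.setReg, Function.update_apply]

@[simp] theorem Mem.setReg_arr (σ : Mem) (x : Reg) (n : ℕ) : (σ.setReg x n).arr = σ.arr := rfl

@[simp] theorem Mem.setArr_reg (σ : Mem) (a : Arr) (i n : ℕ) : (σ.setArr a i n).reg = σ.reg := rfl

@[simp] theorem Mem.setArr_arr (σ : Mem) (a b : Arr) (i j n : ℕ) :
    (σ.setArr a i n).arr b j = if b = a ∧ j = i then n else σ.arr b j := by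
  by_cases h : b = a
  · subst h; simp [Mem.setArr, Function.update_apply]
  · simp [Mem.setArr, h]

theorem Mem.setArr_arr_ne (σ : Mem) {a b : Arr} (h : b ≠ a) (i n : ℕ) :
    (σ.setArr a i n).arr b = σ.arr b := by
  funext j; simp [h]

attribute [simp] Exp.eval

namespace Exp

/-- The test `e = f`. -/
def eq (e f : Exp) : Exp := .sub (.add (.le e f) (.le f e)) (.const 1)

/-- The test `e < f`. -/
def lt (e f : Exp) : Exp := .le (.add e (.const 1)) f

/-- The minimum of two values. -/
def min (e f : Exp) : Exp := .sub e (.sub e f)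

@[simp] theorem eval_eq (σ : Mem) (e f : Exp) :
    (eq e f).eval σ = if e.eval σ = f.eval σ then 1 else 0 := by
  simp only [eq, Exp.eval]
  split_ifs <;> omega

@[simp] theorem eval_lt (σ : Mem) (e f : Exp) :
    (lt e f).eval σ = if e.eval σ < f.eval σ then 1 else 0 := by
  simp only [lt, Exp.eval, Nat.add_one_le_iff]

@[simp] theorem eval_min (σ : Mem) (e f : Exp) :
    (min e f).eval σ = Min.min (e.eval σ) (f.eval σ) := by
  simp only [min, Exp.eval]
  omega

end Exp

namespace Prog

set_option linter.unusedSimpArgs false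

infixr:60 " ;; " => Prog.seq

/-- `c.Ter σ B Q`: the program `c`, started in `σ`, halts within `B` steps in a memory
with property `Q`. -/
def Ter (c : Prog) (σ : Mem) (B : ℕ) (Q : Mem → Prop) : Prop :=
  ∃ τ t, c.Runs σ τ t ∧ t ≤ B ∧ Q τ

/-- `c` may write the register `x`. -/
def writesReg : Prog → Reg → Bool
  | .skip, _ => false
  | .set y _, x => decide (x = y)
  | .write _ _ _, _ => false
  | .seq c d, x => c.writesReg x || d.writesReg x
  | .ite _ c d, x => c.writesReg x || d.writesReg x
  | .while _ c, x => c.writesReg x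

/-- `c` may write into the array `a`. -/
def writesArr : Prog → Arr → Bool
  | .skip, _ => false
  | .set _ _, _ => false
  | .write b _ _, a => decide (a = b)
  | .seq c d, a => c.writesArr a || d.writesArr a
  | .ite _ c d, a => c.writesArr a || d.writesArr a
  | .while _ c, a => c.writesArr a

attribute [simp] writesReg writesArr

/-- The memories agree outside of what `c` may write. -/
structure Frame (c : Prog) (σ τ : Mem) : Prop where
  reg : ∀ x, c.writesReg x = false → τ.reg x = σ.reg x
  arr : ∀ a, c.writesArr a = false → τ.arr a = σ.arr a

theorem Frame.refl (c : Prog) (σ : Mem) : c.Frame σ σ := ⟨fun _ _ => rfl, fun _ _ => rfl⟩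

theorem Frame.trans {c : Prog} {σ τ υ : Mem} (h : c.Frame σ τ) (k : c.Frame τ υ) :
    c.Frame σ υ :=
  ⟨fun x hx => (k.reg x hx).trans (h.reg x hx), fun a ha => (k.arr a ha).trans (h.arr a ha)⟩

theorem Frame.mono {c d : Prog} {σ τ : Mem} (h : c.Frame σ τ)
    (hr : ∀ x, d.writesReg x = false → c.writesReg x = false)
    (ha : ∀ a, d.writesArr a = false → c.writesArr a = false) : d.Frame σ τ :=
  ⟨fun x hx => h.reg x (hr x hx), fun a k => h.arr a (ha a k)⟩

theorem Frame.setReg {c : Prog} {σ τ : Mem} (h : c.Frame σ τ) {x : Reg} (v : ℕ)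
    (hx : c.writesReg x = true) : c.Frame σ (τ.setReg x v) :=
  ⟨fun y hy => by
    have : y ≠ x := by rintro rfl; simp [hx] at hy
    simp [this, h.reg y hy], h.arr⟩

theorem Frame.setArr {c : Prog} {σ τ : Mem} (h : c.Frame σ τ) {a : Arr} (i v : ℕ)
    (ha : c.writesArr a = true) : c.Frame σ (τ.setArr a i v) :=
  ⟨h.reg, fun b hb => by
    have : b ≠ a := by rintro rfl; simp [ha] at hb
    rw [Mem.setArr_arr_ne _ this, h.arr b hb]⟩

/-- What a program may change is read off its syntax. For a concrete program, the preservation of a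
register or an array is therefore settled by `decide`, and invariants need not mention it. -/
theorem Runs.frame {c : Prog} {σ τ : Mem} {t : ℕ} (h : c.Runs σ τ t) : c.Frame σ τ := by
  induction h with
  | skip σ => exact .refl _ _
  | set σ x e => exact ⟨fun y hy => by simp_all [writesReg], fun a _ => rfl⟩
  | write σ a i e =>
    exact ⟨fun y hy => rfl, fun b hb => Mem.setArr_arr_ne _ (by simpa [writesArr] using hb) _ _⟩
  | seq hc hd ihc ihd =>
    exact (ihc.mono (by simp +contextual [writesReg]) (by simp +contextual [writesArr])).trans
      (ihd.mono (by simp +contextual [writesReg]) (by simp +contextual [writesArr]))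
  | ite_true he h ih =>
    exact ih.mono (by simp +contextual [writesReg]) (by simp +contextual [writesArr])
  | ite_false he h ih =>
    exact ih.mono (by simp +contextual [writesReg]) (by simp +contextual [writesArr])
  | while_true he hc hw ihc ihw =>
    exact (ihc.mono (by simp +contextual [writesReg]) (by simp +contextual [writesArr])).trans ihw
  | while_false he => exact .refl _ _

namespace Ter

variable {c d : Prog} {σ : Mem} {B B' : ℕ} {Q Q' : Mem → Prop}

/-- The frame is passed to the consequence, so that values untouched by `c` need not be part of its
postcondition. -/
theorem mono (h : c.Ter σ B Q) (hB : B ≤ B') (hQ : ∀ τ, c.Frame σ τ → Q τ → Q' τ) :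
    c.Ter σ B' Q' := by
  obtain ⟨τ, t, hr, ht, hq⟩ := h
  exact ⟨τ, t, hr, ht.trans hB, hQ τ hr.frame hq⟩

theorem le (h : c.Ter σ B Q) (hB : B ≤ B') : c.Ter σ B' Q := h.mono hB fun _ _ h => h

theorem imp (h : c.Ter σ B Q) (hQ : ∀ τ, c.Frame σ τ → Q τ → Q' τ) : c.Ter σ B Q' :=
  h.mono le_rfl hQ

theorem skip (h : Q σ) : Ter .skip σ 1 Q := ⟨_, _, .skip σ, le_rfl, h⟩

theorem set {x : Reg} {e : Exp} (h : Q (σ.setReg x (e.eval σ))) :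
    Ter (.set x e) σ (e.cost + 1) Q := ⟨_, _, .set σ x e, le_rfl, h⟩

theorem write {a : Arr} {i e : Exp} (h : Q (σ.setArr a (i.eval σ) (e.eval σ))) :
    Ter (.write a i e) σ (i.cost + e.cost + 1) Q := ⟨_, _, .write σ a i e, le_rfl, h⟩

theorem seq (h : c.Ter σ B (fun τ => c.Frame σ τ → d.Ter τ B' Q)) :
    (c ;; d).Ter σ (B + B') Q := by
  obtain ⟨τ, s, hr, hs, hq⟩ := h
  obtain ⟨υ, t, hr', ht, hq⟩ := hq hr.frame
  exact ⟨υ, s + t, .seq hr hr', by omega, hq⟩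

theorem ite {e : Exp} (h : e.eval σ ≠ 0 → c.Ter σ B Q) (k : e.eval σ = 0 → d.Ter σ B Q) :
    (Prog.ite e c d).Ter σ (e.cost + B + 1) Q := by
  by_cases he : e.eval σ = 0
  · obtain ⟨τ, s, hr, hs, hq⟩ := k he
    exact ⟨τ, _, .ite_false he hr, by omega, hq⟩
  · obtain ⟨τ, s, hr, hs, hq⟩ := h he
    exact ⟨τ, _, .ite_true he hr, by omega, hq⟩

/-- The rule for `while`: the invariant has the remaining time as a parameter. -/
theorem while_rule {e : Exp} {b : Prog} {I : ℕ → Mem → Prop} {T : ℕ}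
    (hs : ∀ T τ, I T τ → e.eval τ ≠ 0 →
      ∃ B, b.Ter τ B (fun υ => ∃ T', T' + B + e.cost + 1 ≤ T ∧ I T' υ))
    (h0 : I T σ) :
    (Prog.while e b).Ter σ (T + e.cost + 1) (fun τ => ∃ T', I T' τ ∧ e.eval τ = 0) := by
  -- By `hs` the remaining time drops by at least one in every round, so it also serves as the
  -- termination measure.
  induction T using Nat.strong_induction_on generalizing σ with
  | _ T ih =>
    by_cases he : e.eval σ = 0
    · exact ⟨σ, _, .while_false he, by omega, T, h0, he⟩
    · obtain ⟨B, τ, s, hr, hsB, T', hT', hI⟩ := hs T σ h0 he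
      obtain ⟨υ, t, hr', ht, hq⟩ := ih T' (by omega) hI
      exact ⟨υ, _, .while_true he hr hr', by omega, hq⟩

end Ter

/-- Repeat `b` for `i = 0, …, n - 1`. -/
def loop (i n : Reg) (b : Prog) : Prog :=
  .set i (.const 0) ;;
    .while (.le (.add (.reg i) (.const 1)) (.reg n)) (b ;; .set i (.add (.reg i) (.const 1)))

@[simp] theorem writesReg_loop (i n : Reg) (b : Prog) (x : Reg) :
    (loop i n b).writesReg x = (decide (x = i) || b.writesReg x) := by
  simp only [loop, writesReg]
  cases b.writesReg x <;> simp

@[simp] theorem writesArr_loop (i n : Reg) (b : Prog) (a : Arr) :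
    (loop i n b).writesArr a = b.writesArr a := by
  simp [loop]

/-- A round pays for the body, 4 steps for increasing the counter and 6 for the test, whence `B j +
10`; the final 8 are 2 for clearing the counter and 6 for the failing test. The next instance of the
invariant is required after the counter has been increased. -/
theorem Ter.loop_sum {i n : Reg} {b : Prog} {σ : Mem} {I : ℕ → Mem → Prop} {B : ℕ → ℕ} {N : ℕ}
    (hN : σ.reg n = N)
    (hi : b.writesReg i = false) (hn : b.writesReg n = false) (hin : n ≠ i)
    (h0 : I 0 (σ.setReg i 0))
    (hs : ∀ j < N, ∀ τ, (loop i n b).Frame σ τ → τ.reg i = j → I j τ →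
      b.Ter τ (B j) (fun υ => I (j + 1) (υ.setReg i (j + 1)))) :
    (loop i n b).Ter σ ((∑ j ∈ Finset.range N, (B j + 10)) + 8)
      (fun τ => I N τ) := by
  subst hN
  have hset : (Prog.set i (.const 0)).Ter σ 2 (fun τ => τ = σ.setReg i 0) :=
    Ter.set (by simp)
  have key : (loop i n b).Ter σ (2 + ((∑ j ∈ Finset.range (σ.reg n), (B j + 10)) + 5 + 1))
      (fun τ => ∃ T', (∃ j, j ≤ σ.reg n ∧ τ.reg i = j ∧ I j τ ∧ (loop i n b).Frame σ τ ∧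
        T' = ∑ j ∈ Finset.Ico j (σ.reg n), (B j + 10)) ∧
        (Exp.le (.add (.reg i) (.const 1)) (.reg n)).eval τ = 0) := by
    refine Ter.seq (hset.imp fun τ _ hτ _ => ?_)
    subst hτ
    -- The remaining time is the cost of the rounds that are still to come.
    refine Ter.while_rule (I := fun T' τ => ∃ j, j ≤ σ.reg n ∧ τ.reg i = j ∧ I j τ ∧
      (loop i n b).Frame σ τ ∧ T' = ∑ j ∈ Finset.Ico j (σ.reg n), (B j + 10)) ?_ ?_
    · rintro T τ ⟨j, hj, hij, hI, hF, rfl⟩ he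
      have hnn : τ.reg n = σ.reg n := hF.reg n (by simp [hn, hin])
      have hjn : j < σ.reg n := by
        simp only [Exp.eval, hij, hnn] at he
        by_contra hc
        exact he (if_neg (by omega))
      refine ⟨B j + 4, Ter.seq ((hs j hjn τ hF hij hI).imp fun υ hυ hI' _ => Ter.set ?_)⟩
      have hυi : υ.reg i = j := (hυ.reg i hi).trans hij
      have hev : (Exp.add (.reg i) (.const 1)).eval υ = j + 1 := by simp [hυi]
      rw [hev]
      refine ⟨_, ?_, j + 1, hjn, by simp, hI', ?_, rfl⟩
      · rw [Finset.sum_eq_sum_Ico_succ_bot hjn]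
        simp only [Exp.cost]; omega
      · refine hF.trans ((hυ.mono ?_ ?_).trans ⟨?_, ?_⟩)
        · intro x hx; simp at hx; exact hx.2
        · intro x hx; simpa using hx
        · intro x hx; simp at hx; simp [hx]
        · intro a _; rfl
    · refine ⟨0, by omega, by simp, h0, ⟨?_, ?_⟩, by simp⟩
      · intro x hx; simp at hx; simp [hx]
      · intro a _; rfl
  refine key.mono (by omega) ?_
  rintro τ hF ⟨T', ⟨j, hj, hij, hI, -, -⟩, he⟩
  have hnn : τ.reg n = σ.reg n := hF.reg n (by simp [hn, hin])
  have : j = σ.reg n := by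
    simp only [Exp.eval, hij, hnn] at he
    by_contra hc
    simp [show j + 1 ≤ σ.reg n by omega] at he
  exact this ▸ hI

theorem Ter.loop {i n : Reg} {b : Prog} {σ : Mem} (I : ℕ → Mem → Prop) (B N : ℕ)
    (hN : σ.reg n = N)
    (hi : b.writesReg i = false) (hn : b.writesReg n = false) (hin : n ≠ i)
    (h0 : I 0 (σ.setReg i 0))
    (hs : ∀ j < N, ∀ τ, (loop i n b).Frame σ τ → τ.reg i = j → I j τ →
      b.Ter τ B (fun υ => I (j + 1) (υ.setReg i (j + 1)))) :
    (Prog.loop i n b).Ter σ (N * (B + 10) + 8) (fun τ => I N τ) := by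
  simpa using Ter.loop_sum (B := fun _ => B) hN hi hn hin h0 hs

/-- The program has no loops. -/
def loopFree : Prog → Bool
  | .skip => true
  | .set _ _ => true
  | .write _ _ _ => true
  | .seq c d => c.loopFree && d.loopFree
  | .ite _ c d => c.loopFree && d.loopFree
  | .while _ _ => false

/-- The effect of a program without loops. -/
def exec : Prog → Mem → Mem
  | .skip, σ => σ
  | .set x e, σ => σ.setReg x (e.eval σ)
  | .write a i e, σ => σ.setArr a (i.eval σ) (e.eval σ)
  | .seq c d, σ => d.exec (c.exec σ)
  | .ite e c d, σ => if e.eval σ = 0 then d.exec σ else c.exec σ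
  | .while _ _, σ => σ

theorem exec_seq (c d : Prog) (σ : Mem) : (c ;; d).exec σ = d.exec (c.exec σ) := rfl

theorem exec_set (x : Reg) (e : Exp) (σ : Mem) :
    (Prog.set x e).exec σ = σ.setReg x (e.eval σ) := rfl

theorem exec_ite_of_eq_zero {e : Exp} {σ : Mem} (h : e.eval σ = 0) (c d : Prog) :
    (Prog.ite e c d).exec σ = d.exec σ := if_pos h

theorem exec_ite_of_ne_zero {e : Exp} {σ : Mem} (h : e.eval σ ≠ 0) (c d : Prog) :
    (Prog.ite e c d).exec σ = c.exec σ := if_neg h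

/-- The largest number of steps of a program without loops. -/
def maxCost : Prog → ℕ
  | .skip => 1
  | .set _ e => e.cost + 1
  | .write _ i e => i.cost + e.cost + 1
  | .seq c d => c.maxCost + d.maxCost
  | .ite e c d => e.cost + max c.maxCost d.maxCost + 1
  | .while _ _ => 0

theorem Ter.of_loopFree {c : Prog} {σ : Mem} {Q : Mem → Prop} (hc : c.loopFree = true)
    (h : Q (c.exec σ)) : c.Ter σ c.maxCost Q := by
  induction c generalizing σ Q with
  | skip => exact Ter.skip h
  | set x e => exact Ter.set h
  | write a i e => exact Ter.write h
  | seq c d ihc ihd =>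
    simp only [loopFree, Bool.and_eq_true] at hc
    exact Ter.seq (ihc hc.1 fun _ => ihd hc.2 h)
  | ite e c d ihc ihd =>
    simp only [loopFree, Bool.and_eq_true] at hc
    simp only [exec] at h
    refine Ter.ite (fun he => ?_) fun he => ?_
    · rw [if_neg he] at h
      exact (ihc hc.1 h).le (le_max_left _ _)
    · rw [if_pos he] at h
      exact (ihd hc.2 h).le (le_max_right _ _)
  | _ => simp [loopFree] at hc

/-- Blocks without loops are verified by running them symbolically: absence of loops and the step
bound are found by computation, and only the effect `exec` is left to be simplified. -/
theorem Ter.straight {c : Prog} {σ : Mem} {B : ℕ} {Q : Mem → Prop}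
    (hc : (c.loopFree && decide (c.maxCost ≤ B)) = true)
    (h : Q (c.exec σ)) : c.Ter σ B Q := by
  simp only [Bool.and_eq_true, decide_eq_true_eq] at hc
  exact (Ter.of_loopFree hc.1 h).le hc.2

end Prog

/-! ### Lists of records in memory -/

/-- A record with four fields. -/
abbrev Quad : Type := ℕ × ℕ × ℕ × ℕ

/-- The record number `i` in four parallel arrays. -/
def Mem.row (σ : Mem) (a b c d : Arr) (i : ℕ) : Quad :=
  (σ.arr a i, σ.arr b i, σ.arr c i, σ.arr d i)

/-- The list of the first `n` records in four parallel arrays. -/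
def Mem.list (σ : Mem) (n : Reg) (a b c d : Arr) : List Quad :=
  (List.range (σ.reg n)).map (σ.row a b c d)

theorem Mem.list_congr {σ τ : Mem} {n : Reg} {a b c d : Arr} (hn : τ.reg n = σ.reg n)
    (ha : τ.arr a = σ.arr a) (hb : τ.arr b = σ.arr b) (hc : τ.arr c = σ.arr c)
    (hd : τ.arr d = σ.arr d) : τ.list n a b c d = σ.list n a b c d := by
  simp only [Mem.list, hn, List.map_inj_left]
  intro i _
  simp [Mem.row, ha, hb, hc, hd]

@[simp] theorem Mem.length_list (σ : Mem) (n : Reg) (a b c d : Arr) :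
    (σ.list n a b c d).length = σ.reg n := by simp [Mem.list]

@[simp] theorem Mem.list_setReg {σ : Mem} {n i : Reg} (h : n ≠ i) (a b c d : Arr) (v : ℕ) :
    (σ.setReg i v).list n a b c d = σ.list n a b c d :=
  Mem.list_congr (by simp [h]) rfl rfl rfl rfl

theorem Mem.row_mem_list {σ : Mem} {n : Reg} {i : ℕ} (h : i < σ.reg n) (a b c d : Arr) :
    σ.row a b c d i ∈ σ.list n a b c d := by
  simp only [Mem.list, List.mem_map, List.mem_range]
  exact ⟨i, h, rfl⟩

theorem Mem.mem_list {σ : Mem} {n : Reg} {a b c d : Arr} {x : Quad} :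
    x ∈ σ.list n a b c d ↔ ∃ i < σ.reg n, σ.row a b c d i = x := by
  simp [Mem.list]

namespace Prog

/-- Append a record to the list held in four parallel arrays. -/
def push (n : Reg) (a b c d : Arr) (e f g h : Exp) : Prog :=
  .write a (.reg n) e ;; .write b (.reg n) f ;; .write c (.reg n) g ;; .write d (.reg n) h ;;
    .set n (.add (.reg n) (.const 1))

/-- The four fields are evaluated one after another while the arrays of the list are already
changing. This is why `hv` speaks of all memories that agree with `σ` outside these arrays.
Distinctness of the arrays keeps a later write from destroying an earlier one. -/
theorem Ter.push {n : Reg} {a b c d : Arr} {e f g h : Exp} {σ : Mem} {B : ℕ} {v : Quad}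
    {l : List Quad} (hnd : [a, b, c, d].Nodup) (hl : σ.list n a b c d = l)
    (hB : e.cost + f.cost + g.cost + h.cost + 12 ≤ B)
    (hv : ∀ τ : Mem, τ.reg = σ.reg →
      (∀ z, z ≠ a → z ≠ b → z ≠ c → z ≠ d → τ.arr z = σ.arr z) →
      (e.eval τ, f.eval τ, g.eval τ, h.eval τ) = v) :
    (push n a b c d e f g h).Ter σ B (fun τ => τ.list n a b c d = l ++ [v]) := by
  subst hl
  simp only [List.nodup_cons, List.mem_cons, List.not_mem_nil, or_false, not_or] at hnd
  obtain ⟨⟨hab, hac, had⟩, ⟨hbc, hbd⟩, hcd, -⟩ := hnd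
  obtain ⟨v1, v2, v3, v4⟩ := v
  simp only [Prod.mk.injEq] at hv
  have hc : (Prog.push n a b c d e f g h).maxCost ≤ B := by
    simp only [Prog.push, maxCost, Exp.cost]; omega
  refine Ter.straight (by
    rw [decide_eq_true hc, Bool.and_true]; rfl) ?_
  simp only [Prog.push, exec, Exp.eval]
  set σ1 := σ.setArr a (σ.reg n) (e.eval σ) with h1
  set σ2 := σ1.setArr b (σ1.reg n) (f.eval σ1) with h2
  set σ3 := σ2.setArr c (σ2.reg n) (g.eval σ2) with h3
  set σ4 := σ3.setArr d (σ3.reg n) (h.eval σ3) with h4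
  have e1 := (hv σ rfl (fun _ _ _ _ _ => rfl)).1
  have e2 := (hv σ1 rfl (fun z _ _ _ _ => by rw [h1, Mem.setArr_arr_ne _ ‹_›])).2.1
  have e3 := (hv σ2 rfl (fun z _ _ _ _ => by
    rw [h2, h1, Mem.setArr_arr_ne _ ‹_›, Mem.setArr_arr_ne _ ‹_›])).2.2.1
  have e4 := (hv σ3 rfl (fun z _ _ _ _ => by
    rw [h3, h2, h1, Mem.setArr_arr_ne _ ‹_›, Mem.setArr_arr_ne _ ‹_›,
      Mem.setArr_arr_ne _ ‹_›])).2.2.2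
  rw [e1] at h1
  rw [e2] at h2
  rw [e3] at h3
  rw [e4] at h4
  have r4 : σ4.reg n = σ.reg n := rfl
  simp only [Mem.list, Mem.setReg_reg, if_true, r4, List.range_succ, List.map_append, List.map_cons,
    List.map_nil]
  congr 1
  · refine List.map_inj_left.2 fun i hi => ?_
    have hi : i ≠ σ.reg n := (List.mem_range.1 hi).ne
    simp [Mem.row, h4, h3, h2, h1, hi]
  · simp [Mem.row, h4, h3, h2, h1, hab, hac, had, hbc, hbd, hcd]

@[simp] theorem writesArr_push (n : Reg) (a b c d : Arr) (e f g h : Exp) (z : Arr) :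
    (push n a b c d e f g h).writesArr z =
      (decide (z = a) || decide (z = b) || decide (z = c) || decide (z = d)) := by
  simp [push, Bool.or_assoc]

theorem Ter.loop_append {i n m : Reg} {a b c d : Arr} {p : Prog} {σ : Mem} (f : ℕ → List Quad)
    {l : List Quad} (B N : ℕ) (hN : σ.reg n = N)
    (hi : p.writesReg i = false) (hn : p.writesReg n = false) (hin : n ≠ i) (hm : m ≠ i)
    (hl : σ.list m a b c d = l)
    (hs : ∀ j < N, ∀ τ, (Prog.loop i n p).Frame σ τ → τ.reg i = j → ∀ l',
      τ.list m a b c d = l' → p.Ter τ B (fun υ => υ.list m a b c d = l' ++ f j)) :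
    (Prog.loop i n p).Ter σ (N * (B + 10) + 8)
      (fun τ => τ.list m a b c d = l ++ (List.range N).flatMap f) := by
  refine Ter.loop (fun j τ => τ.list m a b c d = l ++ (List.range j).flatMap f) B N hN hi hn hin
    (by simp [hm, hl]) ?_
  intro j hj τ hF hij hI
  refine (hs j hj τ hF hij _ hI).imp fun υ _ h => ?_
  simp [hm, h, List.range_succ, List.append_assoc]

end Prog

/-! ### Automata and transducers as lists of records -/

theorem labelCode_injective : Function.Injective labelCode := by
  rintro (_ | a) (_ | b) h <;> simp_all [labelCode]

section Records

variable {P : Type} {n : ℕ}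

/-- The record of a transition of a transducer. -/
def transRecord (num : P ≃ Fin n) (t : P × Option ℕ × Option ℕ × P) : Quad :=
  (num t.1, labelCode t.2.1, labelCode t.2.2.1, num t.2.2.2)

theorem transRecord_injective (num : P ≃ Fin n) : Function.Injective (transRecord num) := by
  rintro ⟨p, x, y, q⟩ ⟨p', x', y', q'⟩ h
  simp only [transRecord, Prod.mk.injEq, Fin.val_inj, EmbeddingLike.apply_eq_iff_eq] at h
  obtain ⟨rfl, hx, hy, rfl⟩ := h
  rw [labelCode_injective hx, labelCode_injective hy]

/-- The record of a transition of an automaton. -/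
def autRecord (num : P ≃ Fin n) (t : P × ℕ × P) : Quad :=
  (num t.1, t.2.1, t.2.1, num t.2.2)

theorem autRecord_injective (num : P ≃ Fin n) : Function.Injective (autRecord num) := by
  rintro ⟨p, x, q⟩ ⟨p', x', q'⟩ h
  simp only [autRecord, Prod.mk.injEq, Fin.val_inj, EmbeddingLike.apply_eq_iff_eq] at h
  obtain ⟨rfl, rfl, -, rfl⟩ := h
  rfl

end Records

/-- The list of the transitions of a transducer in memory. -/
abbrev Mem.transList (σ : Mem) (o : Obj) : List Quad :=
  σ.list (.numTrans o) (.src o) (.inp o) (.out o) (.dst o)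

/-- The list of the transitions of the automaton in memory. -/
abbrev Mem.autList (σ : Mem) : List Quad :=
  σ.list (.numTrans .input) (.src .input) (.inp .input) (.inp .input) (.dst .input)

theorem Mem.list_eq_map {α : Type*} {σ : Mem} {n : Reg} {a b c d : Arr} {l : List α}
    {f : α → Quad} (hn : σ.reg n = l.length)
    (h : ∀ (i : ℕ) (hi : i < l.length), σ.row a b c d i = f l[i]) :
    σ.list n a b c d = l.map f := by
  apply List.ext_getElem
  · simp [hn]
  · intro i h1 h2
    simp only [Mem.list, List.getElem_map, List.getElem_range]
    exact h i (by simpa using h2)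

theorem List.exists_map_eq {α β : Type*} {f : α → β} {L : List β} (h : ∀ x ∈ L, ∃ a, f a = x) :
    ∃ l : List α, l.map f = L := by
  induction L with
  | nil => exact ⟨[], rfl⟩
  | cons x L ih =>
    obtain ⟨a, ha⟩ := h x (by simp)
    obtain ⟨l, hl⟩ := ih fun y hy => h y (by simp [hy])
    exact ⟨a :: l, by simp [ha, hl]⟩

/-- Since `transRecord` is injective, the records in memory determine the list of transitions. The
list can thus be eliminated, leaving a condition on the records alone: no repetition and the right
members. -/
theorem Mem.holdsTransducer_iff {σ : Mem} {o : Obj} {P : Type} [Fintype P] {T : Transducer P} :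
    σ.HoldsTransducer o T ↔ ∃ num : P ≃ Fin (Fintype.card P),
      (σ.transList o).Nodup ∧ (∀ x, x ∈ σ.transList o ↔ ∃ t ∈ T.trans, transRecord num t = x) ∧
      σ.reg (.numStates o) = Fintype.card P ∧ σ.reg (.start o) = num T.start ∧
      (∀ p, (p ∈ T.final → σ.arr (.final o) (num p) = 1) ∧
        (p ∉ T.final → σ.arr (.final o) (num p) = 0)) := by
  constructor
  · rintro ⟨num, l, hnd, hm, h1, h2, h3, h4, h5⟩
    have hL : σ.transList o = l.map (transRecord num) :=
      Mem.list_eq_map h4 fun i hi => by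
        obtain ⟨a, b, c, d⟩ := h5 i hi
        simp only [Mem.row, transRecord, a, b, c, d]
    refine ⟨num, ?_, ?_, h1, h2, h3⟩
    · rw [hL]; exact hnd.map (transRecord_injective num)
    · intro x; rw [hL]; simp only [List.mem_map, hm]
  · rintro ⟨num, hnd, hm, h1, h2, h3⟩
    obtain ⟨l, hl⟩ := List.exists_map_eq (f := transRecord num) (L := σ.transList o) fun x hx => by
      obtain ⟨t, -, ht⟩ := (hm x).1 hx
      exact ⟨t, ht⟩
    have hlen : l.length = σ.reg (.numTrans o) := by
      simpa using congrArg List.length hl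
    refine ⟨num, l, ?_, ?_, h1, h2, h3, hlen.symm, ?_⟩
    · rw [← hl] at hnd; exact hnd.of_map _
    · intro t
      have := hm (transRecord num t)
      rw [← hl, (List.mem_map_of_injective (transRecord_injective num))] at this
      rw [this]
      constructor
      · rintro ⟨t', h', e⟩
        rwa [← transRecord_injective num e]
      · exact fun h => ⟨t, h, rfl⟩
    · intro i hi
      have : (σ.transList o)[i]'(by simpa [← hlen] using hi) = transRecord num l[i] := by
        simp [← hl]
      simp only [Mem.transList, Mem.list, List.getElem_map, List.getElem_range, Mem.row,
        transRecord, Prod.mk.injEq] at this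
      exact this

/-- The symbol array is read twice in `Mem.autList`, so that transitions of an automaton fit into
the four-field records used for transducers. -/
theorem Mem.HoldsAutomaton.elim {σ : Mem} {Q : Type} [Fintype Q] {A : Automaton Q}
    (h : σ.HoldsAutomaton A) : ∃ num : Q ≃ Fin (Fintype.card Q),
      σ.autList.Nodup ∧ (∀ x, x ∈ σ.autList ↔ ∃ t ∈ A.trans, autRecord num t = x) ∧
      σ.reg (.numStates .input) = Fintype.card Q ∧ σ.reg (.start .input) = num A.start ∧
      (∀ p, (p ∈ A.final → σ.arr (.final .input) (num p) = 1) ∧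
        (p ∉ A.final → σ.arr (.final .input) (num p) = 0)) ∧
      σ.reg (.numTrans .input) = A.trans.card := by
  classical
  obtain ⟨num, l, hnd, hm, h1, h2, h3, h4, h5⟩ := h
  have hL : σ.autList = l.map (autRecord num) :=
    Mem.list_eq_map h4 fun i hi => by
      obtain ⟨a, b, c⟩ := h5 i hi
      simp only [Mem.row, autRecord, a, b, c]
  refine ⟨num, ?_, ?_, h1, h2, h3, ?_⟩
  · rw [hL]; exact hnd.map (autRecord_injective num)
  · intro x; rw [hL]; simp only [List.mem_map, hm]
  · rw [h4, ← List.toFinset_card_of_nodup hnd]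
    congr 1; ext t; simp [hm]

theorem Mem.HoldsTransducer.numTrans_eq {σ : Mem} {o : Obj} {P : Type} [Fintype P]
    {T : Transducer P} (h : σ.HoldsTransducer o T) : σ.reg (.numTrans o) = T.trans.card := by
  classical
  obtain ⟨num, l, hnd, hm, h1, h2, h3, h4, h5⟩ := h
  rw [h4, ← List.toFinset_card_of_nodup hnd]
  congr 1; ext t; simp [hm]

namespace Prog

/-! ### Numbering of labels -/

/-- Number the different values of `0` and of `lab` for `e = 0, …, n - 1` in the order of their
first occurrence: array `0` gets the values, array `1` the number of the value for every `e`,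
register `1` the number of values. -/
def dedupe (lab : Exp) (n : Reg) : Prog :=
  .set (.scratch 1) (.const 1) ;; .write (.scratch 0) (.const 0) (.const 0) ;;
  loop (.scratch 0) n
    (.write (.scratch 1) (.reg (.scratch 0)) (.reg (.scratch 1)) ;;
    loop (.scratch 2) (.scratch 1)
      (.ite (.eq (.arr (.scratch 0) (.reg (.scratch 2))) lab)
        (.write (.scratch 1) (.reg (.scratch 0)) (.reg (.scratch 2))) .skip) ;;
    .ite (.eq (.arr (.scratch 1) (.reg (.scratch 0))) (.reg (.scratch 1)))
      (.write (.scratch 0) (.reg (.scratch 1)) lab ;;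
        .set (.scratch 1) (.add (.reg (.scratch 1)) (.const 1))) .skip)

/-- `C` lists `0` and the values of `f` below `N`. -/
structure IsNumbering (f : ℕ → ℕ) (N : ℕ) (C : List ℕ) : Prop where
  nodup : C.Nodup
  idxOf_zero : C.idxOf 0 = 0
  mem_iff : ∀ x, x ∈ C ↔ x = 0 ∨ ∃ j < N, f j = x

theorem IsNumbering.length_le {f : ℕ → ℕ} {N : ℕ} {C : List ℕ} (h : IsNumbering f N C)
    {S : Finset ℕ} (h0 : 0 ∈ S) (hS : ∀ j < N, f j ∈ S) : C.length ≤ S.card := by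
  rw [← List.toFinset_card_of_nodup h.nodup]
  refine Finset.card_le_card fun x hx => ?_
  rw [List.mem_toFinset, h.mem_iff] at hx
  obtain rfl | ⟨j, hj, rfl⟩ := hx
  exacts [h0, hS j hj]

theorem IsNumbering.mem {f : ℕ → ℕ} {N : ℕ} {C : List ℕ} (h : IsNumbering f N C) {j : ℕ}
    (hj : j < N) : f j ∈ C := (h.mem_iff _).2 (.inr ⟨j, hj, rfl⟩)

theorem IsNumbering.zero_mem {f : ℕ → ℕ} {N : ℕ} {C : List ℕ} (h : IsNumbering f N C) :
    0 ∈ C := (h.mem_iff _).2 (.inl rfl)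

/-- The value `0` is entered first, so the empty word gets the number `0` and symbols get positive
numbers. For each `e` the number is preset to the current count and overwritten if the search finds
the value; it still equals the count exactly for a new value. The bound `R` is required for all
prefixes because it limits the inner loop in every round. -/
theorem Ter.dedupe {lab : Exp} {n : Reg} {σ : Mem} {N R : ℕ} {f : ℕ → ℕ} (hN : σ.reg n = N)
    (hn : n ≠ .scratch 0 ∧ n ≠ .scratch 1 ∧ n ≠ .scratch 2) (hlab : lab.cost ≤ 4)
    (hf : ∀ j < N, ∀ τ, (dedupe lab n).Frame σ τ → τ.reg (.scratch 0) = j → lab.eval τ = f j)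
    (hR : ∀ j ≤ N, ∀ C, IsNumbering f j C → C.length ≤ R) :
    (dedupe lab n).Ter σ (N * (R * 32 + 44) + 20) (fun τ => ∃ C, IsNumbering f N C ∧
      (List.range (τ.reg (.scratch 1))).map (τ.arr (.scratch 0)) = C ∧
      ∀ j < N, τ.arr (.scratch 1) j = C.idxOf (f j)) := by
  obtain ⟨hn0, hn1, hn2⟩ := hn
  set I : ℕ → Mem → Prop := fun m τ => (Prog.dedupe lab n).Frame σ τ ∧ ∃ C, IsNumbering f m C ∧
      (List.range (τ.reg (.scratch 1))).map (τ.arr (.scratch 0)) = C ∧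
      ∀ j < m, τ.arr (.scratch 1) j = C.idxOf (f j) with hI
  have hstart : ((Prog.set (.scratch 1) (.const 1)) ;;
      .write (.scratch 0) (.const 0) (.const 0)).Ter σ 5
      (fun τ => I 0 (τ.setReg (.scratch 0) 0) ∧ τ.reg n = N) := by
    refine Ter.straight (by decide) ⟨⟨?_, [0], ⟨by simp, by simp, by simp⟩, ?_, by simp⟩, ?_⟩
    · exact (((Frame.refl _ _).setReg _ (by simp [Prog.dedupe])).setArr _ _
        (by simp [Prog.dedupe])).setReg _ (by simp [Prog.dedupe])
    · simp [exec]
    · simp [exec, hn1, hN]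
  obtain ⟨τ, t, ht, htB, hτ⟩ := hstart
  -- The two initial assignments were run as a block; `dedupe` nests its sequence to the right, so
  -- the run is split again.
  cases ht with | seq h1 h2 =>
  refine Ter.le (Ter.seq (B := 2) (B' := 3 + (N * (((4 + (R * (22 + 10) + 8 + 22)) + 10)) + 8))
    ⟨_, _, h1, by cases h1; simp [Exp.cost], fun _ => Ter.seq
    ⟨_, _, h2, by cases h2; simp [Exp.cost], fun _ => ?_⟩⟩) (by ring_nf; omega)
  refine (Ter.loop I _ N hτ.2 (by simp) (by simp [hn1, hn2])
    hn0 hτ.1 ?_).imp fun τ _ h => h.2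
  rintro j hj τ - hij ⟨hF, C, hC, hcode, hrank⟩
  have hlen : C.length = τ.reg (.scratch 1) := by simp [← hcode]
  have hCR := hR j hj.le C hC
  have hget : ∀ i < C.length, C[i]? = some (τ.arr (.scratch 0) i) := by
    intro i hi
    have : C[i]? = ((List.range (τ.reg (.scratch 1))).map (τ.arr (.scratch 0)))[i]? := by rw [hcode]
    rw [this]
    simp [← hlen, hi]
  set ρ : Mem := τ.setArr (.scratch 1) j C.length with hρ
  have hFρ : (Prog.dedupe lab n).Frame σ ρ :=
    hF.setArr _ _ (by simp [Prog.dedupe])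
  refine Ter.seq ((Ter.write (Q := fun υ => υ = ρ) (by simp [hij, ← hlen, hρ])).le
    (by simp [Exp.cost]) |>.imp ?_)
  rintro υ - rfl -
  -- Invariant of the search: the entry for `j` is the index of `f j` once this index has been
  -- passed, and the sentinel `C.length` until then.
  refine Ter.seq (Ter.imp (Ter.le (Ter.loop (fun i υ => (Prog.dedupe lab n).Frame σ υ ∧
    υ.reg (.scratch 0) = j ∧ υ.reg (.scratch 1) = C.length ∧ υ.arr (.scratch 0) = τ.arr (.scratch 0) ∧
    (∀ j' < j, υ.arr (.scratch 1) j' = τ.arr (.scratch 1) j') ∧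
    υ.arr (.scratch 1) j = if C.idxOf (f j) < i then C.idxOf (f j) else C.length) 22 C.length
    (by simp [hρ, hlen]) (by simp) (by simp) (by simp) ?_ ?_)
    (by have := Nat.mul_le_mul_right 32 hCR; omega)) ?_)
  · refine ⟨hFρ.setReg _ (by simp [Prog.dedupe]), ?_, ?_, ?_, ?_, ?_⟩
    · simp [hρ, hij]
    · simp [hρ, hlen]
    · funext; simp [hρ]
    · intro j' hj'
      simp [hρ, hj'.ne]
    · simp [hρ]
  · rintro i hi υ - hυi ⟨hFυ, h0, h1, h2, h3, h4⟩
    have hl := hf j hj υ hFυ h0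
    have hCi : C[i] = τ.arr (.scratch 0) i := by
      have := hget i hi
      rw [List.getElem?_eq_getElem hi] at this
      simpa using this
    have hidx : C.idxOf C[i] = i := hC.nodup.idxOf_getElem i hi
    refine Ter.le (B := (Exp.eq (.arr (.scratch 0) (.reg (.scratch 2))) lab).cost + 3 + 1) ?_
      (by simp [Exp.eq, Exp.cost]; omega)
    refine Ter.ite (fun he => Ter.le (Ter.write ?_) (by simp [Exp.cost]))
      fun he => Ter.le (Ter.skip ?_) (by omega)
    · have he : C[i] = f j := by simpa [hυi, h2, hl, hCi] using he
      rw [he] at hidx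
      refine ⟨(hFυ.setArr _ _ (by simp [Prog.dedupe])).setReg _ (by simp [Prog.dedupe]),
        ?_, ?_, ?_, ?_, ?_⟩
      · simp [h0]
      · simp [h1]
      · funext; simp [h2]
      · intro j' hj'
        simp [h3 j' hj', h0, hj'.ne]
      · simp [h0, hυi, hidx]
    · have he : C[i] ≠ f j := by simpa [hυi, h2, hl, hCi] using he
      refine ⟨hFυ.setReg _ (by simp [Prog.dedupe]), ?_, ?_, ?_, ?_, ?_⟩
      · simp [h0]
      · simp [h1]
      · simp [h2]
      · simpa using h3
      · have : C.idxOf (f j) ≠ i := by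
          rintro rfl
          exact he (List.getElem_idxOf hi)
        simp only [Mem.setReg_arr, h4]
        split_ifs <;> omega
  · rintro υ - ⟨hFυ, h0, h1, h2, h3, h4⟩ -
    -- `List.idxOf` returns the length for a missing value, so sentinel and index agree and both
    -- cases merge.
    have h4 : υ.arr (.scratch 1) j = C.idxOf (f j) := by
      rw [h4]
      have := List.idxOf_le_length (a := f j) (l := C)
      split_ifs <;> omega
    have hl := hf j hj υ hFυ h0
    have hold : (List.range C.length).map (υ.arr (.scratch 0)) = C := by
      rw [h2, hlen, hcode]
    refine Ter.le (B := (Exp.eq (.arr (.scratch 1) (.reg (.scratch 0)))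
      (.reg (.scratch 1))).cost + (6 + 4) + 1) ?_ (by simp [Exp.eq, Exp.cost])
    refine Ter.ite (fun he => Ter.le (Ter.of_loopFree rfl ?_)
      (by simp only [maxCost, Exp.cost]; omega)) fun he => Ter.le (Ter.skip ?_) (by omega)
    · have he : f j ∉ C := by
        rw [← List.idxOf_lt_length_iff]
        have : C.idxOf (f j) = C.length := by simpa [h0, h1, h4] using he
        omega
      have hzero : 0 ∈ C := (hC.mem_iff 0).2 (.inl rfl)
      refine ⟨((hFυ.setArr _ _ (by simp [Prog.dedupe])).setReg _ (by simp [Prog.dedupe])).setReg _ (by simp [Prog.dedupe]),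
        C ++ [f j],
        ⟨?_, ?_, ?_⟩, ?_, ?_⟩
      · simp only [List.nodup_append, hC.nodup, List.nodup_singleton]
        exact ⟨trivial, trivial, fun a ha b hb h => he (by rw [List.mem_singleton] at hb; rwa [← hb, ← h])⟩
      · rw [List.idxOf_append_of_mem hzero, hC.idxOf_zero]
      · intro x
        rw [List.mem_append, hC.mem_iff, List.mem_singleton]
        constructor
        · rintro ((h | ⟨i, hi, h⟩) | h)
          exacts [.inl h, .inr ⟨i, by omega, h⟩, .inr ⟨j, by omega, h.symm⟩]
        · rintro (h | ⟨i, hi, h⟩)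
          · exact .inl (.inl h)
          · obtain hi | rfl := Nat.lt_succ_iff_lt_or_eq.1 hi
            exacts [.inl (.inr ⟨i, hi, h⟩), .inr h.symm]
      · simp only [exec, Mem.setReg_arr, Mem.setReg_reg, Mem.setArr_reg, Reg.scratch.injEq,
          Exp.eval, h1, if_false, if_true, one_ne_zero, List.range_succ, List.map_append]
        congr 1
        · conv_rhs => rw [← hold]
          refine List.map_inj_left.2 fun i hi => ?_
          have hi : i ≠ C.length := (List.mem_range.1 hi).ne
          simp [hi]
        · simp [hl]
      · intro i hi
        simp only [exec, Mem.setReg_arr, Exp.eval, Mem.setArr_arr, Arr.scratch.injEq, one_ne_zero,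
          false_and, if_false]
        obtain hi | rfl := Nat.lt_succ_iff_lt_or_eq.1 hi
        · rw [h3 i hi, hrank i hi, List.idxOf_append_of_mem (hC.mem hi)]
        · rw [h4, List.idxOf_append_of_notMem he]
          simp [List.idxOf_eq_length_iff.2 he]
    · have he : f j ∈ C := by
        have : C.idxOf (f j) ≠ C.length := by simpa [h0, h1, h4] using he
        rw [← List.idxOf_lt_length_iff]
        have := List.idxOf_le_length (a := f j) (l := C)
        omega
      refine ⟨hFυ.setReg _ (by simp [Prog.dedupe]), C,
        ⟨hC.nodup, hC.idxOf_zero, ?_⟩, ?_, ?_⟩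
      · intro x
        constructor
        · intro hx
          obtain h | ⟨i, hi, h⟩ := (hC.mem_iff x).1 hx
          exacts [.inl h, .inr ⟨i, by omega, h⟩]
        · rintro (rfl | ⟨i, hi, rfl⟩)
          · exact (hC.mem_iff 0).2 (.inl rfl)
          · obtain hi | rfl := Nat.lt_succ_iff_lt_or_eq.1 hi
            exacts [hC.mem hi, he]
      · simpa [h1] using hold
      · intro i hi
        simp only [Mem.setReg_arr]
        obtain hi | rfl := Nat.lt_succ_iff_lt_or_eq.1 hi
        · rw [h3 i hi, hrank i hi]
        · exact h4

end Prog

theorem List.nodup_flatMap_range {α : Type*} {N : ℕ} {f : ℕ → List α}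
    (h : ∀ i < N, (f i).Nodup) (hd : ∀ i < N, ∀ j < N, ∀ x ∈ f i, x ∈ f j → i = j) :
    ((List.range N).flatMap f).Nodup := by
  refine List.nodup_flatMap.2 ⟨fun i hi => h i (List.mem_range.1 hi), ?_⟩
  refine List.Nodup.pairwise_of_forall_ne List.nodup_range fun i hi j hj hij => ?_
  exact fun x hx hx' => hij (hd i (List.mem_range.1 hi) j (List.mem_range.1 hj) x hx hx')

theorem Prog.IsNumbering.exists_index {f : ℕ → ℕ} {N : ℕ} {C : List ℕ} (h : IsNumbering f N C)
    {R : ℕ} {c : ℕ → ℕ} (hc : (List.range R).map c = C) (x : ℕ) :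
    (∃ j < R, c j = x) ↔ x = 0 ∨ ∃ j < N, f j = x := by
  rw [← h.mem_iff, ← hc]
  simp

theorem Prog.IsNumbering.index_injective {f : ℕ → ℕ} {N : ℕ} {C : List ℕ}
    (h : IsNumbering f N C) {R : ℕ} {c : ℕ → ℕ} (hc : (List.range R).map c = C) {i j : ℕ}
    (hi : i < R) (hj : j < R) (hij : c i = c j) : i = j := by
  have := h.nodup
  rw [← hc] at this
  exact List.inj_on_of_nodup_map this (List.mem_range.2 hi) (List.mem_range.2 hj) hij

theorem Prog.IsNumbering.index_zero {f : ℕ → ℕ} {N : ℕ} {C : List ℕ}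
    (h : IsNumbering f N C) {R : ℕ} {c : ℕ → ℕ} (hc : (List.range R).map c = C) :
    0 < R ∧ c 0 = 0 := by
  have h0 := h.zero_mem
  have h1 : C[C.idxOf 0]'(List.idxOf_lt_length_iff.2 h0) = 0 := List.getElem_idxOf _
  have hl : C.length = R := by simp [← hc]
  have h2 := List.idxOf_lt_length_iff.2 h0
  simp only [h.idxOf_zero] at h1 h2
  refine ⟨by omega, ?_⟩
  simpa [← hc] using h1

/-! ### Constructing the channel transducer. -/

namespace Prog

/-- Construct the channel transducer. -/
def channel : Prog :=
  dedupe (.add (.arr (.inp .input) (.reg (.scratch 0))) (.const 1)) (.numTrans .input) ;;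
  (.set (.numStates .channel) (.add (.reg .k) (.const 1)) ;; .set (.start .channel) (.const 0) ;;
    .set (.numTrans .channel) (.const 0)) ;;
  loop (.scratch 3) (.numStates .channel)
    (.write (.final .channel) (.reg (.scratch 3)) (.const 1)) ;;
  loop (.scratch 3) (.numStates .channel) (loop (.scratch 4) (.scratch 1)
    (.ite (.reg (.scratch 4))
      (push (.numTrans .channel) (.src .channel) (.inp .channel) (.out .channel) (.dst .channel)
        (.reg (.scratch 3)) (.arr (.scratch 0) (.reg (.scratch 4)))
        (.arr (.scratch 0) (.reg (.scratch 4))) (.reg (.scratch 3)))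
      .skip)) ;;
  loop (.scratch 3) .k (loop (.scratch 4) (.scratch 1) (loop (.scratch 5) (.scratch 1)
    (.ite (.eq (.reg (.scratch 4)) (.reg (.scratch 5))) .skip
      (push (.numTrans .channel) (.src .channel) (.inp .channel) (.out .channel) (.dst .channel)
        (.reg (.scratch 3)) (.arr (.scratch 0) (.reg (.scratch 4)))
        (.arr (.scratch 0) (.reg (.scratch 5))) (.add (.reg (.scratch 3)) (.const 1))))))

/-- The list of the transitions of the channel transducer that `channel` constructs, where `c`
numbers the labels. -/
def channelList (R k : ℕ) (c : ℕ → ℕ) : List Quad :=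
  ((List.range (k + 1)).flatMap fun i => (List.range R).flatMap fun j =>
    if j = 0 then [] else [(i, c j, c j, i)]) ++
  (List.range k).flatMap fun i => (List.range R).flatMap fun j => (List.range R).flatMap fun j' =>
    if j = j' then [] else [(i, c j, c j', i + 1)]

/-- All that follows the numbering, which enters only through the number `R` of labels and their
codes `c`. The index `0` stands for the empty word and is skipped in the loops that keep the state,
since `ε/ε` labels no transition. -/
theorem Ter.channel_lists {σ : Mem} {R k : ℕ} {c : ℕ → ℕ} (hR : σ.reg (.scratch 1) = R)
    (hk : σ.reg .k = k) (hc : σ.arr (.scratch 0) = c) :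
    ((Prog.set (.numStates .channel) (.add (.reg .k) (.const 1)) ;;
        .set (.start .channel) (.const 0) ;; .set (.numTrans .channel) (.const 0)) ;;
    Prog.loop (.scratch 3) (.numStates .channel)
      (.write (.final .channel) (.reg (.scratch 3)) (.const 1)) ;;
    Prog.loop (.scratch 3) (.numStates .channel) (Prog.loop (.scratch 4) (.scratch 1)
      (.ite (.reg (.scratch 4))
        (Prog.push (.numTrans .channel) (.src .channel) (.inp .channel) (.out .channel)
          (.dst .channel) (.reg (.scratch 3)) (.arr (.scratch 0) (.reg (.scratch 4)))
          (.arr (.scratch 0) (.reg (.scratch 4))) (.reg (.scratch 3)))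
        .skip)) ;;
    Prog.loop (.scratch 3) .k (Prog.loop (.scratch 4) (.scratch 1)
      (Prog.loop (.scratch 5) (.scratch 1)
      (.ite (.eq (.reg (.scratch 4)) (.reg (.scratch 5))) .skip
        (Prog.push (.numTrans .channel) (.src .channel) (.inp .channel) (.out .channel)
          (.dst .channel) (.reg (.scratch 3)) (.arr (.scratch 0) (.reg (.scratch 4)))
          (.arr (.scratch 0) (.reg (.scratch 5))) (.add (.reg (.scratch 3)) (.const 1))))))).Ter σ
    (8 + (((k + 1) * 13 + 8) + (((k + 1) * ((R * 30 + 8) + 10) + 8) +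
      (k * ((R * ((R * 45 + 8) + 10) + 8) + 10) + 8))))
    (fun τ => τ.reg (.numStates .channel) = k + 1 ∧ τ.reg (.start .channel) = 0 ∧
      (∀ i < k + 1, τ.arr (.final .channel) i = 1) ∧ τ.transList .channel = channelList R k c) := by
  refine Ter.seq (Ter.straight (Q := fun τ => τ.reg (.numStates .channel) = k + 1 ∧
    τ.reg (.start .channel) = 0 ∧ τ.reg (.numTrans .channel) = 0) (by decide)
    (by simp [exec, hk]) |>.imp ?_)
  rintro τ1 hF1 ⟨hs1, ht1, hn1⟩ -
  refine Ter.seq (Ter.loop (fun j τ => ∀ i < j, τ.arr (.final .channel) i = 1) 3 (k + 1) hs1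
    (by decide) (by decide) (by decide) (by simp) ?_ |>.imp ?_)
  · intro j hj τ hF hij hI
    refine Ter.straight (by decide) ?_
    intro i hi
    simp only [exec, Mem.setReg_arr, Mem.setArr_arr, Exp.eval, hij, true_and]
    split_ifs with h
    · rfl
    · exact hI i (by omega)
  rintro τ2 hF2 hf2 -
  have hl2 : τ2.transList .channel = [] := by
    rw [Mem.transList, Mem.list, hF2.reg _ (by decide), hn1]
    rfl
  refine Ter.seq (Ter.loop_append (fun i => (List.range R).flatMap fun j =>
    if j = 0 then [] else [(i, c j, c j, i)]) (R * 30 + 8) (k + 1)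
    ((hF2.reg _ (by decide)).trans hs1) (by decide) (by decide) (by decide) (by decide) hl2 ?_
    |>.imp ?_)
  · intro i hi τ hF hτi l hl
    have hR' : τ.reg (.scratch 1) = R := by
      rw [hF.reg _ (by decide), hF2.reg _ (by decide), hF1.reg _ (by decide), hR]
    refine Ter.loop_append _ 20 R hR' (by decide) (by decide) (by decide) (by decide) hl ?_
    intro j hj υ hF' hυj l' hl'
    have hc' : υ.arr (.scratch 0) = c := by
      rw [hF'.arr _ (by decide), hF.arr _ (by decide), hF2.arr _ (by decide),
        hF1.arr _ (by decide), hc]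
    have hi' : υ.reg (.scratch 3) = i := by rw [hF'.reg _ (by decide), hτi]
    refine Ter.ite (B := 18) (fun he => ?_) fun he => ?_
    · simp only [Exp.eval, hυj] at he
      refine Ter.push (v := (i, c j, c j, i)) (l := l') (by decide) hl' (by decide) ?_ |>.imp
        fun ω _ h => by rw [h, if_neg he]
      intro ω hr ha
      simp [hr, ha, hc', hυj, hi']
    · simp only [Exp.eval, hυj] at he
      exact (Ter.skip (by simp [hl', he])).le (by omega)
  rintro τ3 hF3 hl3 -
  refine (Ter.loop_append (fun i => (List.range R).flatMap fun j => (List.range R).flatMap fun j' =>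
    if j = j' then [] else [(i, c j, c j', i + 1)]) _ k
    (by rw [hF3.reg _ (by decide), hF2.reg _ (by decide), hF1.reg _ (by decide), hk])
    (by decide) (by decide) (by decide) (by decide) hl3 ?_).imp ?_
  · intro i hi τ hF hτi l hl
    have hR' : τ.reg (.scratch 1) = R := by
      rw [hF.reg _ (by decide), hF3.reg _ (by decide), hF2.reg _ (by decide),
        hF1.reg _ (by decide), hR]
    refine Ter.loop_append _ (R * 45 + 8) R hR' (by decide) (by decide) (by decide) (by decide)
      hl ?_
    intro j hj υ hF' hυj l hl
    have hR'' : υ.reg (.scratch 1) = R := by rw [hF'.reg _ (by decide), hR']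
    refine Ter.loop_append _ 35 R hR'' (by decide) (by decide) (by decide) (by decide) hl ?_
    intro j' hj' ω hF'' hωj l hl
    have hc' : ω.arr (.scratch 0) = c := by
      rw [hF''.arr _ (by decide), hF'.arr _ (by decide), hF.arr _ (by decide),
        hF3.arr _ (by decide), hF2.arr _ (by decide), hF1.arr _ (by decide), hc]
    have hi' : ω.reg (.scratch 3) = i := by
      rw [hF''.reg _ (by decide), hF'.reg _ (by decide), hτi]
    have hj' : ω.reg (.scratch 4) = j := by rw [hF''.reg _ (by decide), hυj]
    refine Ter.le (B := _ + 20 + 1) (Ter.ite (fun he => ?_) fun he => ?_) (by decide)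
    · have he : j = j' := by simpa [hj', hωj] using he
      exact (Ter.skip (by simp [hl, he])).le (by omega)
    · have he : j ≠ j' := by simpa [hj', hωj] using he
      refine Ter.push (v := (i, c j, c j', i + 1)) (l := l) (by decide) hl (by decide) ?_ |>.imp
        fun ω _ h => by rw [h, if_neg he]
      intro ω hr ha
      simp [hr, ha, hc', hωj, hi', hj']
  · intro τ hF hl
    refine ⟨?_, ?_, ?_, hl⟩
    · rw [hF.reg _ (by decide), hF3.reg _ (by decide), hF2.reg _ (by decide), hs1]
    · rw [hF.reg _ (by decide), hF3.reg _ (by decide), hF2.reg _ (by decide), ht1]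
    · intro i hi
      rw [hF.arr _ (by decide), hF3.arr _ (by decide), hf2 i hi]

theorem nodup_channelList {R k : ℕ} {c : ℕ → ℕ}
    (hc : ∀ i < R, ∀ j < R, c i = c j → i = j) : (channelList R k c).Nodup := by
  refine List.nodup_append.2 ⟨?_, ?_, ?_⟩
  · refine List.nodup_flatMap_range (fun i _ => List.nodup_flatMap_range (fun j _ => ?_) ?_) ?_
    · split_ifs <;> simp
    · intro j hj j' hj' x hx hx'
      split_ifs at hx hx' <;> simp_all
      exact hc _ hj _ hj' (by tauto)
    · intro i hi j hj x hx hx'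
      simp only [List.mem_flatMap, List.mem_range] at hx hx'
      obtain ⟨a, -, hx⟩ := hx
      obtain ⟨b, -, hx'⟩ := hx'
      split_ifs at hx hx' <;> simp_all
  · refine List.nodup_flatMap_range (fun i _ => List.nodup_flatMap_range (fun j _ =>
      List.nodup_flatMap_range (fun j' _ => ?_) ?_) ?_) ?_
    · split_ifs <;> simp
    · intro j hj j' hj' x hx hx'
      split_ifs at hx hx' <;> simp_all
      exact hc _ hj _ hj' (by tauto)
    · intro i hi j hj x hx hx'
      simp only [List.mem_flatMap, List.mem_range] at hx hx'
      obtain ⟨a, -, hx⟩ := hx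
      obtain ⟨b, -, hx'⟩ := hx'
      split_ifs at hx hx' <;> simp_all
      exact hc _ hi _ hj (by tauto)
    · intro i hi j hj x hx hx'
      simp only [List.mem_flatMap, List.mem_range] at hx hx'
      obtain ⟨a, -, a', -, hx⟩ := hx
      obtain ⟨b, -, b', -, hx'⟩ := hx'
      split_ifs at hx hx' <;> simp_all
  · intro x hx y hy
    simp only [List.mem_flatMap, List.mem_range] at hx hy
    obtain ⟨i, -, j, -, hx⟩ := hx
    obtain ⟨i', -, a, -, b, -, hy⟩ := hy
    split_ifs at hx hy <;> simp_all

/-- Injectivity of `c` below `R` turns "different indices" into "different labels", and index `0`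
into the empty word. -/
theorem mem_channelList {R k : ℕ} {c : ℕ → ℕ} {S : Finset ℕ} {n : ℕ} {num : Fin (k + 1) ≃ Fin n}
    (hnum : ∀ i, (num i : ℕ) = i)
    (hc : ∀ i < R, ∀ j < R, c i = c j → i = j) (hR : 0 < R) (hc0 : c 0 = 0)
    (hS : ∀ x, (∃ j < R, c j = x) ↔ x = 0 ∨ ∃ a ∈ S, a + 1 = x) (x : Quad) :
    x ∈ channelList R k c ↔ ∃ t ∈ (sidTransducer S k).trans, transRecord num t = x := by
  have hlab : ∀ x, (∃ j < R, c j = x) ↔ ∃ o ∈ Finset.insertNone S, labelCode o = x := by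
    intro x
    rw [hS]
    constructor
    · rintro (rfl | ⟨a, ha, rfl⟩)
      exacts [⟨none, by simp, rfl⟩, ⟨some a, by simpa using ha, rfl⟩]
    · rintro ⟨_ | a, ha, rfl⟩
      exacts [.inl rfl, .inr ⟨a, by simpa using ha, rfl⟩]
  constructor
  · intro hx
    simp only [channelList, List.mem_append, List.mem_flatMap, List.mem_range] at hx
    obtain ⟨i, hi, j, hj, hx⟩ | ⟨i, hi, j, hj, j', hj', hx⟩ := hx
    · split_ifs at hx with h
      · simp at hx
      obtain h' | ⟨a, ha, hja⟩ := (hS (c j)).1 ⟨j, hj, rfl⟩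
      · exact absurd (hc j hj 0 hR (by rw [hc0, h'])) h
      · simp only [List.mem_singleton] at hx
        refine ⟨(⟨i, hi⟩, some a, some a, ⟨i, hi⟩), ?_, ?_⟩
        · simp [sidTransducer, ha]
        · simp [transRecord, hnum, hx, labelCode, hja]
    · split_ifs at hx with h
      · simp at hx
      obtain ⟨o, ho, hoj⟩ := (hlab (c j)).1 ⟨j, hj, rfl⟩
      obtain ⟨o', ho', hoj'⟩ := (hlab (c j')).1 ⟨j', hj', rfl⟩
      simp only [List.mem_singleton] at hx
      refine ⟨(Fin.castSucc ⟨i, hi⟩, o, o', Fin.succ ⟨i, hi⟩), ?_, ?_⟩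
      · simp only [sidTransducer, Finset.mem_union, Finset.mem_image]
        refine .inr ⟨(⟨i, hi⟩, o, o'), ?_, rfl⟩
        simp only [Finset.mem_product, Finset.mem_univ, true_and, Finset.mem_filter]
        refine ⟨⟨ho, ho'⟩, ?_⟩
        rintro rfl
        exact h (hc j hj j' hj' (by rw [← hoj, ← hoj']))
      · simp [transRecord, hnum, hx, hoj, hoj']
  · rintro ⟨t, ht, rfl⟩
    simp only [sidTransducer, Finset.mem_union, Finset.mem_image] at ht
    simp only [channelList, List.mem_append, List.mem_flatMap, List.mem_range]
    obtain ⟨⟨i, a⟩, hia, rfl⟩ | ⟨⟨i, o, o'⟩, hio, rfl⟩ := ht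
    · obtain ⟨j, hj, hja⟩ := (hS (a + 1)).2 (.inr ⟨a, by simpa using hia, rfl⟩)
      refine .inl ⟨i, i.2, j, hj, ?_⟩
      rw [if_neg (by rintro rfl; omega)]
      simp [transRecord, hnum, labelCode, hja]
    · simp only [Finset.mem_product, Finset.mem_univ, true_and, Finset.mem_filter] at hio
      obtain ⟨⟨ho, ho'⟩, hne⟩ := hio
      obtain ⟨j, hj, hjo⟩ := (hlab _).2 ⟨o, ho, rfl⟩
      obtain ⟨j', hj', hjo'⟩ := (hlab _).2 ⟨o', ho', rfl⟩
      refine .inr ⟨i, i.2, j, hj, j', hj', ?_⟩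
      rw [if_neg]
      · simp [transRecord, hnum, hjo, hjo']
      · rintro rfl
        exact hne (labelCode_injective (by rw [← hjo, hjo']))

/-- The automaton stores a symbol `a` as `a`, transducers store it as `a + 1`. Numbering the values
`a + 1` together with `0` therefore enumerates the codes of all labels of the channel, at most
`A.alphabet.card + 1` of them; this explains the square of that number in the bound. -/
theorem Ter.channel {Q : Type} [Fintype Q] {A : Automaton Q} {σ : Mem} {k : ℕ}
    (hA : σ.HoldsAutomaton A) (hk : σ.reg .k = k) :
    channel.Ter σ (200 * ((A.trans.card + k + 1) * (A.alphabet.card + 1) ^ 2))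
      (fun τ => τ.HoldsTransducer .channel (sidTransducer A.alphabet k)) := by
  obtain ⟨num, hnd, hmem, h1, h2, h3, h4⟩ := hA.elim
  have hinp : ∀ x, (∃ j < A.trans.card, σ.arr (.inp .input) j = x) ↔ x ∈ A.alphabet := by
    intro x
    simp only [Automaton.alphabet, Finset.mem_image]
    constructor
    · rintro ⟨j, hj, rfl⟩
      obtain ⟨t, ht, h⟩ := (hmem _).1 (Mem.mem_list.2 ⟨j, h4 ▸ hj, rfl⟩)
      exact ⟨t, ht, congrArg (fun x : Quad => x.2.1) h⟩
    · rintro ⟨t, ht, rfl⟩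
      obtain ⟨j, hj, h⟩ := Mem.mem_list.1 ((hmem _).2 ⟨t, ht, rfl⟩)
      exact ⟨j, h4 ▸ hj, congrArg (fun x : Quad => x.2.1) h⟩
  set S' : Finset ℕ := insert 0 (A.alphabet.image (· + 1)) with hS'
  have hcard : S'.card ≤ A.alphabet.card + 1 :=
    (Finset.card_insert_le _ _).trans (Nat.succ_le_succ Finset.card_image_le)
  have hlen : ∀ m ≤ A.trans.card, ∀ C, IsNumbering (fun j => σ.arr (.inp .input) j + 1) m C →
      C.length ≤ A.alphabet.card + 1 := fun m hm C hC =>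
    (hC.length_le (S := S') (by simp [hS']) fun j hj => by
      simpa [hS'] using (hinp _).1 ⟨j, hj.trans_le hm, rfl⟩).trans hcard
  set s := A.alphabet.card + 1 with hs
  set E := A.trans.card
  have hd := Ter.dedupe (lab := .add (.arr (.inp .input) (.reg (.scratch 0))) (.const 1)) h4
    (by decide) (by decide) (f := fun j => σ.arr (.inp .input) j + 1) (R := s)
    (by
      intro j hj τ hF h0
      simp [h0, hF.arr (.inp .input) (by decide)]) hlen
  refine (Ter.seq (B' := 8 + (((k + 1) * 13 + 8) + (((k + 1) * ((s * 30 + 8) + 10) + 8) +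
      (k * ((s * ((s * 45 + 8) + 10) + 8) + 10) + 8)))) (hd.imp ?_)).le ?_
  · rintro τ hF ⟨C, hC, hcode, -⟩ -
    have hCl := hlen _ le_rfl C hC
    have hRC : C.length = τ.reg (.scratch 1) := by simp [← hcode]
    obtain ⟨hR0, hc0⟩ := hC.index_zero hcode
    refine (Ter.channel_lists rfl ((hF.reg _ (by decide)).trans hk) rfl).mono ?_ ?_
    · rw [hRC] at hCl
      gcongr
    rintro υ - ⟨e1, e2, e3, e4⟩
    refine Mem.holdsTransducer_iff.2 ⟨finCongr (Fintype.card_fin _).symm, ?_, ?_, ?_, ?_, ?_⟩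
    · rw [e4]
      exact nodup_channelList fun i hi j hj => hC.index_injective hcode hi hj
    · intro x
      rw [e4]
      refine mem_channelList (fun i => rfl) (fun i hi j hj => hC.index_injective hcode hi hj)
        hR0 hc0 (fun x => ?_) x
      rw [hC.exists_index hcode]
      refine or_congr_right ⟨?_, ?_⟩
      · rintro ⟨j, hj, rfl⟩
        exact ⟨_, (hinp _).1 ⟨j, hj, rfl⟩, rfl⟩
      · rintro ⟨a, ha, rfl⟩
        obtain ⟨j, hj, rfl⟩ := (hinp _).2 ha
        exact ⟨j, hj, rfl⟩
    · simp [e1]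
    · simp [e2, sidTransducer]
    · intro p
      exact ⟨fun _ => e3 p p.2, fun h => absurd (Finset.mem_univ p) h⟩
  · have : 1 ≤ s := by omega
    nlinarith [Nat.mul_le_mul_left E (show s ≤ s ^ 2 by nlinarith),
      Nat.mul_le_mul_left k (show s ≤ s ^ 2 by nlinarith),
      Nat.mul_le_mul_left E this, Nat.mul_le_mul_left k this, show s ≤ s ^ 2 by nlinarith]

end Prog

/-! ### Constructing the product transducer. -/

theorem List.nodup_flatMap_of_disjoint {α β : Type*} {l : List α} {f : α → List β} (hl : l.Nodup)
    (h : ∀ x ∈ l, (f x).Nodup) (hd : ∀ x ∈ l, ∀ y ∈ l, ∀ z ∈ f x, z ∈ f y → x = y) :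
    (l.flatMap f).Nodup := by
  refine List.nodup_flatMap.2 ⟨h, ?_⟩
  refine List.Nodup.pairwise_of_forall_ne hl fun x hx y hy hxy => ?_
  exact fun z hz hz' => hxy (hd x hx y hy z hz hz')

namespace Prog

/-- The records visited are those of the initial memory, so nested loops are described by nested
`flatMap`s over fixed lists. -/
theorem Ter.loop_forEach {i n m : Reg} {a b c d a' b' c' d' : Arr} {p : Prog} {σ : Mem}
    {l₀ : List Quad} (g : Quad → List Quad) {l : List Quad} (B : ℕ)
    (h₀ : σ.list n a' b' c' d' = l₀)
    (hi : p.writesReg i = false) (hn : p.writesReg n = false) (hin : n ≠ i) (hm : m ≠ i)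
    (hl : σ.list m a b c d = l)
    (hs : ∀ j < l₀.length, ∀ τ, (Prog.loop i n p).Frame σ τ → τ.reg i = j →
      σ.row a' b' c' d' j ∈ l₀ → ∀ l',
      τ.list m a b c d = l' →
        p.Ter τ B (fun υ => υ.list m a b c d = l' ++ g (σ.row a' b' c' d' j))) :
    (Prog.loop i n p).Ter σ (l₀.length * (B + 10) + 8)
      (fun τ => τ.list m a b c d = l ++ l₀.flatMap g) := by
  have hlen : σ.reg n = l₀.length := by simp [← h₀]
  refine (Ter.loop_append (fun j => g (σ.row a' b' c' d' j)) B l₀.length hlen hi hn hin hm hl ?_).imp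
    fun τ _ h => ?_
  · intro j hj τ hF hij l' hl'
    exact hs j hj τ hF hij (h₀ ▸ Mem.row_mem_list (hlen ▸ hj) _ _ _ _) l' hl'
  · rw [h, ← h₀, Mem.list, List.flatMap_map, List.length_map, List.length_range, hlen]

/-- Fill `t` with the multiples of `n`; the product of `n` and the number of entries ends
up in `acc`. -/
def mulTable (t : Arr) (acc i n cnt : Reg) : Prog :=
  .set acc (.const 0) ;;
  loop i cnt (.write t (.reg i) (.reg acc) ;; .set acc (.add (.reg acc) (.reg n)))

/-- The machine has no multiplication. Products with a fixed factor are read from a table filled by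
repeated addition. -/
theorem Ter.mulTable {t : Arr} {acc i n cnt : Reg} {σ : Mem} {m N : ℕ}
    (hne : [acc, i, n].Nodup) (hc : cnt ≠ acc) (hc' : cnt ≠ i)
    (hn : σ.reg n = m) (hN : σ.reg cnt = N) :
    (Prog.mulTable t acc i n cnt).Ter σ (N * 18 + 10)
      (fun τ => (∀ j < N, τ.arr t j = j * m) ∧ τ.reg acc = N * m) := by
  simp only [List.nodup_cons, List.mem_cons, List.not_mem_nil, or_false, not_or] at hne
  obtain ⟨⟨hai, han⟩, hin, -⟩ := hne
  refine (Ter.seq (B' := N * (8 + 10) + 8) ((Ter.set (Q := fun τ => τ.reg acc = 0 ∧ τ.reg n = m ∧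
    τ.reg cnt = N) ?_).imp ?_)).le (by simp only [Exp.cost]; omega)
  · simp [hn, hN, Ne.symm han, hc]
  rintro τ1 hF1 ⟨h1, h2, h3⟩ -
  refine (Ter.loop (fun j τ => (∀ j' < j, τ.arr t j' = j' * m) ∧ τ.reg acc = j * m ∧ τ.reg n = m)
    8 N h3 ?_ ?_ hc' ?_ ?_).imp fun τ _ h => ⟨h.1, h.2.1⟩
  · simp [Ne.symm hai]
  · simp [hc]
  · simp [hai, h1, Ne.symm hin, h2]
  · rintro j hj τ hF hij ⟨h4, h5, h6⟩
    refine Ter.straight (by rfl) ⟨?_, ?_, ?_⟩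
    · intro j' hj'
      simp only [exec, Exp.eval, Mem.setReg_arr, Mem.setArr_arr, hij, true_and, h5]
      split_ifs with h
      · rw [h]
      · exact h4 j' (by omega)
    · simp [exec, h5, h6, hai]
      ring
    · simp [exec, Ne.symm hin, Ne.symm han, h6]

/-- Construct the list of the moves of the given automaton, including those on the empty word. -/
def moveList : Prog :=
  .set (.scratch 6) (.const 0) ;;
  loop (.scratch 3) (.numTrans .input)
    (push (.scratch 6) (.scratch 2) (.scratch 3) (.scratch 4) (.scratch 5)
      (.arr (.src .input) (.reg (.scratch 3)))
      (.add (.arr (.inp .input) (.reg (.scratch 3))) (.const 1)) (.const 0)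
      (.arr (.dst .input) (.reg (.scratch 3)))) ;;
  loop (.scratch 3) (.numStates .input)
    (push (.scratch 6) (.scratch 2) (.scratch 3) (.scratch 4) (.scratch 5)
      (.reg (.scratch 3)) (.const 0) (.const 0) (.reg (.scratch 3)))

/-- The list that `moveList` constructs. -/
def movesOf (l : List Quad) (n : ℕ) : List Quad :=
  (l.flatMap fun t => [(t.1, t.2.1 + 1, 0, t.2.2.2)]) ++
    (List.range n).flatMap fun q => [(q, 0, 0, q)]

theorem length_movesOf (l : List Quad) (n : ℕ) : (movesOf l n).length = l.length + n := by
  simp [movesOf, List.length_flatMap]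

theorem Ter.moveList {σ : Mem} {n : ℕ} (hn : σ.reg (.numStates .input) = n) :
    moveList.Ter σ ((σ.autList.length + n) * 40 + 20) (fun τ =>
      τ.list (.scratch 6) (.scratch 2) (.scratch 3) (.scratch 4) (.scratch 5) =
        movesOf σ.autList n) := by
  refine (Ter.seq (B := 2) (B' := (σ.autList.length * (30 + 10) + 8) + (n * (30 + 10) + 8))
    (Ter.straight (Q := fun τ => τ.reg (.scratch 6) = 0) (by decide)
      (by simp [exec]) |>.imp ?_)).le (by omega)
  rintro τ1 hF1 h1 -
  have hl : τ1.autList = σ.autList := Mem.list_congr (hF1.reg _ (by decide)) (hF1.arr _ (by decide))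
    (hF1.arr _ (by decide)) (hF1.arr _ (by decide)) (hF1.arr _ (by decide))
  refine Ter.seq (Ter.loop_forEach (fun t => [(t.1, t.2.1 + 1, 0, t.2.2.2)]) 30 hl (by decide)
    (by decide) (by decide) (by decide) (m := .scratch 6) (a := .scratch 2) (b := .scratch 3)
    (c := .scratch 4) (d := .scratch 5) (l := []) (by simp [Mem.list, h1]) ?_ |>.imp ?_)
  · intro j hj τ hF hij _ l' hl'
    refine Ter.push (by decide) hl' (by decide) ?_
    intro ω hr ha
    simp [hr, ha, hij, Mem.row, hF.arr (.src .input) (by decide), hF.arr (.inp .input) (by decide),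
      hF.arr (.dst .input) (by decide)]
  · intro τ2 hF2 h2 _
    refine (Ter.loop_append (fun q => [(q, 0, 0, q)]) 30 n ?_ (by decide) (by decide) (by decide)
      (by decide) h2 ?_)
    · rw [hF2.reg _ (by decide), hF1.reg _ (by decide), hn]
    · intro j hj τ hF hij l' hl'
      refine Ter.push (by decide) hl' (by decide) ?_
      intro ω hr ha
      simp [hr, hij]

end Prog

section Moves

variable {Q : Type} {n : ℕ}

/-- The record of a move of an automaton. -/
def moveRecord (num : Q ≃ Fin n) (m : Q × Option ℕ × Q) : Quad :=
  (num m.1, labelCode m.2.1, 0, num m.2.2)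

/-- A move carries the label code used for transducers, `0` for staying and `a + 1` for reading `a`,
so moves and transducer labels can be compared directly. The third field is only padding. -/
theorem mem_movesOf {num : Q ≃ Fin n} {A : Automaton Q} {l : List Quad}
    (hl : ∀ x, x ∈ l ↔ ∃ t ∈ A.trans, autRecord num t = x) (x : Quad) :
    x ∈ Prog.movesOf l n ↔ ∃ m, A.Moves m.1 m.2.1 m.2.2 ∧ moveRecord num m = x := by
  simp only [Prog.movesOf, List.mem_append, List.mem_flatMap, List.mem_range, List.mem_singleton]
  constructor
  · rintro (⟨t, ht, rfl⟩ | ⟨q, hq, rfl⟩)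
    · obtain ⟨⟨p, a, q⟩, ht', rfl⟩ := (hl t).1 ht
      exact ⟨(p, some a, q), ht', rfl⟩
    · exact ⟨(num.symm ⟨q, hq⟩, none, num.symm ⟨q, hq⟩), rfl, by simp [moveRecord, labelCode]⟩
  · rintro ⟨⟨p, _ | a, q⟩, h, rfl⟩
    · obtain rfl : p = q := h
      exact .inr ⟨num p, (num p).2, rfl⟩
    · exact .inl ⟨_, (hl _).2 ⟨_, h, rfl⟩, rfl⟩

theorem nodup_movesOf {num : Q ≃ Fin n} {A : Automaton Q} {l : List Quad}
    (hl : ∀ x, x ∈ l ↔ ∃ t ∈ A.trans, autRecord num t = x) (hnd : l.Nodup) :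
    (Prog.movesOf l n).Nodup := by
  refine List.nodup_append.2 ⟨?_, ?_, ?_⟩
  · refine List.nodup_flatMap_of_disjoint hnd (by simp) ?_
    intro x hx y hy z hz hz'
    obtain ⟨t, -, rfl⟩ := (hl x).1 hx
    obtain ⟨t', -, rfl⟩ := (hl y).1 hy
    simp only [List.mem_singleton] at hz hz'
    rw [hz'] at hz
    simp_all [autRecord]
  · exact List.nodup_flatMap_range (by simp) (by simp)
  · intro x hx y hy
    simp only [List.mem_flatMap, List.mem_range, List.mem_singleton] at hx hy
    obtain ⟨t, -, rfl⟩ := hx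
    obtain ⟨t', -, rfl⟩ := hy
    simp

end Moves

/-- The numbering of triples of states. -/
def prodNum {P Q : Type} [Fintype P] [Fintype Q] (num : P ≃ Fin (Fintype.card P))
    (num' : Q ≃ Fin (Fintype.card Q)) : P × Q × Q ≃ Fin (Fintype.card (P × Q × Q)) :=
  ((num.prodCongr ((num'.prodCongr num').trans finProdFinEquiv)).trans finProdFinEquiv).trans
    (finCongr (by simp))

theorem prodNum_val {P Q : Type} [Fintype P] [Fintype Q] (num : P ≃ Fin (Fintype.card P))
    (num' : Q ≃ Fin (Fintype.card Q)) (x : P × Q × Q) :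
    (prodNum num num' x : ℕ) = num x.1 * (Fintype.card Q * Fintype.card Q) +
      num' x.2.1 * Fintype.card Q + num' x.2.2 := by
  simp [prodNum, finProdFinEquiv]
  ring

namespace Prog

/-- Construct the product transducer. -/
def product : Prog :=
  moveList ;;
  mulTable (.scratch 6) (.scratch 7) (.scratch 3) (.numStates .input) (.numStates .input) ;;
  mulTable (.scratch 7) (.numStates .product) (.scratch 3) (.scratch 7) (.numStates .channel) ;;
  (.set (.start .product) (.add (.add (.arr (.scratch 7) (.reg (.start .channel)))
      (.arr (.scratch 6) (.reg (.start .input)))) (.reg (.start .input))) ;;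
    .set (.numTrans .product) (.const 0)) ;;
  loop (.scratch 3) (.numStates .channel) (loop (.scratch 4) (.numStates .input)
    (loop (.scratch 5) (.numStates .input)
      (.write (.final .product)
        (.add (.add (.arr (.scratch 7) (.reg (.scratch 3))) (.arr (.scratch 6) (.reg (.scratch 4))))
          (.reg (.scratch 5)))
        (.le (.const 3) (.add (.add (.arr (.final .channel) (.reg (.scratch 3)))
          (.arr (.final .input) (.reg (.scratch 4))))
          (.arr (.final .input) (.reg (.scratch 5)))))))) ;;
  loop (.scratch 3) (.numTrans .channel) (loop (.scratch 4) (.scratch 6)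
    (.ite (.eq (.arr (.scratch 3) (.reg (.scratch 4))) (.arr (.inp .channel) (.reg (.scratch 3))))
      (loop (.scratch 5) (.scratch 6)
        (.ite
          (.eq (.arr (.scratch 3) (.reg (.scratch 5))) (.arr (.out .channel) (.reg (.scratch 3))))
          (push (.numTrans .product) (.src .product) (.inp .product) (.out .product)
            (.dst .product)
            (.add (.add (.arr (.scratch 7) (.arr (.src .channel) (.reg (.scratch 3))))
              (.arr (.scratch 6) (.arr (.scratch 2) (.reg (.scratch 4)))))
              (.arr (.scratch 2) (.reg (.scratch 5))))
            (.arr (.inp .channel) (.reg (.scratch 3))) (.arr (.out .channel) (.reg (.scratch 3)))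
            (.add (.add (.arr (.scratch 7) (.arr (.dst .channel) (.reg (.scratch 3))))
              (.arr (.scratch 6) (.arr (.scratch 5) (.reg (.scratch 4)))))
              (.arr (.scratch 5) (.reg (.scratch 5)))))
          .skip))
      .skip))

/-- The list of the transitions of the product that `product` constructs, for an automaton
with `n` states. -/
def productList (n : ℕ) (l m : List Quad) : List Quad :=
  l.flatMap fun t => m.flatMap fun u => if u.2.1 = t.2.1 then m.flatMap fun v =>
    if v.2.1 = t.2.2.1 then [(t.1 * (n * n) + u.1 * n + v.1, t.2.1, t.2.2.1,
      t.2.2.2 * (n * n) + u.2.2.2 * n + v.2.2.2)] else [] else []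

/-- The labels of the two moves are forced by the transition of `T`, and the code of a triple
determines the triple. Hence the record of a product transition determines the transition and both
moves it came from. -/
theorem nodup_productList {P Q : Type} [Fintype P] [Fintype Q] {num : P ≃ Fin (Fintype.card P)}
    {num' : Q ≃ Fin (Fintype.card Q)} {T : Transducer P} {A : Automaton Q} {l m : List Quad}
    (hl : ∀ x, x ∈ l ↔ ∃ t ∈ T.trans, transRecord num t = x) (hnd : l.Nodup)
    (hm : ∀ x, x ∈ m ↔ ∃ t, A.Moves t.1 t.2.1 t.2.2 ∧ moveRecord num' t = x) (hnd' : m.Nodup) :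
    (productList (Fintype.card Q) l m).Nodup := by
  have key : ∀ t ∈ l, ∀ u ∈ m, ∀ v ∈ m, ∀ t' ∈ l, ∀ u' ∈ m, ∀ v' ∈ m,
      u.2.1 = t.2.1 → v.2.1 = t.2.2.1 → u'.2.1 = t'.2.1 → v'.2.1 = t'.2.2.1 →
      (t.1 * (Fintype.card Q * Fintype.card Q) + u.1 * Fintype.card Q + v.1, t.2.1, t.2.2.1,
        t.2.2.2 * (Fintype.card Q * Fintype.card Q) + u.2.2.2 * Fintype.card Q + v.2.2.2) =
      (t'.1 * (Fintype.card Q * Fintype.card Q) + u'.1 * Fintype.card Q + v'.1, t'.2.1, t'.2.2.1,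
        t'.2.2.2 * (Fintype.card Q * Fintype.card Q) + u'.2.2.2 * Fintype.card Q + v'.2.2.2) →
      t = t' ∧ u = u' ∧ v = v' := by
    intro t ht u hu v hv t' ht' u' hu' v' hv' h1 h2 h3 h4 h
    obtain ⟨⟨i, x, y, j⟩, -, rfl⟩ := (hl t).1 ht
    obtain ⟨⟨i', x', y', j'⟩, -, rfl⟩ := (hl t').1 ht'
    obtain ⟨⟨p, a, q⟩, -, rfl⟩ := (hm u).1 hu
    obtain ⟨⟨p', a', q'⟩, -, rfl⟩ := (hm u').1 hu'
    obtain ⟨⟨r, b, s⟩, -, rfl⟩ := (hm v).1 hv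
    obtain ⟨⟨r', b', s'⟩, -, rfl⟩ := (hm v').1 hv'
    simp only [transRecord, moveRecord] at h h1 h2 h3 h4
    rw [← prodNum_val num num' (i, p, r), ← prodNum_val num num' (i', p', r'),
      ← prodNum_val num num' (j, q, s), ← prodNum_val num num' (j', q', s')] at h
    simp only [Prod.mk.injEq, Fin.val_inj, EmbeddingLike.apply_eq_iff_eq] at h
    obtain ⟨⟨rfl, rfl, rfl⟩, hx, hy, rfl, rfl, rfl⟩ := h
    obtain rfl := labelCode_injective hx
    obtain rfl := labelCode_injective hy
    obtain rfl := labelCode_injective (h1.trans h3.symm)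
    obtain rfl := labelCode_injective (h2.trans h4.symm)
    simp
  refine List.nodup_flatMap_of_disjoint hnd (fun t ht => List.nodup_flatMap_of_disjoint hnd'
    (fun u hu => ?_) ?_) ?_
  · split_ifs with h
    · refine List.nodup_flatMap_of_disjoint hnd' (fun v hv => ?_) ?_
      · split_ifs <;> simp
      · intro v hv v' hv' z hz hz'
        split_ifs at hz hz' with h1 h2 <;> simp only [List.not_mem_nil, List.mem_singleton] at hz hz'
        exact (key t ht u hu v hv t ht u hu v' hv' h h1 h h2 (hz.symm.trans hz')).2.2
    · simp
  · intro u hu u' hu' z hz hz'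
    split_ifs at hz hz' with h1 h2 <;> simp only [List.not_mem_nil, List.mem_flatMap] at hz hz'
    obtain ⟨v, hv, hz⟩ := hz
    obtain ⟨v', hv', hz'⟩ := hz'
    split_ifs at hz hz' with h3 h4 <;> simp only [List.not_mem_nil, List.mem_singleton] at hz hz'
    exact (key t ht u hu v hv t ht u' hu' v' hv' h1 h3 h2 h4 (hz.symm.trans hz')).2.1
  · intro t ht t' ht' z hz hz'
    simp only [List.mem_flatMap] at hz hz'
    obtain ⟨u, hu, hz⟩ := hz
    obtain ⟨u', hu', hz'⟩ := hz'
    split_ifs at hz hz' with h1 h2 <;> simp only [List.not_mem_nil, List.mem_flatMap] at hz hz'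
    obtain ⟨v, hv, hz⟩ := hz
    obtain ⟨v', hv', hz'⟩ := hz'
    split_ifs at hz hz' with h3 h4 <;> simp only [List.not_mem_nil, List.mem_singleton] at hz hz'
    exact (key t ht u hu v hv t' ht' u' hu' v' hv' h1 h3 h2 h4 (hz.symm.trans hz')).1

end Prog

theorem Transducer.mem_restrict_trans {P Q : Type} [Fintype P] [Fintype Q] {T : Transducer P}
    {A : Automaton Q} {t : (P × Q × Q) × Option ℕ × Option ℕ × (P × Q × Q)} :
    t ∈ (T.restrict A).trans ↔ (t.1.1, t.2.1, t.2.2.1, t.2.2.2.1) ∈ T.trans ∧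
      A.Moves t.1.2.1 t.2.1 t.2.2.2.2.1 ∧ A.Moves t.1.2.2 t.2.2.1 t.2.2.2.2.2 := by
  classical
  obtain ⟨⟨i, p, q⟩, x, y, i', p', q'⟩ := t
  simp only [restrict, Finset.mem_image, Finset.mem_filter, Finset.mem_product, Finset.mem_univ,
    and_true, Prod.mk.injEq]
  constructor
  · rintro ⟨⟨⟨j, x', y', j'⟩, ⟨r, s⟩, r', s'⟩, h, ⟨rfl, rfl, rfl⟩, rfl, rfl, rfl, rfl, rfl⟩
    exact h
  · intro h
    exact ⟨((i, x, y, i'), (p, q), (p', q')), h, by simp⟩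

namespace Prog

theorem mem_productList {P Q : Type} [Fintype P] [Fintype Q] {num : P ≃ Fin (Fintype.card P)}
    {num' : Q ≃ Fin (Fintype.card Q)} {T : Transducer P} {A : Automaton Q} {l m : List Quad}
    (hl : ∀ x, x ∈ l ↔ ∃ t ∈ T.trans, transRecord num t = x)
    (hm : ∀ x, x ∈ m ↔ ∃ t, A.Moves t.1 t.2.1 t.2.2 ∧ moveRecord num' t = x) (x : Quad) :
    x ∈ productList (Fintype.card Q) l m ↔
      ∃ t ∈ (T.restrict A).trans, transRecord (prodNum num num') t = x := by
  simp only [productList, List.mem_flatMap]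
  constructor
  · rintro ⟨t, ht, u, hu, h⟩
    split_ifs at h with h1 <;> simp only [List.not_mem_nil, List.mem_flatMap] at h
    obtain ⟨v, hv, h⟩ := h
    split_ifs at h with h2 <;> simp only [List.not_mem_nil, List.mem_singleton] at h
    obtain ⟨⟨i, x, y, j⟩, ht', rfl⟩ := (hl t).1 ht
    obtain ⟨⟨p, a, q⟩, hu', rfl⟩ := (hm u).1 hu
    obtain ⟨⟨r, b, s⟩, hv', rfl⟩ := (hm v).1 hv
    obtain rfl := labelCode_injective h1
    obtain rfl := labelCode_injective h2
    refine ⟨((i, p, r), a, b, (j, q, s)), Transducer.mem_restrict_trans.2 ⟨ht', hu', hv'⟩, ?_⟩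
    simp only [transRecord, prodNum_val, h, moveRecord]
  · rintro ⟨⟨⟨i, p, r⟩, a, b, j, q, s⟩, ht, rfl⟩
    obtain ⟨ht, hu, hv⟩ := Transducer.mem_restrict_trans.1 ht
    refine ⟨_, (hl _).2 ⟨_, ht, rfl⟩, _, (hm _).2 ⟨(p, a, q), hu, rfl⟩, ?_⟩
    split_ifs with h
    swap
    · exact absurd rfl h
    refine List.mem_flatMap.2 ⟨_, (hm _).2 ⟨(r, b, s), hv, rfl⟩, ?_⟩
    split_ifs with h
    swap
    · exact absurd rfl h
    simp only [transRecord, prodNum_val, moveRecord, List.mem_singleton]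

end Prog

theorem pair_code_injective {n a b a' b' : ℕ} (hb : b < n) (hb' : b' < n)
    (h : a * n + b = a' * n + b') : a = a' ∧ b = b' := by
  have h1 : (a * n + b) / n = a := by
    rw [add_comm, Nat.add_mul_div_right _ _ (by omega), Nat.div_eq_of_lt hb, zero_add]
  have h2 : (a' * n + b') / n = a' := by
    rw [add_comm, Nat.add_mul_div_right _ _ (by omega), Nat.div_eq_of_lt hb', zero_add]
  obtain rfl : a = a' := by rw [← h1, ← h2, h]
  exact ⟨rfl, by omega⟩

theorem triple_code_injective {n j p q j' p' q' : ℕ} (hp : p < n) (hp' : p' < n) (hq : q < n)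
    (hq' : q' < n) (h : j * (n * n) + p * n + q = j' * (n * n) + p' * n + q') :
    j = j' ∧ p = p' ∧ q = q' := by
  have h' : (j * n + p) * n + q = (j' * n + p') * n + q' := by
    calc _ = j * (n * n) + p * n + q := by ring
      _ = _ := h
      _ = _ := by ring
  obtain ⟨h1, rfl⟩ := pair_code_injective hq hq' h'
  obtain ⟨rfl, rfl⟩ := pair_code_injective hp hp' h1
  simp

namespace Prog

/-- With flags in `{0, 1}`, three of them hold exactly when their sum reaches 3. The predicates `W`
single out the triples already treated, in lexicographic order; injectivity of the code of a triple
protects their cells from later writes. -/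
theorem Ter.product_final {σ : Mem} {P n : ℕ} (hP : σ.reg (.numStates .channel) = P)
    (hn : σ.reg (.numStates .input) = n) (h6 : ∀ p < n, σ.arr (.scratch 6) p = p * n)
    (h7 : ∀ j < P, σ.arr (.scratch 7) j = j * (n * n)) :
    (Prog.loop (.scratch 3) (.numStates .channel) (Prog.loop (.scratch 4) (.numStates .input)
      (Prog.loop (.scratch 5) (.numStates .input)
      (.write (.final .product)
        (.add (.add (.arr (.scratch 7) (.reg (.scratch 3))) (.arr (.scratch 6) (.reg (.scratch 4))))
          (.reg (.scratch 5)))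
        (.le (.const 3) (.add (.add (.arr (.final .channel) (.reg (.scratch 3)))
          (.arr (.final .input) (.reg (.scratch 4))))
          (.arr (.final .input) (.reg (.scratch 5))))))))).Ter σ
      (P * ((n * ((n * (18 + 10) + 8) + 10) + 8) + 10) + 8) (fun τ => ∀ j < P, ∀ p < n, ∀ q < n,
        τ.arr (.final .product) (j * (n * n) + p * n + q) =
          if 3 ≤ σ.arr (.final .channel) j + σ.arr (.final .input) p + σ.arr (.final .input) q
          then 1 else 0) := by
  set G : ℕ → ℕ → ℕ → ℕ := fun j p q =>
    if 3 ≤ σ.arr (.final .channel) j + σ.arr (.final .input) p + σ.arr (.final .input) q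
          then 1 else 0 with hG
  set I : (ℕ → ℕ → ℕ → Prop) → Mem → Prop := fun W τ => ∀ j < P, ∀ p < n, ∀ q < n, W j p q →
    τ.arr (.final .product) (j * (n * n) + p * n + q) = G j p q with hI
  refine (Ter.loop (fun i τ => I (fun j _ _ => j < i) τ) _ P hP (by decide) (by decide) (by decide)
    (fun j hj p hp q hq h => by omega) ?_).imp fun τ _ h j hj p hp q hq => h j hj p hp q hq hj
  intro i hi τ hF hτi hIτ
  refine (Ter.loop (fun i' τ => I (fun j p _ => j < i ∨ j = i ∧ p < i') τ) (n * (18 + 10) + 8) n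
    ((hF.reg _ (by decide)).trans hn) (by decide) (by decide) (by decide)
    (fun j hj p hp q hq h => hIτ j hj p hp q hq (by omega)) ?_).imp
    fun τ _ h j hj p hp q hq h' => h j hj p hp q hq (by omega)
  intro i' hi' υ hF' hυi hIυ
  refine (Ter.loop (fun i'' τ => I (fun j p q => (j < i ∨ j = i ∧ p < i') ∨ j = i ∧ p = i' ∧ q < i'')
    τ) 18 n
    (by rw [hF'.reg _ (by decide), hF.reg _ (by decide), hn]) (by decide) (by decide) (by decide)
    (fun j hj p hp q hq h => hIυ j hj p hp q hq (by omega)) ?_).imp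
    fun τ _ h j hj p hp q hq h' => h j hj p hp q hq (by omega)
  intro i'' hi'' ω hF'' hωi hIω
  have hr : ∀ a, a ≠ .final .product → ω.arr a = σ.arr a := fun a ha => by
    rw [hF''.arr _ (by simpa using ha), hF'.arr _ (by simpa using ha), hF.arr _ (by simpa using ha)]
  have r3 : ω.reg (.scratch 3) = i := by
    rw [hF''.reg _ (by decide), hF'.reg _ (by decide), hτi]
  have r4 : ω.reg (.scratch 4) = i' := by rw [hF''.reg _ (by decide), hυi]
  refine Ter.straight (by decide) ?_
  intro j hj p hp q hq hW
  simp only [exec, Exp.eval, Mem.setReg_arr, Mem.setArr_arr, true_and, hωi, r3, r4,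
    hr (.scratch 7) (by decide), hr (.scratch 6) (by decide), hr (.final .channel) (by decide),
    hr (.final .input) (by decide), h7 i hi, h6 i' hi']
  split_ifs with h1 h2
  · obtain ⟨rfl, rfl, rfl⟩ := triple_code_injective hp hi' hq hi'' h1
    simp [hG, h2]
  · obtain ⟨rfl, rfl, rfl⟩ := triple_code_injective hp hi' hq hi'' h1
    simp [hG, h2]
  · refine hIω j hj p hp q hq ?_
    by_contra hc
    obtain ⟨rfl, rfl, rfl⟩ : j = i ∧ p = i' ∧ q = i'' := by omega
    exact h1 rfl

/-- The bounds `hlP` and `hmn` make the look-ups valid: the tables of multiples are only known below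
`P` and `n`. -/
theorem Ter.product_trans {σ : Mem} {P n : ℕ} {m l : List Quad}
    (hm : σ.list (.scratch 6) (.scratch 2) (.scratch 3) (.scratch 4) (.scratch 5) = m)
    (hl : σ.transList .channel = l) (h0 : σ.reg (.numTrans .product) = 0)
    (h6 : ∀ p < n, σ.arr (.scratch 6) p = p * n)
    (h7 : ∀ j < P, σ.arr (.scratch 7) j = j * (n * n))
    (hlP : ∀ t ∈ l, t.1 < P ∧ t.2.2.2 < P) (hmn : ∀ u ∈ m, u.1 < n ∧ u.2.2.2 < n) :
    (Prog.loop (.scratch 3) (.numTrans .channel) (Prog.loop (.scratch 4) (.scratch 6)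
    (.ite (.eq (.arr (.scratch 3) (.reg (.scratch 4))) (.arr (.inp .channel) (.reg (.scratch 3))))
      (Prog.loop (.scratch 5) (.scratch 6)
        (.ite
          (.eq (.arr (.scratch 3) (.reg (.scratch 5))) (.arr (.out .channel) (.reg (.scratch 3))))
          (Prog.push (.numTrans .product) (.src .product) (.inp .product) (.out .product)
            (.dst .product)
            (.add (.add (.arr (.scratch 7) (.arr (.src .channel) (.reg (.scratch 3))))
              (.arr (.scratch 6) (.arr (.scratch 2) (.reg (.scratch 4)))))
              (.arr (.scratch 2) (.reg (.scratch 5))))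
            (.arr (.inp .channel) (.reg (.scratch 3))) (.arr (.out .channel) (.reg (.scratch 3)))
            (.add (.add (.arr (.scratch 7) (.arr (.dst .channel) (.reg (.scratch 3))))
              (.arr (.scratch 6) (.arr (.scratch 5) (.reg (.scratch 4)))))
              (.arr (.scratch 5) (.reg (.scratch 5)))))
          .skip))
      .skip))).Ter σ (l.length * ((m.length * ((14 + (m.length * (60 + 10) + 8)) + 10) + 8) + 10) + 8)
    (fun τ => τ.transList .product = productList n l m) := by
  refine (Ter.loop_forEach _ _ hl (by decide) (by decide) (by decide) (by decide)
    (m := .numTrans .product) (a := .src .product) (b := .inp .product) (c := .out .product)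
    (d := .dst .product) (l := []) (by simp [Mem.list, h0]) ?_).imp
    fun τ _ h => by rw [Mem.transList, h]; exact List.nil_append _
  intro i hi τ hF hτi hτl l1 hl1
  set t := σ.row (.src .channel) (.inp .channel) (.out .channel) (.dst .channel) i with ht
  have hmτ : τ.list (.scratch 6) (.scratch 2) (.scratch 3) (.scratch 4) (.scratch 5) = m := by
    rw [← hm]
    exact Mem.list_congr (hF.reg _ (by decide)) (hF.arr _ (by decide)) (hF.arr _ (by decide))
      (hF.arr _ (by decide)) (hF.arr _ (by decide))
  refine Ter.loop_forEach _ _ hmτ (by decide) (by decide) (by decide) (by decide) hl1 ?_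
  intro j hj υ hF' hυj hυm l2 hl2
  set u := τ.row (.scratch 2) (.scratch 3) (.scratch 4) (.scratch 5) j with hu
  have hmυ : υ.list (.scratch 6) (.scratch 2) (.scratch 3) (.scratch 4) (.scratch 5) = m := by
    rw [← hmτ]
    exact Mem.list_congr (hF'.reg _ (by decide)) (hF'.arr _ (by decide)) (hF'.arr _ (by decide))
      (hF'.arr _ (by decide)) (hF'.arr _ (by decide))
  have hr : ∀ a, a ≠ .src .product → a ≠ .inp .product → a ≠ .out .product →
      a ≠ .dst .product → υ.arr a = σ.arr a := fun a h1 h2 h3 h4 => by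
    rw [hF'.arr _ (by simp [h1, h2, h3, h4]), hF.arr _ (by simp [h1, h2, h3, h4])]
  have hr' : ∀ a, a ≠ .src .product → a ≠ .inp .product → a ≠ .out .product →
      a ≠ .dst .product → τ.arr a = σ.arr a := fun a h1 h2 h3 h4 => by
    rw [hF.arr _ (by simp [h1, h2, h3, h4])]
  have r3 : υ.reg (.scratch 3) = i := by rw [hF'.reg _ (by decide), hτi]
  refine Ter.le (B := _ + (m.length * (60 + 10) + 8) + 1) (Ter.ite (fun he => ?_) fun he => ?_)
    (by simp only [Exp.eq, Exp.cost]; omega)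
  swap
  · have he : ¬ u.2.1 = t.2.1 := by
      simpa [hυj, r3, hu, ht, Mem.row, hr, hr'] using he
    exact (Ter.skip (by rw [if_neg he, hl2, List.append_nil])).le (by omega)
  have he : u.2.1 = t.2.1 := by
    simpa [hυj, r3, hu, ht, Mem.row, hr, hr'] using he
  rw [if_pos he]
  refine Ter.loop_forEach _ _ hmυ (by decide) (by decide) (by decide) (by decide) hl2 ?_
  intro j' hj' ω hF'' hωj hωm l3 hl3
  set v := υ.row (.scratch 2) (.scratch 3) (.scratch 4) (.scratch 5) j' with hv
  have r3' : ω.reg (.scratch 3) = i := by rw [hF''.reg _ (by decide), r3]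
  have r4' : ω.reg (.scratch 4) = j := by rw [hF''.reg _ (by decide), hυj]
  have hr'' : ∀ a, a ≠ .src .product → a ≠ .inp .product → a ≠ .out .product →
      a ≠ .dst .product → ω.arr a = σ.arr a := fun a h1 h2 h3 h4 => by
    rw [hF''.arr _ (by simp [h1, h2, h3, h4]), hr a h1 h2 h3 h4]
  refine Ter.le (B := _ + 45 + 1) (Ter.ite (fun he' => ?_) fun he' => ?_)
    (by simp only [Exp.eq, Exp.cost]; omega)
  swap
  · have he' : ¬ v.2.1 = t.2.2.1 := by
      simpa [hωj, r3', hv, ht, Mem.row, hr, hr''] using he'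
    exact (Ter.skip (by rw [if_neg he', hl3, List.append_nil])).le (by omega)
  have he' : v.2.1 = t.2.2.1 := by
    simpa [hωj, r3', hv, ht, Mem.row, hr, hr''] using he'
  rw [if_pos he']
  refine Ter.push (by decide) hl3 (by decide) ?_
  intro ρ hρr hρa
  have e1 := h7 _ (hlP t hτl).1
  have e2 := h7 _ (hlP t hτl).2
  have e3 := h6 _ (hmn u hυm).1
  have e4 := h6 _ (hmn u hυm).2
  simp only [ht, hu, Mem.row, hr' (.scratch 2) (by decide) (by decide) (by decide) (by decide),
    hr' (.scratch 5) (by decide) (by decide) (by decide) (by decide)] at e1 e2 e3 e4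
  simp [hρr, hρa, hr'', hr', hr, r3', r4', hωj, ht, hu, hv, Mem.row, e1, e2, e3, e4]

theorem product_bound {a n c d : ℕ} (hn : 1 ≤ n) (hna : n ≤ a) (hc : 1 ≤ c) :
    a * 40 + 20 + (n * 18 + 10 + (c * 18 + 10 + (12 +
      ((c * ((n * ((n * (18 + 10) + 8) + 10) + 8) + 10) + 8) +
      (d * ((a * ((14 + (a * (60 + 10) + 8)) + 10) + 8) + 10) + 8))))) ≤
      500 * ((d + c) * a ^ 2) := by
  have ha : 1 ≤ a := hn.trans hna
  have e1 : c * ((n * ((n * (18 + 10) + 8) + 10) + 8) + 10) ≤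
      c * ((a * ((a * (18 + 10) + 8) + 10) + 8) + 10) := by gcongr
  have e2 : a ≤ a ^ 2 := by nlinarith
  have e3 : 1 ≤ a ^ 2 := by nlinarith
  have e4 := Nat.mul_le_mul_left c e2
  have e5 := Nat.mul_le_mul_left c e3
  have e6 := Nat.mul_le_mul_left d e2
  have e7 := Nat.mul_le_mul_left d e3
  have e8 : a ^ 2 ≤ c * a ^ 2 := Nat.le_mul_of_pos_left _ hc
  linarith

theorem Ter.product {P Q : Type} [Fintype P] [Fintype Q] {T : Transducer P} {A : Automaton Q}
    {σ : Mem} (hA : σ.HoldsAutomaton A) (hT : σ.HoldsTransducer .channel T) :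
    product.Ter σ (500 * ((T.trans.card + Fintype.card P) * A.size ^ 2))
      (fun τ => τ.HoldsTransducer .product (T.restrict A)) := by
  have hm0 := hT.numTrans_eq
  obtain ⟨num', hnd', hmem', h1', h2', h3', h4'⟩ := hA.elim
  obtain ⟨num, hnd, hmem, h1, h2, h3⟩ := Mem.holdsTransducer_iff.1 hT
  obtain ⟨E, hE⟩ : ∃ E, E = A.trans.card := ⟨_, rfl⟩
  have hElen : σ.autList.length = E := by rw [Mem.length_list, h4', hE]
  obtain ⟨m, hm⟩ : ∃ m, m = movesOf σ.autList (Fintype.card Q) := ⟨_, rfl⟩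
  have hmlen : m.length = A.size := by rw [hm, length_movesOf, hElen, hE, Automaton.size, add_comm]
  have hmm := mem_movesOf hmem'
  rw [← hm] at hmm
  have hnA : Fintype.card Q ≤ A.size := Nat.le_add_right _ _
  have hn1 : 1 ≤ Fintype.card Q := Fintype.card_pos_iff.2 ⟨A.start⟩
  have hP1 : 1 ≤ Fintype.card P := Fintype.card_pos_iff.2 ⟨T.start⟩
  have hlen : (σ.transList .channel).length = T.trans.card := by rw [Mem.length_list, hm0]
  refine (Ter.seq (B := (E + Fintype.card Q) * 40 + 20) (B' := (Fintype.card Q * 18 + 10) + ((Fintype.card P * 18 + 10) +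
    (12 + ((Fintype.card P * ((Fintype.card Q * ((Fintype.card Q * (18 + 10) + 8) + 10) + 8) + 10) + 8) +
    (T.trans.card * ((A.size * ((14 + (A.size * (60 + 10) + 8)) + 10) + 8) + 10) + 8)))))
    ((Ter.moveList h1').mono (by rw [hElen]) ?_)).le ?_
  · intro τ1 F1 hl1 _
    refine Ter.seq (Ter.mulTable (m := Fintype.card Q) (N := Fintype.card Q) (by decide) (by decide) (by decide)
      ((F1.reg _ (by decide)).trans h1') ((F1.reg _ (by decide)).trans h1') |>.imp ?_)
    rintro τ2 F2 ⟨ht2, hr2⟩ -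
    refine Ter.seq (Ter.mulTable (m := Fintype.card Q * Fintype.card Q) (N := Fintype.card P) (by decide) (by decide)
      (by decide) hr2 (by rw [F2.reg _ (by decide), F1.reg _ (by decide), h1]) |>.imp ?_)
    rintro τ3 F3 ⟨ht3, hr3⟩ -
    have ha3 : ∀ a, a ≠ .scratch 2 → a ≠ .scratch 3 → a ≠ .scratch 4 → a ≠ .scratch 5 →
        a ≠ .scratch 6 → a ≠ .scratch 7 → τ3.arr a = σ.arr a := fun a i2 i3 i4 i5 i6 i7 => by
      rw [F3.arr _ (by simp [Prog.mulTable, i7]), F2.arr _ (by simp [Prog.mulTable, i6]),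
        F1.arr _ (by simp [Prog.moveList, i2, i3, i4, i5])]
    have hs3 : τ3.reg (.start .channel) = num T.start := by
      rw [F3.reg _ (by decide), F2.reg _ (by decide), F1.reg _ (by decide), h2]
    have hs3' : τ3.reg (.start .input) = num' A.start := by
      rw [F3.reg _ (by decide), F2.reg _ (by decide), F1.reg _ (by decide), h2']
    refine Ter.seq (Ter.straight (Q := fun τ => τ.reg (.numStates .product) =
      Fintype.card P * (Fintype.card Q * Fintype.card Q) ∧ τ.reg (.start .product) = prodNum num num' (T.restrict A).start ∧
      τ.reg (.numTrans .product) = 0) (by decide) ?_ |>.imp ?_)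
    · refine ⟨by simp [exec, hr3], ?_, by simp [exec]⟩
      simp only [exec, Exp.eval, Mem.setReg_reg, hs3, hs3', ht3 _ (num T.start).2, prodNum_val]
      rw [F3.arr _ (by decide), ht2 _ (num' A.start).2]
      rfl
    rintro τ4 F4 ⟨hN4, hs4, hz4⟩ -
    have t7 : ∀ j < Fintype.card P, τ4.arr (.scratch 7) j = j * (Fintype.card Q * Fintype.card Q) := by
      rwa [F4.arr _ (by decide)]
    have t6 : ∀ j < Fintype.card Q, τ4.arr (.scratch 6) j = j * Fintype.card Q := by
      rwa [F4.arr _ (by decide), F3.arr _ (by decide)]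
    have rr : ∀ x, Prog.moveList.writesReg x = false → x ≠ .scratch 7 → x ≠ .scratch 3 →
        x ≠ .numStates .product → x ≠ .start .product → x ≠ .numTrans .product →
        τ4.reg x = σ.reg x := fun x i1 i2 i3 i4 i5 i6 => by
      rw [F4.reg _ (by simp [i5, i6]), F3.reg _ (by simp [Prog.mulTable, i4, i3]),
        F2.reg _ (by simp [Prog.mulTable, i2, i3]), F1.reg _ i1]
    have aa : ∀ a, a ≠ .scratch 2 → a ≠ .scratch 3 → a ≠ .scratch 4 → a ≠ .scratch 5 →
        a ≠ .scratch 6 → a ≠ .scratch 7 → τ4.arr a = σ.arr a := fun a i2 i3 i4 i5 i6 i7 => by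
      rw [F4.arr _ rfl, ha3 a i2 i3 i4 i5 i6 i7]
    refine Ter.seq (Ter.product_final (by rw [rr _ rfl (by decide) (by decide) (by decide)
      (by decide) (by decide), h1]) (by rw [rr _ rfl (by decide) (by decide) (by decide)
      (by decide) (by decide), h1']) t6 t7 |>.imp ?_)
    rintro τ5 F5 h5 -
    have hl5 : τ5.transList .channel = σ.transList .channel := by
      refine Mem.list_congr ?_ ?_ ?_ ?_ ?_
      · rw [F5.reg _ (by decide), rr _ rfl] <;> decide
      all_goals rw [F5.arr _ (by decide), aa] <;> decide
    have hm5 : τ5.list (.scratch 6) (.scratch 2) (.scratch 3) (.scratch 4) (.scratch 5) = m := by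
      rw [hm, ← hl1]
      refine Mem.list_congr ?_ ?_ ?_ ?_ ?_
      · rw [F5.reg _ (by decide), F4.reg _ (by decide), F3.reg _ (by decide), F2.reg _ (by decide)]
      all_goals
        rw [F5.arr _ (by decide), F4.arr _ (by decide), F3.arr _ (by decide), F2.arr _ (by decide)]
    rw [← hlen, ← hmlen]
    refine (Ter.product_trans (P := Fintype.card P) (n := Fintype.card Q) hm5 hl5 (by rw [F5.reg _ (by decide), hz4])
      (by rwa [F5.arr _ (by decide)]) (by rwa [F5.arr _ (by decide)]) ?_ ?_).imp ?_
    · intro t ht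
      obtain ⟨t, -, rfl⟩ := (hmem _).1 ht
      exact ⟨(num _).2, (num _).2⟩
    · intro u hu
      obtain ⟨u, -, rfl⟩ := (hmm _).1 hu
      exact ⟨(num' _).2, (num' _).2⟩
    intro τ6 F6 h6
    refine Mem.holdsTransducer_iff.2 ⟨prodNum num num', ?_, ?_, ?_, ?_, ?_⟩
    · rw [h6]
      exact nodup_productList hmem hnd hmm (hm ▸ nodup_movesOf hmem' hnd')
    · intro x
      rw [h6]
      exact mem_productList hmem hmm x
    · rw [F6.reg _ (by decide), F5.reg _ (by decide), hN4]
      simp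
    · rw [F6.reg _ (by decide), F5.reg _ (by decide), hs4]
    · rintro ⟨i, p, q⟩
      rw [prodNum_val, F6.arr _ (by decide), h5 _ (num i).2 _ (num' p).2 _ (num' q).2,
        aa _ (by decide) (by decide) (by decide) (by decide) (by decide) (by decide),
        aa _ (by decide) (by decide) (by decide) (by decide) (by decide) (by decide)]
      simp only [Transducer.restrict, Finset.mem_product]
      obtain ⟨a1, a2⟩ := h3 i
      obtain ⟨b1, b2⟩ := h3' p
      obtain ⟨c1, c2⟩ := h3' q
      by_cases hi : i ∈ T.final <;> by_cases hp : p ∈ A.final <;> by_cases hq : q ∈ A.final <;>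
        simp_all
  · have hEa : A.trans.card + Fintype.card Q = A.size := by rw [add_comm]; rfl
    rw [hE, hEa]
    exact product_bound hn1 hnA hP1

end Prog

/-! ### Graph search -/

/-- In the array `nxt` the linked list with head `h` is `l`; a pointer to `e` is `e + 1`. -/
def Linked (nxt : ℕ → ℕ) : ℕ → List ℕ → Prop
  | h, [] => h = 0
  | h, e :: l => h = e + 1 ∧ Linked nxt (nxt e) l

theorem Linked.congr {nxt nxt' : ℕ → ℕ} {h : ℕ} {l : List ℕ} (hl : Linked nxt h l)
    (heq : ∀ e ∈ l, nxt' e = nxt e) : Linked nxt' h l := by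
  induction l generalizing h with
  | nil => exact hl
  | cons e l ih =>
    refine ⟨hl.1, ?_⟩
    rw [heq e (by simp)]
    exact ih hl.2 fun e' he' => heq e' (by simp [he'])

/-- The edges below `M` that leave `v`, in decreasing order. -/
def adjacency (S : ℕ → ℕ) (M v : ℕ) : List ℕ := ((List.range M).filter (S · = v)).reverse

theorem mem_adjacency {S : ℕ → ℕ} {M v e : ℕ} : e ∈ adjacency S M v ↔ e < M ∧ S e = v := by
  simp [adjacency]

/-- A new edge is put in front, which is what insertion at the head of a linked list does; hence the
decreasing order. -/
theorem adjacency_succ (S : ℕ → ℕ) (M v : ℕ) :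
    adjacency S (M + 1) v = if S M = v then M :: adjacency S M v else adjacency S M v := by
  simp only [adjacency, List.range_succ, List.filter_append]
  split_ifs with h <;> simp [h]

theorem length_adjacency (S : ℕ → ℕ) (M v : ℕ) :
    (adjacency S M v).length = ((Finset.range M).filter (S · = v)).card := by
  rw [adjacency, List.length_reverse]
  rfl

/-- The invariant of the search: `ord` lists the `c` vertices visited so far; every one but the
first was reached by the edge `par` from an earlier one. -/
structure SearchInv (S D : ℕ → ℕ) (M V x : ℕ) (vis ord par : ℕ → ℕ) (c : ℕ) : Prop where
  pos : 0 < c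
  first : ord 0 = x
  lt : ∀ i < c, ord i < V
  inj : ∀ i < c, ∀ j < c, ord i = ord j → i = j
  vis_ord : ∀ i < c, vis (ord i) ≠ 0
  ord_vis : ∀ v < V, vis v ≠ 0 → ∃ i < c, ord i = v
  tree : ∀ i < c, i ≠ 0 → par i < M ∧ D (par i) = ord i ∧ ∃ j < i, ord j = S (par i)

namespace SearchInv

variable {S D : ℕ → ℕ} {M V x : ℕ} {vis ord par : ℕ → ℕ} {c : ℕ}

theorem card_le (h : SearchInv S D M V x vis ord par c) : c ≤ V := by
  have : ((Finset.range c).image ord).card = c := by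
    rw [Finset.card_image_of_injOn, Finset.card_range]
    intro i hi j hj
    exact h.inj i (by simpa using hi) j (by simpa using hj)
  rw [← this, ← Finset.card_range V]
  refine Finset.card_le_card fun v hv => ?_
  obtain ⟨i, hi, rfl⟩ := Finset.mem_image.1 hv
  simpa using h.lt i (by simpa using hi)

theorem add (h : SearchInv S D M V x vis ord par c) {e i : ℕ} (he : e < M) (hD : D e < V)
    (hvis : vis (D e) = 0) (hi : i < c) (hS : S e = ord i) :
    SearchInv S D M V x (fun v => if v = D e then 1 else vis v)
      (fun j => if j = c then D e else ord j) (fun j => if j = c then e else par j) (c + 1) := by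
  have hne : ∀ j < c, ord j ≠ D e := fun j hj hj' => h.vis_ord j hj (hj' ▸ hvis)
  refine ⟨by omega, ?_, ?_, ?_, ?_, ?_, ?_⟩
  · simp [h.pos.ne, h.first]
  · intro j hj
    split_ifs with h'
    exacts [hD, h.lt j (by omega)]
  · intro j hj j' hj' hjj
    split_ifs at hjj with h1 h2 h2
    · omega
    · exact absurd hjj.symm (hne j' (by omega))
    · exact absurd hjj (hne j (by omega))
    · exact h.inj j (by omega) j' (by omega) hjj
  · intro j hj
    split_ifs with h1 h2 h2
    · simp
    · exact absurd rfl h2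
    · simp
    · exact h.vis_ord j (by omega)
  · intro v hv hv'
    by_cases hvD : v = D e
    · exact ⟨c, by omega, by simp [hvD]⟩
    · obtain ⟨j, hj, rfl⟩ := h.ord_vis v hv (by simpa [hvD] using hv')
      exact ⟨j, by omega, by simp [hj.ne]⟩
  · intro j hj hj0
    by_cases hjc : j = c
    · subst hjc
      exact ⟨by simpa using he, by simp, i, hi, by simp [hi.ne, hS]⟩
    · obtain ⟨h1, h2, k, hk, h3⟩ := h.tree j (by omega) hj0
      exact ⟨by simpa [hjc] using h1, by simpa [hjc] using h2, k, hk,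
        by simpa [hjc, show k ≠ c by omega] using h3⟩

/-- The relation given by the edges. -/
def _root_.EdgeRel (S D : ℕ → ℕ) (M : ℕ) (x y : ℕ) : Prop := ∃ e < M, S e = x ∧ D e = y

theorem reachable (h : SearchInv S D M V x vis ord par c) :
    ∀ i < c, Relation.ReflTransGen (EdgeRel S D M) x (ord i) := by
  intro i
  induction i using Nat.strong_induction_on with
  | _ i ih =>
    intro hi
    by_cases h0 : i = 0
    · rw [h0, h.first]
    · obtain ⟨h1, h2, j, hj, h3⟩ := h.tree i hi h0
      exact (ih j hj (by omega)).tail ⟨par i, h1, h3.symm, h2⟩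

/-- Tree edges show that visited vertices are reachable. Conversely, the visited set contains `x`
and is closed under edges by `hcl`. -/
theorem vis_iff (h : SearchInv S D M V x vis ord par c)
    (hD : ∀ e < M, D e < V)
    (hcl : ∀ j < c, ∀ e < M, S e = ord j → vis (D e) ≠ 0) (v : ℕ) (hv : v < V) :
    vis v ≠ 0 ↔ Relation.ReflTransGen (EdgeRel S D M) x v := by
  constructor
  · intro hvis
    obtain ⟨i, hi, rfl⟩ := h.ord_vis v hv hvis
    exact h.reachable i hi
  · intro hr
    suffices ∃ i < c, ord i = v by
      obtain ⟨i, hi, rfl⟩ := this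
      exact h.vis_ord i hi
    clear hv
    induction hr with
    | refl => exact ⟨0, h.pos, h.first⟩
    | tail _ hs ih =>
      obtain ⟨i, hi, rfl⟩ := ih
      obtain ⟨e, he, h1, rfl⟩ := hs
      exact h.ord_vis _ (hD e he) (hcl i hi e he h1)

end SearchInv

/-! ### Breadth-first search in linear time. -/

namespace Prog

/-- Visit the unvisited targets of the edges in a linked list. -/
def scan (d vis : Arr) : Prog :=
  .while (.reg (.scratch 12)) (
    .set (.scratch 12) (.sub (.reg (.scratch 12)) (.const 1)) ;;
    .set (.scratch 13) (.arr d (.reg (.scratch 12))) ;;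
    .ite (.arr vis (.reg (.scratch 13))) .skip (
      .write vis (.reg (.scratch 13)) (.const 1) ;;
      .write (.scratch 22) (.reg (.scratch 11)) (.reg (.scratch 13)) ;;
      .write (.scratch 23) (.reg (.scratch 11)) (.reg (.scratch 12)) ;;
      .set (.scratch 11) (.add (.reg (.scratch 11)) (.const 1))) ;;
    .set (.scratch 12) (.arr (.scratch 21) (.reg (.scratch 12))))

/-- Search in the directed graph with `scratch 8` edges, given by the arrays `s` and `d`, and
`scratch 9` vertices, from the vertex `scratch 10`. -/
def search (s d vis : Arr) : Prog :=
  loop (.scratch 3) (.scratch 9) (.write vis (.reg (.scratch 3)) (.const 0) ;;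
    .write (.scratch 20) (.reg (.scratch 3)) (.const 0)) ;;
  loop (.scratch 3) (.scratch 8)
    (.write (.scratch 21) (.reg (.scratch 3)) (.arr (.scratch 20) (.arr s (.reg (.scratch 3)))) ;;
    .write (.scratch 20) (.arr s (.reg (.scratch 3))) (.add (.reg (.scratch 3)) (.const 1))) ;;
  (.write (.scratch 22) (.const 0) (.reg (.scratch 10)) ;;
    .write vis (.reg (.scratch 10)) (.const 1) ;;
    .set (.scratch 11) (.const 1) ;; .set (.scratch 3) (.const 0)) ;;
  .while (.lt (.reg (.scratch 3)) (.reg (.scratch 11))) (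
    .set (.scratch 12) (.arr (.scratch 20) (.arr (.scratch 22) (.reg (.scratch 3)))) ;;
    scan d vis ;;
    .set (.scratch 3) (.add (.reg (.scratch 3)) (.const 1)))

theorem Ter.scan {d vis : Arr} {σ : Mem} {S D : ℕ → ℕ} {M V x i : ℕ} {l : List ℕ}
    (hd : d ∉ [vis, .scratch 22, .scratch 23]) (hv : vis ∉ [.scratch 21, .scratch 22, .scratch 23])
    (hDd : σ.arr d = D) (hDV : ∀ e < M, D e < V)
    (hl : Linked (σ.arr (.scratch 21)) (σ.reg (.scratch 12)) l)
    (hlS : ∀ e ∈ l, e < M ∧ S e = σ.arr (.scratch 22) i) (hi : i < σ.reg (.scratch 11))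
    (hI : SearchInv S D M V x (σ.arr vis) (σ.arr (.scratch 22)) (σ.arr (.scratch 23))
      (σ.reg (.scratch 11))) :
    (Prog.scan d vis).Ter σ (l.length * 40 + 2) (fun τ =>
      SearchInv S D M V x (τ.arr vis) (τ.arr (.scratch 22)) (τ.arr (.scratch 23))
        (τ.reg (.scratch 11)) ∧ σ.reg (.scratch 11) ≤ τ.reg (.scratch 11) ∧
      (∀ j < σ.reg (.scratch 11), τ.arr (.scratch 22) j = σ.arr (.scratch 22) j) ∧
      (∀ v, σ.arr vis v ≠ 0 → τ.arr vis v ≠ 0) ∧ ∀ e ∈ l, τ.arr vis (D e) ≠ 0) := by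
  simp only [List.mem_cons, List.not_mem_nil, or_false, not_or] at hd hv
  obtain ⟨hd1, hd2, hd3⟩ := hd
  obtain ⟨hv1, hv2, hv3⟩ := hv
  set c₀ := σ.reg (.scratch 11) with hc₀
  -- Here `l'` is the unread rest of the list: every edge of `l` is either still in `l'` or has a
  -- visited target, and each unread edge is allotted 40 steps.
  refine (Ter.while_rule (I := fun T τ => ∃ l', T = l'.length * 40 ∧ (Prog.scan d vis).Frame σ τ ∧
      Linked (τ.arr (.scratch 21)) (τ.reg (.scratch 12)) l' ∧ (∀ e ∈ l', e ∈ l) ∧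
      SearchInv S D M V x (τ.arr vis) (τ.arr (.scratch 22)) (τ.arr (.scratch 23))
        (τ.reg (.scratch 11)) ∧ c₀ ≤ τ.reg (.scratch 11) ∧
      (∀ j < c₀, τ.arr (.scratch 22) j = σ.arr (.scratch 22) j) ∧
      (∀ v, σ.arr vis v ≠ 0 → τ.arr vis v ≠ 0) ∧ ∀ e ∈ l, e ∈ l' ∨ τ.arr vis (D e) ≠ 0) ?_
    ⟨l, rfl, .refl _ _, hl, fun _ h => h, hI, le_rfl, fun _ _ => rfl, fun _ h => h,
      fun _ h => .inl h⟩).imp ?_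
  · rintro _ τ ⟨l', rfl, hF, hL, hsub, hI', hc, hord, hvis, hcl⟩ he
    rcases l' with _ | ⟨e, l'⟩
    · exact absurd hL he
    obtain ⟨hL1, hL2⟩ := hL
    obtain ⟨heM, heS⟩ := hlS e (hsub e (by simp))
    have hdτ : τ.arr d = D := by
      rw [hF.arr _ (by simp [Prog.scan, hd1, hd2, hd3]), hDd]
    refine ⟨38, ?_⟩
    -- Common conclusion of both branches of the body: the pointer has advanced and the target of
    -- `e` is visited.
    have hstep : ∀ υ : Mem, (Prog.scan d vis).Frame σ υ → υ.reg (.scratch 12) =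
        τ.arr (.scratch 21) e →
        SearchInv S D M V x (υ.arr vis) (υ.arr (.scratch 22)) (υ.arr (.scratch 23))
          (υ.reg (.scratch 11)) → c₀ ≤ υ.reg (.scratch 11) →
        υ.arr (.scratch 21) = τ.arr (.scratch 21) →
        (∀ j < c₀, υ.arr (.scratch 22) j = τ.arr (.scratch 22) j) →
        (∀ v, τ.arr vis v ≠ 0 → υ.arr vis v ≠ 0) → υ.arr vis (D e) ≠ 0 →
        ∃ T', T' + 38 + (Exp.reg (.scratch 12)).cost + 1 ≤ (e :: l').length * 40 ∧
        ∃ l', T' = l'.length * 40 ∧ (Prog.scan d vis).Frame σ υ ∧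
        Linked (υ.arr (.scratch 21)) (υ.reg (.scratch 12)) l' ∧ (∀ e ∈ l', e ∈ l) ∧
        SearchInv S D M V x (υ.arr vis) (υ.arr (.scratch 22)) (υ.arr (.scratch 23))
          (υ.reg (.scratch 11)) ∧ c₀ ≤ υ.reg (.scratch 11) ∧
        (∀ j < c₀, υ.arr (.scratch 22) j = σ.arr (.scratch 22) j) ∧
        (∀ v, σ.arr vis v ≠ 0 → υ.arr vis v ≠ 0) ∧ ∀ e ∈ l, e ∈ l' ∨ υ.arr vis (D e) ≠ 0 := by
      intro υ k1 k2 k3 k4 k5 k6 k7 k8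
      refine ⟨_, ?_, l', rfl, k1, by rwa [k2, k5], fun e' he' => hsub e' (by simp [he']), k3, k4,
        fun j hj => (k6 j hj).trans (hord j hj), fun v hv => k7 v (hvis v hv), fun e' he' => ?_⟩
      · simp only [List.length_cons, Exp.cost]; omega
      · rcases hcl e' he' with h | h
        · rcases List.mem_cons.1 h with rfl | h
          exacts [.inr k8, .inl h]
        · exact .inr (k7 _ h)
    have hsc : ∀ x, x = .scratch 11 ∨ x = .scratch 12 ∨ x = .scratch 13 →
        (Prog.scan d vis).writesReg x = true := by
      rintro x (rfl | rfl | rfl) <;> simp [Prog.scan]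
    have hsa : ∀ a, a = vis ∨ a = .scratch 22 ∨ a = .scratch 23 →
        (Prog.scan d vis).writesArr a = true := by
      rintro a (rfl | rfl | rfl) <;> simp [Prog.scan]
    refine Ter.straight (by rfl) ?_
    simp only [exec_seq, exec_set]
    by_cases h : τ.arr vis (D e) = 0
    · rw [exec_ite_of_eq_zero]
      swap
      · simpa [hL1, hdτ] using h
      simp only [exec]
      refine hstep _ ?_ ?_ ?_ ?_ ?_ ?_ ?_ ?_
      · exact ((((((hF.setReg _ (hsc _ (by simp))).setReg _ (hsc _ (by simp))).setArr _ _
          (hsa _ (by simp))).setArr _ _ (hsa _ (by simp))).setArr _ _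
          (hsa _ (by simp))).setReg _ (hsc _ (by simp))).setReg _ (hsc _ (by simp))
      · simp [hL1, Ne.symm hv1]
      · have := hI'.add heM (hDV e heM) h (hi.trans_le hc) (by rw [heS, hord i hi])
        have q1 : ∀ τ' : Mem, (∀ j, τ'.arr vis j = if j = D e then 1 else τ.arr vis j) →
            (∀ j, τ'.arr (.scratch 22) j = if j = τ.reg (.scratch 11) then D e else
              τ.arr (.scratch 22) j) →
            (∀ j, τ'.arr (.scratch 23) j = if j = τ.reg (.scratch 11) then e else
              τ.arr (.scratch 23) j) → τ'.reg (.scratch 11) = τ.reg (.scratch 11) + 1 →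
            SearchInv S D M V x (τ'.arr vis) (τ'.arr (.scratch 22)) (τ'.arr (.scratch 23))
              (τ'.reg (.scratch 11)) := by
          intro τ' e1 e2 e3 e4
          rw [funext e1, funext e2, funext e3, e4]
          exact this
        refine q1 _ ?_ ?_ ?_ ?_
        · intro j; simp [hL1, hv2, hv3, hdτ]
        · intro j; simp [hL1, Ne.symm hv2, hdτ]
        · intro j; simp [hL1, Ne.symm hv3, hdτ]
        · simp
      · simp; omega
      · funext j; simp [Ne.symm hv1]
      · intro j hj
        simp [Ne.symm hv2, show j ≠ τ.reg (.scratch 11) by omega]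
      · intro v hv'
        simp only [Mem.setReg_arr, Mem.setArr_arr, hv2, hv3, false_and, if_false, true_and]
        split_ifs <;> simp [hv']
      · simp [hv2, hv3, hL1, hdτ]
    · rw [exec_ite_of_ne_zero]
      swap
      · simpa [hL1, hdτ] using h
      simp only [exec]
      refine hstep _ ?_ ?_ ?_ ?_ ?_ ?_ ?_ ?_
      · exact ((hF.setReg _ (hsc _ (by simp))).setReg _ (hsc _ (by simp))).setReg _
          (hsc _ (by simp))
      · simp [hL1]
      · simpa using hI'
      · simpa using hc
      · simp
      · simp
      · simp
      · simpa using h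
  · rintro τ - ⟨T', ⟨l', -, -, h1, -, h2, h3, h4, h5, h6⟩, h7⟩
    refine ⟨h2, h3, h4, h5, fun e he => ?_⟩
    rcases h6 e he with h | h
    · rcases l' with _ | ⟨e', l'⟩
      · simp at h
      · obtain ⟨h8, -⟩ := h1
        simp [h8] at h7
    · exact h

/-- The number of edges that do not leave one of the first `i` vertices in the list `ord`. -/
def edgesLeft (S ord : ℕ → ℕ) (M i : ℕ) : ℕ :=
  ((Finset.range M).filter fun e => ∀ j < i, ord j ≠ S e).card

/-- The amortization of the search: handling one vertex uses up its own adjacency list, so all scans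
together cost a multiple of the number of edges. -/
theorem edgesLeft_succ {S ord : ℕ → ℕ} {M i : ℕ} (h : ∀ j < i, ord j ≠ ord i) :
    edgesLeft S ord M (i + 1) + (adjacency S M (ord i)).length = edgesLeft S ord M i := by
  rw [length_adjacency, edgesLeft, edgesLeft, ← Finset.card_union_of_disjoint]
  · congr 1
    ext e
    simp only [Finset.mem_union, Finset.mem_filter, Finset.mem_range]
    constructor
    · rintro (⟨he, h1⟩ | ⟨he, h1⟩)
      · exact ⟨he, fun j hj => h1 j (by omega)⟩
      · exact ⟨he, fun j hj => h1 ▸ h j hj⟩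
    · rintro ⟨he, h1⟩
      by_cases h2 : S e = ord i
      · exact .inr ⟨he, h2⟩
      · refine .inl ⟨he, fun j hj => ?_⟩
        obtain hj | rfl := Nat.lt_succ_iff_lt_or_eq.1 hj
        exacts [h1 j hj, Ne.symm h2]
  · rw [Finset.disjoint_left]
    intro e h1 h2
    simp only [Finset.mem_filter, Finset.mem_range] at h1 h2
    exact h1.2 i (by omega) h2.2.symm

theorem edgesLeft_congr {S ord ord' : ℕ → ℕ} {M i : ℕ} (h : ∀ j < i, ord' j = ord j) :
    edgesLeft S ord' M i = edgesLeft S ord M i := by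
  unfold edgesLeft
  congr 1
  refine Finset.filter_congr fun e _ => ?_
  exact forall₂_congr fun j hj => by rw [h j hj]

/-- Stated for an arbitrary continuation `c`, because sequences nest to the right. When `c` starts,
no vertex is marked and each vertex heads the linked list of its outgoing edges. -/
theorem Ter.search_adjacency {s d vis : Arr} {σ : Mem} {S : ℕ → ℕ} {M V : ℕ}
    (hs : s ∉ [vis, .scratch 20, .scratch 21]) (hv : vis ∉ [.scratch 20, .scratch 21])
    (hM : σ.reg (.scratch 8) = M) (hV : σ.reg (.scratch 9) = V) (hSs : σ.arr s = S)
    {B : ℕ} {c : Prog} {Q : Mem → Prop}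
    (hc : ∀ τ, (Prog.search s d vis).Frame σ τ → (∀ v < V, τ.arr vis v = 0) →
      (∀ v < V, Linked (τ.arr (.scratch 21)) (τ.arr (.scratch 20) v) (adjacency S M v)) →
      c.Ter τ B Q) :
    (Prog.loop (.scratch 3) (.scratch 9) (.write vis (.reg (.scratch 3)) (.const 0) ;;
      .write (.scratch 20) (.reg (.scratch 3)) (.const 0)) ;;
    Prog.loop (.scratch 3) (.scratch 8)
      (.write (.scratch 21) (.reg (.scratch 3)) (.arr (.scratch 20) (.arr s (.reg (.scratch 3)))) ;;
      .write (.scratch 20) (.arr s (.reg (.scratch 3))) (.add (.reg (.scratch 3)) (.const 1))) ;;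
    c).Ter σ (V * 16 + 8 + ((M * 21 + 8) + B)) Q := by
  simp only [List.mem_cons, List.not_mem_nil, or_false, not_or] at hs hv
  obtain ⟨hs1, hs2, hs3⟩ := hs
  obtain ⟨hv1, hv2⟩ := hv
  refine Ter.seq ((Ter.loop (fun j τ => ∀ v < j, τ.arr vis v = 0 ∧ τ.arr (.scratch 20) v = 0) 6 V hV
    (by simp) (by simp) (by simp) (by simp) ?_).imp ?_)
  · intro j hj τ hF hij hI
    refine Ter.straight (by rfl) fun v hv => ?_
    simp only [exec, Exp.eval, Mem.setReg_arr, Mem.setArr_arr, Mem.setArr_reg, hv1,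
      Ne.symm hv1, true_and, false_and, if_false, hij]
    split_ifs with h
    · simp
    · exact hI v (by omega)
  intro τ1 F1 h1 F1
  refine Ter.seq ((Ter.loop (fun j τ => ∀ v < V,
    Linked (τ.arr (.scratch 21)) (τ.arr (.scratch 20) v) (adjacency S j v)) 11 M
    (by rw [F1.reg _ (by simp), hM]) (by simp) (by simp) (by simp) ?_ ?_).imp ?_)
  · intro v hv
    simpa [adjacency, Linked] using (h1 v hv).2
  · intro j hj τ F2 hij hI
    have hsτ : τ.arr s = S := by
      rw [F2.arr _ (by simp [hs2, hs3]), F1.arr _ (by simp [hs1, hs2]), hSs]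
    refine Ter.straight (by rfl) fun v hv => ?_
    have e21 : ∀ j', (exec (.write (.scratch 21) (.reg (.scratch 3))
        (.arr (.scratch 20) (.arr s (.reg (.scratch 3)))) ;;
        .write (.scratch 20) (.arr s (.reg (.scratch 3))) (.add (.reg (.scratch 3)) (.const 1)))
        τ).arr (.scratch 21) j' = if j' = j then τ.arr (.scratch 20) (S j) else
          τ.arr (.scratch 21) j' := by
      intro j'; simp [exec, hij, hsτ]
    have e20 : (exec (.write (.scratch 21) (.reg (.scratch 3))
        (.arr (.scratch 20) (.arr s (.reg (.scratch 3)))) ;;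
        .write (.scratch 20) (.arr s (.reg (.scratch 3))) (.add (.reg (.scratch 3)) (.const 1)))
        τ).arr (.scratch 20) v = if v = S j then j + 1 else τ.arr (.scratch 20) v := by
      simp [exec, hij, hs3, hsτ]
    have hlt : ∀ v, ∀ e ∈ adjacency S j v, (exec (.write (.scratch 21) (.reg (.scratch 3))
        (.arr (.scratch 20) (.arr s (.reg (.scratch 3)))) ;;
        .write (.scratch 20) (.arr s (.reg (.scratch 3))) (.add (.reg (.scratch 3)) (.const 1)))
        τ).arr (.scratch 21) e = τ.arr (.scratch 21) e := by
      intro v e he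
      rw [e21, if_neg (mem_adjacency.1 he).1.ne]
    rw [Mem.setReg_arr, adjacency_succ, e20]
    by_cases h : v = S j
    · rw [if_pos h, if_pos h.symm]
      refine ⟨rfl, ?_⟩
      rw [e21, if_pos rfl, ← h]
      exact (hI v hv).congr (hlt v)
    · rw [if_neg h, if_neg (Ne.symm h)]
      exact (hI v hv).congr (hlt v)
  intro τ2 F2 h2 F2
  refine hc τ2 ((F1.mono ?_ ?_).trans (F2.mono ?_ ?_)) ?_ h2
  · intro x hx; simp [Prog.search] at hx ⊢; tauto
  · intro x hx; simp [Prog.search] at hx ⊢; tauto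
  · intro x hx; simp [Prog.search] at hx ⊢; tauto
  · intro x hx; simp [Prog.search] at hx ⊢; tauto
  · intro v hv
    rw [F2.arr _ (by simp [hv1, hv2])]
    exact (h1 v hv).1

/-- The array `22` of visited vertices is also the queue, read at `scratch 3` and extended at
`scratch 11`. When the two positions meet, every visited vertex has been scanned, so the visited set
is closed under edges and `SearchInv.vis_iff` applies. -/
theorem Ter.search {s d vis : Arr} {σ : Mem} {S D : ℕ → ℕ} {M V x : ℕ}
    (hs : s ∉ [vis, .scratch 20, .scratch 21])
    (hd : d ∉ [vis, .scratch 20, .scratch 21, .scratch 22, .scratch 23])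
    (hv : vis ∉ [.scratch 20, .scratch 21, .scratch 22, .scratch 23])
    (hM : σ.reg (.scratch 8) = M) (hV : σ.reg (.scratch 9) = V) (hx : σ.reg (.scratch 10) = x)
    (hSs : σ.arr s = S) (hDd : σ.arr d = D) (hDV : ∀ e < M, D e < V)
    (hxV : x < V) :
    (Prog.search s d vis).Ter σ ((V + M) * 100 + 50) (fun τ =>
      SearchInv S D M V x (τ.arr vis) (τ.arr (.scratch 22)) (τ.arr (.scratch 23))
        (τ.reg (.scratch 11)) ∧
      ∀ v < V, τ.arr vis v ≠ 0 ↔ Relation.ReflTransGen (EdgeRel S D M) x v) := by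
  have hs' := hs
  have hd' := hd
  have hv' := hv
  simp only [List.mem_cons, List.not_mem_nil, or_false, not_or] at hs' hd' hv'
  obtain ⟨hs1, hs2, hs3⟩ := hs'
  obtain ⟨hd1, hd2, hd3, hd4, hd5⟩ := hd'
  obtain ⟨hv1, hv2, hv3, hv4⟩ := hv'
  refine (Ter.search_adjacency (d := d) (B := 12 + ((V * 60 + M * 40) + 5 + 1)) hs (by simp [hv1, hv2]) hM hV
    hSs fun τ F1 h1 h2 => ?_).le (by ring_nf; omega)
  refine Ter.seq ((Ter.straight (Q := fun τ =>
    SearchInv S D M V x (τ.arr vis) (τ.arr (.scratch 22)) (τ.arr (.scratch 23))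
      (τ.reg (.scratch 11)) ∧ τ.reg (.scratch 3) = 0 ∧ (∀ v < V, Linked (τ.arr (.scratch 21))
      (τ.arr (.scratch 20) v) (adjacency S M v)) ∧ (Prog.search s d vis).Frame σ τ)
      (by rfl) ?_).imp ?_)
  · have hx' : τ.reg (.scratch 10) = x := by rw [F1.reg _ (by simp [Prog.search, Prog.scan]), hx]
    refine ⟨⟨?_, ?_, ?_, ?_, ?_, ?_, ?_⟩, ?_, ?_, ?_⟩
    · simp [exec]
    · simp [exec, hx', Ne.symm hv3]
    · intro i hi
      simp only [exec, Mem.setReg_reg] at hi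
      simp at hi
      simpa [exec, hi, hx', Ne.symm hv3] using hxV
    · intro i hi j hj _
      simp [exec] at hi hj
      omega
    · intro i hi
      simp [exec] at hi
      simp [exec, hi, hx', Ne.symm hv3]
    · intro v hv hvis
      refine ⟨0, by simp [exec], ?_⟩
      by_contra hne
      simp [exec, hx', Ne.symm hv3] at hne hvis
      simp [Ne.symm hne, h1 v hv, hv3] at hvis
    · intro i hi h0
      simp [exec] at hi
      omega
    · simp [exec]
    · have e21 := Ne.symm hv2
      have e20 := Ne.symm hv1
      simpa [exec, e20, e21, Mem.setArr_arr_ne] using h2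
    · exact (((F1.setArr _ _ (by simp [Prog.search])).setArr _ _ (by simp [Prog.search])).setReg _
        (by simp [Prog.search])).setReg _ (by simp [Prog.search])
  rintro τ2 - ⟨h3, h4, h5, F2⟩ -
  -- The time left is 60 for every vertex that may still be handled and 40 for every edge whose
  -- source has not been handled.
  refine (Ter.while_rule (I := fun T τ => ∃ i, τ.reg (.scratch 3) = i ∧ i ≤ τ.reg (.scratch 11) ∧
    T = (V - i) * 60 + edgesLeft S (τ.arr (.scratch 22)) M i * 40 ∧
    SearchInv S D M V x (τ.arr vis) (τ.arr (.scratch 22)) (τ.arr (.scratch 23))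
      (τ.reg (.scratch 11)) ∧ (∀ v < V, Linked (τ.arr (.scratch 21))
      (τ.arr (.scratch 20) v) (adjacency S M v)) ∧ (Prog.search s d vis).Frame σ τ ∧
      ∀ j < i, ∀ e < M, S e = τ.arr (.scratch 22) j → τ.arr vis (D e) ≠ 0) ?_
      (T := V * 60 + M * 40) ?_).mono (by simp [Exp.lt, Exp.cost]) ?_
  · rintro _ τ ⟨i, hi, hic, rfl, hI, hL, hF, hcl⟩ he
    have hic : i < τ.reg (.scratch 11) := by simpa [hi] using he
    have hiV : i < V := hic.trans_le hI.card_le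
    set v := τ.arr (.scratch 22) i with hv
    have hleft := edgesLeft_succ (S := S) (M := M) (ord := τ.arr (.scratch 22)) (i := i)
      fun j hj h => hj.ne (hI.inj j (by omega) i hic h)
    refine ⟨4 + (((adjacency S M v).length * 40 + 2) + 4), ?_⟩
    refine Ter.seq ((Ter.set (Q := fun υ => υ = τ.setReg (.scratch 12) (τ.arr (.scratch 20) v))
      (by simp [hi, hv])).imp ?_)
    rintro _ - rfl -
    refine Ter.seq ((Ter.scan (S := S) (D := D) (M := M) (V := V) (x := x) (i := i)
      (l := adjacency S M v) (by simp [hd1, hd4, hd5]) (by simp [hv2, hv3, hv4]) ?_ hDV ?_ ?_ ?_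
      ?_).imp ?_)
    · simpa [hDd] using hF.arr d (by simp [Prog.search, Prog.scan, hd1, hd2, hd3, hd4, hd5])
    · simpa using hL v (hI.lt i hic)
    · intro e he
      simpa using mem_adjacency.1 he
    · simpa using hic
    · simpa using hI
    rintro υ Fυ ⟨k1, k2, k3, k4, k5⟩ -
    simp only [Mem.setReg_reg, Mem.setReg_arr] at k2 k3 k4
    simp only [Reg.scratch.injEq, Nat.reduceEqDiff, if_false] at k2 k3
    refine Ter.set ?_
    have h3υ : υ.reg (.scratch 3) = i := by
      rw [Fυ.reg _ (by simp [Prog.scan])]; simpa using hi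
    have hk : ∀ j ≤ i, υ.arr (.scratch 22) j = τ.arr (.scratch 22) j := fun j hj =>
      k3 j (by omega)
    refine ⟨_, ?_, i + 1, by simp [h3υ], by simp; omega, rfl, by simpa using k1, ?_, ?_, ?_⟩
    · simp only [Exp.lt, Exp.cost, Mem.setReg_arr]
      rw [edgesLeft_congr fun j hj => hk j (by omega)]
      rw [← hv] at hleft
      omega
    · intro w hw
      simp only [Mem.setReg_arr]
      rw [Fυ.arr _ (by simp [Prog.scan, Ne.symm hv2]), Fυ.arr _ (by simp [Prog.scan, Ne.symm hv1])]
      exact hL w hw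
    · refine ((hF.setReg _ (by simp [Prog.search])).trans (Fυ.mono ?_ ?_)).setReg _
        (by simp [Prog.search])
      · intro y hy; simp [Prog.search] at hy ⊢; tauto
      · intro y hy; simp [Prog.search] at hy ⊢; tauto
    · intro j hj e he hS
      simp only [Mem.setReg_arr] at hS ⊢
      rw [hk j (by omega)] at hS
      obtain hj | rfl := Nat.lt_succ_iff_lt_or_eq.1 hj
      · exact k4 _ (hcl j hj e he hS)
      · exact k5 e (mem_adjacency.2 ⟨he, hS⟩)
  · refine ⟨0, h4, by omega, ?_, h3, h5, F2, by simp⟩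
    simp [edgesLeft]
  · rintro τ - ⟨T, ⟨i, hi, hic, -, hI, -, -, hcl⟩, he⟩
    have hic' : i = τ.reg (.scratch 11) := by
      simp [hi] at he
      omega
    refine ⟨hI, fun v hv => hI.vis_iff hDV (fun j hj => hcl j (hic' ▸ hj)) v hv⟩

end Prog

/-! ### Words as affine maps -/

/-- A number that determines a word of positive numbers. -/
def wordVal : List ℕ → ℕ
  | [] => 1
  | j :: w => 2 ^ j * wordVal w + 1

theorem wordVal_pos (w : List ℕ) : 0 < wordVal w := by cases w <;> simp [wordVal]

theorem odd_wordVal {w : List ℕ} (h : ∀ j ∈ w, 0 < j) : Odd (wordVal w) := by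
  cases w with
  | nil => exact odd_one
  | cons j w =>
    refine Even.add_one (Even.mul_right ?_ _)
    exact (Nat.even_pow.2 ⟨even_two, (h j (by simp)).ne'⟩)

theorem two_pow_mul_odd_injective {i j a b : ℕ} (ha : Odd a) (hb : Odd b)
    (h : 2 ^ i * a = 2 ^ j * b) : i = j ∧ a = b := by
  have key : ∀ {i j a b : ℕ}, Odd a → i < j → 2 ^ i * a ≠ 2 ^ j * b := by
    intro i j a b ha hij h
    obtain ⟨k, rfl⟩ := Nat.exists_eq_add_of_lt hij
    rw [show i + k + 1 = i + (k + 1) by ring, pow_add, mul_assoc] at h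
    have h := Nat.eq_of_mul_eq_mul_left (by positivity) h
    rw [h, pow_succ] at ha
    exact absurd ha (by simp [parity_simps])
  obtain hij | rfl | hij := lt_trichotomy i j
  · exact absurd h (key ha hij)
  · exact ⟨rfl, Nat.eq_of_mul_eq_mul_left (by positivity) h⟩
  · exact absurd h.symm (key hb hij)

/-- Codes of words of positive letters are odd. In `wordVal (j :: w) - 1 = 2 ^ j * wordVal w` the
letter `j` is therefore the exponent of 2, and the odd part is the code of the rest. -/
theorem wordVal_injective {v w : List ℕ} (hv : ∀ j ∈ v, 0 < j) (hw : ∀ j ∈ w, 0 < j)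
    (h : wordVal v = wordVal w) : v = w := by
  induction v generalizing w with
  | nil =>
    cases w with
    | nil => rfl
    | cons j w => exact absurd h (by simp [wordVal, (wordVal_pos w).ne'])
  | cons i v ih =>
    cases w with
    | nil => exact absurd h (by simp [wordVal, (wordVal_pos v).ne'])
    | cons j w =>
      have hv' : ∀ j ∈ v, 0 < j := fun j hj => hv j (by simp [hj])
      have hw' : ∀ j ∈ w, 0 < j := fun j hj => hw j (by simp [hj])
      obtain ⟨rfl, h'⟩ := two_pow_mul_odd_injective (odd_wordVal hv') (odd_wordVal hw')
        (Nat.succ_injective h)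
      rw [ih hv' hw' h']

/-- The map `t ↦ 2 ^ j * t + 1` for a symbol numbered `j > 0`, the identity for the empty word. -/
noncomputable def letterMap (j : ℕ) : Equiv.Perm ℚ :=
  if j = 0 then 1 else Equiv.addRight (1 : ℚ) * Equiv.mulLeft₀ (2 ^ j : ℚ) (by positivity)

@[simp] theorem letterMap_zero : letterMap 0 = 1 := if_pos rfl

theorem letterMap_apply {j : ℕ} (h : j ≠ 0) (t : ℚ) : letterMap j t = 2 ^ j * t + 1 := by
  simp [letterMap, h]

/-- The composition of the maps of the symbols of a word. -/
noncomputable def wordMap (w : List ℕ) : Equiv.Perm ℚ := (w.reverse.map letterMap).prod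

@[simp] theorem wordMap_nil : wordMap [] = 1 := rfl

theorem wordMap_append (v w : List ℕ) : wordMap (v ++ w) = wordMap w * wordMap v := by
  simp [wordMap]

theorem wordMap_apply_one {w : List ℕ} (h : ∀ j ∈ w, 0 < j) :
    wordMap w 1 = wordVal w.reverse := by
  suffices ∀ w : List ℕ, (∀ j ∈ w, 0 < j) → (w.map letterMap).prod 1 = wordVal w from
    this w.reverse (by simpa using h)
  intro w h
  induction w with
  | nil => simp [wordVal]
  | cons j w ih =>
    rw [List.map_cons, List.prod_cons, Equiv.Perm.mul_apply, ih fun i hi => h i (by simp [hi]),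
      letterMap_apply (h j (by simp)).ne']
    simp [wordVal]

/-- The value at `1` already determines the word, so the maps of the positive letters generate a
free monoid inside the group of permutations of `ℚ`. The reversal appears because the map of the
last letter is applied last. -/
theorem wordMap_injective {v w : List ℕ} (hv : ∀ j ∈ v, 0 < j) (hw : ∀ j ∈ w, 0 < j)
    (h : wordMap v = wordMap w) : v = w := by
  have := congrArg (fun f : Equiv.Perm ℚ => f 1) h
  simp only [wordMap_apply_one hv, wordMap_apply_one hw, Nat.cast_inj] at this
  exact List.reverse_injective (wordVal_injective (by simpa using hv) (by simpa using hw) this)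

/-! ### Graphs with labels in a group -/

/-- A step in a graph whose edges act on the elements of a group. -/
def WalkStep {G : Type*} [Group G] (φ : ℕ → G) (l : List Quad) (x y : ℕ × G) : Prop :=
  ∃ e ∈ l, e.1 = x.1 ∧ e.2.2.2 = y.1 ∧ y.2 = φ e.2.1 * x.2 * (φ e.2.2.1)⁻¹

/-- A walk acts on the group component by `g ↦ c * g * d⁻¹`, where `c` and `d` depend only on its
edges. It can be started with any other element, and its action is injective. -/
theorem WalkStep.translate {G : Type*} [Group G] {φ : ℕ → G} {l : List Quad} {x y : ℕ} {g h : G}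
    (hw : Relation.ReflTransGen (WalkStep φ l) (x, g) (y, h)) :
    ∃ c d : G, ∀ g', ∃ h', h' = c * g' * d⁻¹ ∧
      Relation.ReflTransGen (WalkStep φ l) (x, g') (y, h') := by
  generalize hz : (y, h) = z at hw
  induction hw generalizing y h with
  | refl =>
    cases hz
    exact ⟨1, 1, fun g' => ⟨g', by simp, .refl⟩⟩
  | @tail z' _ _ hs ih =>
    subst hz
    obtain ⟨c, d, hcd⟩ := ih rfl
    obtain ⟨e, he, h1, h2, -⟩ := hs
    refine ⟨φ e.2.1 * c, φ e.2.2.1 * d, fun g' => ?_⟩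
    obtain ⟨h', e1, e3⟩ := hcd g'
    refine ⟨φ e.2.1 * h' * (φ e.2.2.1)⁻¹, by rw [e1]; group, e3.tail ⟨e, he, h1, h2, rfl⟩⟩

/-- `val` is the potential obtained by following the tree edges from `x`. If all walks to `N` yield
`1`, an edge between a reachable and a co-reachable vertex must respect the potential: reaching its
target through the tree or through this edge and then continuing by one and the same walk gives `1`
both times, and the common continuation cancels. Conversely, if these edges respect the potential,
every walk carries the potential as long as it can still reach `N`. -/
theorem walkStep_unique_iff {G : Type*} [Group G] {φ : ℕ → G} {S D Y Z : ℕ → ℕ} {M V x N : ℕ}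
    {vis co ord par : ℕ → ℕ} {c : ℕ} (hI : SearchInv S D M V x vis ord par c)
    (hSV : ∀ e < M, S e < V) (hDV : ∀ e < M, D e < V) (hN : N < V)
    (hvis : ∀ v < V, vis v ≠ 0 ↔ Relation.ReflTransGen (EdgeRel S D M) x v)
    (hco : ∀ v < V, co v ≠ 0 ↔ Relation.ReflTransGen (EdgeRel D S M) N v)
    {l : List Quad} (hl : (List.range M).map (fun e => (S e, Y e, Z e, D e)) = l) {val : ℕ → G}
    (h0 : val x = 1) (ht : ∀ i < c, i ≠ 0 →
      val (ord i) = φ (Y (par i)) * val (S (par i)) * (φ (Z (par i)))⁻¹) :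
    (∀ g, Relation.ReflTransGen (WalkStep φ l) (x, 1) (N, g) → g = 1) ↔
      (∀ e < M, vis (S e) ≠ 0 → co (D e) ≠ 0 →
        val (D e) = φ (Y e) * val (S e) * (φ (Z e))⁻¹) ∧ (vis N ≠ 0 → val N = 1) := by
  have hstep : ∀ {y z : ℕ × G}, WalkStep φ l y z ↔
      ∃ e < M, S e = y.1 ∧ D e = z.1 ∧ z.2 = φ (Y e) * y.2 * (φ (Z e))⁻¹ := by
    intro y z
    subst hl
    simp [WalkStep]
  have hreach : ∀ i < c, Relation.ReflTransGen (WalkStep φ l) (x, 1) (ord i, val (ord i)) := by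
    intro i
    induction i using Nat.strong_induction_on with
    | _ i ih =>
      intro hi
      by_cases hi0 : i = 0
      · rw [hi0, hI.first, h0]
      · obtain ⟨h1, h2, j, hj, h3⟩ := hI.tree i hi hi0
        refine (ih j hj (by omega)).tail (hstep.2 ⟨par i, h1, h3.symm, h2, ?_⟩)
        simp only
        rw [ht i hi hi0, h3]
  have hreach' : ∀ v < V, vis v ≠ 0 → Relation.ReflTransGen (WalkStep φ l) (x, 1) (v, val v) := by
    intro v hv hvv
    obtain ⟨i, hi, rfl⟩ := hI.ord_vis v hv hvv
    exact hreach i hi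
  have hxV : x < V := hI.first ▸ hI.lt 0 hI.pos
  constructor
  · intro H
    refine ⟨fun e he hs hd => ?_, fun hv => H _ (hreach' N hN hv)⟩
    have h1 := hreach' _ (hSV e he) hs
    have hd' : vis (D e) ≠ 0 := (hvis _ (hDV e he)).2
      (((hvis _ (hSV e he)).1 hs).tail ⟨e, he, rfl, rfl⟩)
    have h2 := hreach' _ (hDV e he) hd'
    have h3 : Relation.ReflTransGen (WalkStep φ l) (x, 1)
        (D e, φ (Y e) * val (S e) * (φ (Z e))⁻¹) := h1.tail (hstep.2 ⟨e, he, rfl, rfl, rfl⟩)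
    -- A path to `N` in the bare graph lifts to a walk starting from any group element.
    have hback : ∀ v, Relation.ReflTransGen (EdgeRel D S M) N v → ∀ g : G,
        ∃ g', Relation.ReflTransGen (WalkStep φ l) (v, g) (N, g') := by
      intro v hv
      induction hv with
      | refl => exact fun g => ⟨g, .refl⟩
      | tail _ hs ih =>
        obtain ⟨e', he', rfl, rfl⟩ := hs
        intro g
        obtain ⟨g', hg'⟩ := ih (φ (Y e') * g * (φ (Z e'))⁻¹)
        exact ⟨g', .head (hstep.2 ⟨e', he', rfl, rfl, rfl⟩) hg'⟩
    obtain ⟨g', hg'⟩ := hback _ ((hco _ (hDV e he)).1 hd) 1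
    -- One continuation is used for both elements found at `D e`; its action `g ↦ a * g * b⁻¹` is
    -- then cancelled.
    obtain ⟨a, b, hab⟩ := WalkStep.translate hg'
    obtain ⟨_, rfl, h5⟩ := hab (val (D e))
    obtain ⟨_, rfl, h6⟩ := hab (φ (Y e) * val (S e) * (φ (Z e))⁻¹)
    have h7 := (H _ (h2.trans h5)).trans (H _ (h3.trans h6)).symm
    exact mul_left_cancel (mul_right_cancel h7)
  · rintro ⟨H1, H2⟩ g hg
    -- The group component is controlled only at vertices that can reach `N`; elsewhere edges were
    -- never checked.
    suffices ∀ z : ℕ × G, Relation.ReflTransGen (WalkStep φ l) (x, 1) z → z.1 < V ∧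
        vis z.1 ≠ 0 ∧ (co z.1 ≠ 0 → z.2 = val z.1) by
      obtain ⟨-, h1, h2⟩ := this _ hg
      exact (h2 ((hco N hN).2 .refl)).trans (H2 h1)
    intro z hz
    induction hz with
    | refl => exact ⟨hxV, (hvis x hxV).2 .refl, fun _ => h0.symm⟩
    | tail _ hs ih =>
      obtain ⟨e, he, h1, h2, h3⟩ := hstep.1 hs
      obtain ⟨k1, k2, k3⟩ := ih
      rw [← h1] at k1 k2 k3
      rw [← h2]
      refine ⟨hDV e he, (hvis _ (hDV e he)).2 (((hvis _ k1).1 k2).tail ⟨e, he, rfl, rfl⟩),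
        fun hc => ?_⟩
      rw [H1 e he k2 hc, h3, k3 ((hco _ k1).2 (((hco _ (hDV e he)).1 hc).tail ⟨e, he, rfl, rfl⟩))]

/-! ### Functionality as a property of the graph of pairs -/

namespace Transducer

variable {P : Type} {T : Transducer P}

theorem Path.snoc {p q s : P} {u v : List ℕ} {x y : Option ℕ} (h : T.Path p u v q)
    (ht : (q, x, y, s) ∈ T.trans) : T.Path p (u ++ x.toList) (v ++ y.toList) s := by
  induction h with
  | nil p => simpa using Path.cons ht (.nil s)
  | cons ht' _ ih => simpa using Path.cons ht' (ih ht)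

/-- The transitions of a transducer and the empty moves. -/
def Ext (T : Transducer P) (t : P × Option ℕ × Option ℕ × P) : Prop :=
  t ∈ T.trans ∨ t.2.1 = none ∧ t.2.2.1 = none ∧ t.1 = t.2.2.2

theorem Path.ext {p : P} {u v : List ℕ} {t : P × Option ℕ × Option ℕ × P}
    (h : T.Path p u v t.1) (ht : T.Ext t) :
    T.Path p (u ++ t.2.1.toList) (v ++ t.2.2.1.toList) t.2.2.2 := by
  obtain ht | ⟨h1, h2, h3⟩ := ht
  · exact h.snoc ht
  · simpa [h1, h2, ← h3] using h

/-- The edges of the graph of pairs of states, with a sink `N`. -/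
def IsPairGraph (T : Transducer P) (pc : P → P → ℕ) (f : ℕ → ℕ) (N : ℕ) (l : List Quad) : Prop :=
  ∀ r, r ∈ l ↔ (∃ t t', T.Ext t ∧ T.Ext t' ∧ t.2.1 = t'.2.1 ∧
      (pc t.1 t'.1, f (labelCode t.2.2.1), f (labelCode t'.2.2.1), pc t.2.2.2 t'.2.2.2) = r) ∨
    ∃ p ∈ T.final, ∃ p' ∈ T.final, (pc p p', 0, 0, N) = r

/-- The map of an output word. -/
noncomputable def outMap (f : ℕ → ℕ) (v : List ℕ) : Equiv.Perm ℚ :=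
  wordMap (v.map fun a => f (a + 1))

theorem outMap_append (f : ℕ → ℕ) (v w : List ℕ) :
    outMap f (v ++ w) = outMap f w * outMap f v := by simp [outMap, wordMap_append]

theorem outMap_toList {f : ℕ → ℕ} (h0 : f 0 = 0) (y : Option ℕ) :
    outMap f y.toList = letterMap (f (labelCode y)) := by
  cases y <;> simp [outMap, labelCode, h0, wordMap]

theorem outMap_injective {f : ℕ → ℕ} (hf : Function.Injective f) (h0 : f 0 = 0) :
    Function.Injective (outMap f) := by
  intro v w h
  have hpos : ∀ v : List ℕ, ∀ j ∈ v.map fun a => f (a + 1), 0 < j := by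
    intro v j hj
    obtain ⟨a, -, rfl⟩ := List.mem_map.1 hj
    rw [Nat.pos_iff_ne_zero, ← h0]
    exact fun h => absurd (hf h) (by simp)
  refine List.map_injective_iff.2 ?_ (wordMap_injective (hpos v) (hpos w) h)
  intro a b hab
  simpa using hf hab

/-- A walk in the graph of pairs is a pair of paths with equal inputs, one of them resting while the
other makes a transition with empty input. If the outputs are `v` and `v'`, the group component is
`outMap f v * (outMap f v')⁻¹`, which is `1` exactly when `v = v'`. The sink is entered only from
pairs of final states and with trivial labels. -/
theorem functional_iff {pc : P → P → ℕ} {f : ℕ → ℕ} {N : ℕ} {l : List Quad}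
    (hl : T.IsPairGraph pc f N l) (hpc : ∀ p p' q q', pc p p' = pc q q' → p = q ∧ p' = q')
    (hN : ∀ p p', pc p p' ≠ N) (hf : Function.Injective f) (h0 : f 0 = 0) :
    T.Functional ↔ ∀ g, Relation.ReflTransGen (WalkStep letterMap l)
      (pc T.start T.start, 1) (N, g) → g = 1 := by
  constructor
  · intro H g hg
    suffices ∀ z : ℕ × Equiv.Perm ℚ, Relation.ReflTransGen (WalkStep letterMap l)
        (pc T.start T.start, 1) z → ∃ q q' u v v', T.Path T.start u v q ∧ T.Path T.start u v' q' ∧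
        z.2 = outMap f v * (outMap f v')⁻¹ ∧
        (z.1 = pc q q' ∨ z.1 = N ∧ q ∈ T.final ∧ q' ∈ T.final) by
      obtain ⟨q, q', u, v, v', h1, h2, h3, h4 | ⟨-, h5, h6⟩⟩ := this _ hg
      · exact absurd h4.symm (hN q q')
      · rw [H u v v' ⟨q, h5, h1⟩ ⟨q', h6, h2⟩] at h3
        simpa using h3
    intro z hz
    induction hz with
    | refl => exact ⟨_, _, [], [], [], .nil _, .nil _, by simp, .inl rfl⟩
    | @tail y z _ hs ih =>
      obtain ⟨q, q', u, v, v', h1, h2, h3, h4⟩ := ih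
      obtain ⟨r, hr, k1, k2, k3⟩ := hs
      obtain ⟨t, t', ht, ht', hin, rfl⟩ | ⟨p, hp, p', hp', rfl⟩ := (hl r).1 hr
      · have h4 : y.1 = pc q q' := h4.resolve_right fun h => hN _ _ (k1.trans h.1)
        obtain ⟨rfl, rfl⟩ := hpc _ _ _ _ (k1.trans h4)
        refine ⟨t.2.2.2, t'.2.2.2, _, _, _, h1.ext ht, hin ▸ h2.ext ht', ?_, .inl k2.symm⟩
        rw [k3, h3, outMap_append, outMap_append, outMap_toList h0, outMap_toList h0]
        group
      · have h4 : y.1 = pc q q' := h4.resolve_right fun h => hN _ _ (k1.trans h.1)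
        obtain ⟨rfl, rfl⟩ := hpc _ _ _ _ (k1.trans h4)
        refine ⟨p, p', u, v, v', h1, h2, ?_, .inr ⟨k2.symm, hp, hp'⟩⟩
        rw [k3, h3]
        simp
  · rintro H u v v' ⟨q, hq, h1⟩ ⟨q', hq', h2⟩
    -- Any two paths with the same input can be synchronized; the initial element `g` is kept
    -- arbitrary for the induction.
    suffices ∀ p u v q, T.Path p u v q → ∀ p' v' q', T.Path p' u v' q' → ∀ g,
        Relation.ReflTransGen (WalkStep letterMap l) (pc p p', g)
          (pc q q', outMap f v * g * (outMap f v')⁻¹) by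
      have h3 := (this _ _ _ _ h1 _ _ _ h2 1).tail (b := (pc q q', _))
        (c := (N, outMap f v * 1 * (outMap f v')⁻¹))
        ⟨_, (hl _).2 (.inr ⟨q, hq, q', hq', rfl⟩), rfl, rfl, by simp⟩
      have h4 := H _ h3
      rw [mul_one, mul_inv_eq_one] at h4
      exact outMap_injective hf h0 h4
    have head : ∀ (x : Option ℕ) (p : P) (y : Option ℕ) (q p' : P) (y' : Option ℕ) (q' : P),
        T.Ext (p, x, y, q) → T.Ext (p', x, y', q') →
        ∀ (z : ℕ) (v v' w w' : List ℕ), (∀ g, Relation.ReflTransGen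
          (WalkStep letterMap l) (pc q q', g) (z, outMap f v * g * (outMap f v')⁻¹)) →
        w = y.toList ++ v → w' = y'.toList ++ v' → ∀ g,
        Relation.ReflTransGen (WalkStep letterMap l) (pc p p', g)
          (z, outMap f w * g * (outMap f w')⁻¹) := by
      rintro x p y q p' y' q' ht ht' z v v' _ _ h rfl rfl g
      refine .head (b := (pc q q', letterMap (f (labelCode y)) * g *
        (letterMap (f (labelCode y')))⁻¹))
        ⟨_, (hl _).2 (.inl ⟨_, _, ht, ht', rfl, rfl⟩), rfl, rfl, rfl⟩ ?_
      convert h _ using 2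
      rw [outMap_append, outMap_append, outMap_toList h0, outMap_toList h0]
      group
    have stay : ∀ p : P, T.Ext (p, none, none, p) := fun p => .inr ⟨rfl, rfl, rfl⟩
    intro p u v q h1
    induction h1 with
    | nil p =>
      intro p' v' q' h2
      generalize hu : ([] : List ℕ) = u at h2
      induction h2 with
      | nil p' => intro g; simpa [outMap] using Relation.ReflTransGen.refl
      | @cons p' s' q' x' y' u' v' ht' _ ih =>
        obtain ⟨hx, hu'⟩ := List.append_eq_nil_iff.1 hu.symm
        obtain rfl : x' = none := by
          cases x' with
          | none => rfl
          | some a => simp at hx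
        exact head none p none p p' y' s' (stay p) (.inl ht') _ _ _ _ _ (ih hu'.symm) rfl rfl
    | @cons p s q x y u v ht h ih =>
      intro p' v' q' h2
      -- A transition with empty input is made while the second path rests. If the first path wants
      -- to read `a`, the second path is advanced through its empty inputs until it reads `a` too,
      -- and both move together.
      rcases x with _ | a
      · exact head none p y s p' none p' (.inl ht) (stay p') _ _ _ _ _ (ih _ _ _ h2) rfl rfl
      · generalize hu : (some a).toList ++ u = u₀ at h2
        induction h2 with
        | nil p' => simp at hu
        | @cons p' s' q' x' y' u' v' ht' h' ih' =>
          rcases x' with _ | a'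
          · exact head none p none p p' y' s' (stay p) (.inl ht') _ _ _ _ _ (ih' hu) rfl rfl
          · simp only [Option.toList_some, List.singleton_append, List.cons.injEq] at hu
            obtain ⟨rfl, rfl⟩ := hu
            exact head (some a) p y s p' y' s' (.inl ht) (.inl ht') _ _ _ _ _ (ih _ _ _ h') rfl rfl

end Transducer

/-! ### Affine maps in memory -/

/-- The numbers `P`, `N`, `X`, `Y` represent the map `t ↦ (P * t + X - Y) / N`. -/
structure AffineRep (h : ℚ → ℚ) (P N X Y : ℕ) : Prop where
  apply : ∀ t, N * h t = P * t + X - Y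
  norm : ∃ a, P = 2 ^ a ∧ N = 1 ∨ P = 1 ∧ N = 2 ^ a

namespace AffineRep

theorem one : AffineRep (1 : Equiv.Perm ℚ) 1 1 0 0 := ⟨by simp, 0, by simp⟩

theorem pos {h : ℚ → ℚ} {P N X Y : ℕ} (hr : AffineRep h P N X Y) : 0 < P ∧ 0 < N := by
  obtain ⟨a, ⟨rfl, rfl⟩ | ⟨rfl, rfl⟩⟩ := hr.norm <;> simp

theorem inv {g : Equiv.Perm ℚ} {P N X Y : ℕ} (hr : AffineRep g P N X Y) :
    AffineRep (g⁻¹ : Equiv.Perm ℚ) N P Y X := by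
  refine ⟨fun t => ?_, ?_⟩
  · have := hr.apply (g⁻¹ t)
    rw [show g (g⁻¹ t) = t from g.apply_symm_apply t] at this
    linarith
  · obtain ⟨a, h | h⟩ := hr.norm
    exacts [⟨a, .inr h.symm⟩, ⟨a, .inl h.symm⟩]

/-- `N` is halved as long as possible before `P` is doubled. Thus one of `P`, `N` stays `1`, and the
representation of the slope stays unique. -/
theorem double {h : ℚ → ℚ} {P N X Y : ℕ} (hr : AffineRep h P N X Y) :
    if 2 ≤ N then AffineRep (fun t => 2 * h t) P (N / 2) X Y
    else AffineRep (fun t => 2 * h t) (P + P) N (X + X) (Y + Y) := by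
  obtain ⟨a, ⟨rfl, rfl⟩ | ⟨rfl, rfl⟩⟩ := hr.norm
  · rw [if_neg (by norm_num)]
    refine ⟨fun t => ?_, a + 1, .inl ⟨by ring, rfl⟩⟩
    have := hr.apply t
    push_cast at this ⊢
    linarith
  · rcases a with _ | a
    · rw [if_neg (by norm_num)]
      refine ⟨fun t => ?_, 1, .inl ⟨rfl, rfl⟩⟩
      have := hr.apply t
      push_cast at this ⊢
      linarith
    · rw [if_pos (by rw [pow_succ]; have := Nat.one_le_two_pow (n := a); omega)]
      have h2 : 2 ^ (a + 1) / 2 = 2 ^ a := by rw [pow_succ]; omega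
      rw [h2]
      refine ⟨fun t => ?_, a, .inr ⟨rfl, rfl⟩⟩
      have := hr.apply t
      push_cast at this ⊢
      rw [pow_succ] at this
      linarith

theorem succ {h : ℚ → ℚ} {P N X Y : ℕ} (hr : AffineRep h P N X Y) :
    AffineRep (fun t => h t + 1) P N (X + N) Y := by
  refine ⟨fun t => ?_, hr.norm⟩
  have := hr.apply t
  push_cast
  linarith

/-- The slope `P / N` is a power of two with `P = 1` or `N = 1`, hence it determines `P` and `N`.
The offsets `X - Y` and `X' - Y'` are compared by sums, since subtraction is truncated. -/
theorem eq_iff {g g' : Equiv.Perm ℚ} {P N X Y P' N' X' Y' : ℕ} (hr : AffineRep g P N X Y)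
    (hr' : AffineRep g' P' N' X' Y') : g = g' ↔ P = P' ∧ N = N' ∧ X + Y' = X' + Y := by
  constructor
  · rintro rfl
    have e0 := hr.apply 0
    have e1 := hr.apply 1
    have f0 := hr'.apply 0
    have f1 := hr'.apply 1
    -- The slopes agree because they are the difference of the values at `1` and `0`.
    have hP : (P : ℚ) * N' = P' * N := by linear_combination N * (f1 - f0) - N' * (e1 - e0)
    have hP' : P * N' = P' * N := by exact_mod_cast hP
    have hPN : P = P' ∧ N = N' := by
      obtain ⟨p1, p2⟩ := hr.pos
      obtain ⟨q1, q2⟩ := hr'.pos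
      obtain ⟨a, ⟨h1, h2⟩ | ⟨h1, h2⟩⟩ := hr.norm <;>
        obtain ⟨b, ⟨k1, k2⟩ | ⟨k1, k2⟩⟩ := hr'.norm <;> rw [h1, h2, k1, k2] at hP' ⊢ <;>
        simp only [mul_one, one_mul] at hP' ⊢
      · exact ⟨hP', trivial⟩
      · exact ⟨Nat.eq_one_of_mul_eq_one_right hP', (Nat.eq_one_of_mul_eq_one_left hP').symm⟩
      · exact ⟨(Nat.eq_one_of_mul_eq_one_right hP'.symm).symm,
          Nat.eq_one_of_mul_eq_one_left hP'.symm⟩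
      · exact ⟨trivial, hP'.symm⟩
    obtain ⟨rfl, rfl⟩ := hPN
    refine ⟨rfl, rfl, ?_⟩
    have : (X : ℚ) + Y' = X' + Y := by linarith
    exact_mod_cast this
  · rintro ⟨rfl, rfl, h⟩
    ext t
    have h' : (X : ℚ) + Y' = X' + Y := by exact_mod_cast h
    have hN : (N : ℚ) ≠ 0 := by exact_mod_cast hr.pos.2.ne'
    refine mul_left_cancel₀ hN ?_
    rw [hr.apply, hr'.apply]
    linarith

end AffineRep

/-! ### Propagating and comparing affine maps. -/

namespace Prog

/-- Compose a map with the map of the symbol numbered `j`. -/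
def appendLetter (P N X Y j c : Reg) : Prog :=
  loop c j (.ite (.le (.const 2) (.reg N)) (.set N (.half (.reg N)))
    (.set P (.add (.reg P) (.reg P)) ;; .set X (.add (.reg X) (.reg X)) ;;
      .set Y (.add (.reg Y) (.reg Y)))) ;;
  .ite (.reg j) (.set X (.add (.reg X) (.reg N))) .skip

/-- Multiplication by `2 ^ k` is carried out as `k` doublings, and the final `+ 1` adds `N` to `X`.
The cost is linear in the number of the symbol, which is why symbols are renumbered beforehand. The
number `0` of the empty word gives the identity. -/
theorem Ter.appendLetter {P N X Y j c : Reg} {σ : Mem} {k R : ℕ} {g : Equiv.Perm ℚ}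
    (hne : [P, N, X, Y, j, c].Nodup) (hk : σ.reg j = k) (hR : k ≤ R)
    (hg : AffineRep g (σ.reg P) (σ.reg N) (σ.reg X) (σ.reg Y)) :
    (Prog.appendLetter P N X Y j c).Ter σ (R * 26 + 20) (fun τ =>
      AffineRep (letterMap k * g : Equiv.Perm ℚ) (τ.reg P) (τ.reg N) (τ.reg X) (τ.reg Y)) := by
  simp only [List.nodup_cons, List.mem_cons, List.not_mem_nil, or_false, not_or] at hne
  obtain ⟨⟨n1, n2, n3, n4, n5⟩, ⟨n6, n7, n8, n9⟩, ⟨n10, n11, n12⟩, ⟨n13, n14⟩, n15, -⟩ := hne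
  refine Ter.le (B := (k * (16 + 10) + 8) + 12) (Ter.seq ((Ter.loop (fun i τ =>
    AffineRep (fun t => 2 ^ i * g t) (τ.reg P) (τ.reg N) (τ.reg X) (τ.reg Y)) 16 k hk ?_ ?_ n15
    ?_ ?_).imp ?_)) ?_
  · simp [Ne.symm n5, Ne.symm n9, Ne.symm n12, Ne.symm n14]
  · simp [Ne.symm n4, Ne.symm n8, Ne.symm n11, Ne.symm n13]
  · simpa [n5, n9, n12, n14] using hg
  · intro i hi τ hF hτi hI
    have h2 := hI.double
    simp only [← mul_assoc, ← pow_succ'] at h2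
    refine Ter.straight (by rfl) ?_
    by_cases h : 2 ≤ τ.reg N
    · rw [if_pos h] at h2
      rw [exec_ite_of_ne_zero (by simp [h])]
      simpa [exec, n1, n2, n3, n5, n6, n7, n8, n9, n10, n12, n13, n14, Ne.symm n6, Ne.symm n7,
        Ne.symm n1, Ne.symm n2, Ne.symm n3] using h2
    · rw [if_neg h] at h2
      have he : (Exp.le (.const 2) (.reg N)).eval τ = 0 := if_neg h
      rw [exec_ite_of_eq_zero he]
      simpa [exec, n1, n2, n3, n5, n6, n7, n8, n9, n10, n12, n13, n14, Ne.symm n6, Ne.symm n7,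
        Ne.symm n1, Ne.symm n2, Ne.symm n3, Ne.symm n10] using h2
  · intro τ hF hI _
    have hj : τ.reg j = k := by
      rw [hF.reg _ (by simp [n15, Ne.symm n4, Ne.symm n8, Ne.symm n11, Ne.symm n13]), hk]
    refine Ter.straight (by rfl) ?_
    by_cases h : k = 0
    · rw [exec_ite_of_eq_zero (by simpa [hj] using h)]
      subst h
      simpa [exec] using hI
    · rw [exec_ite_of_ne_zero (by simpa [hj] using h)]
      have := hI.succ
      have e : (fun t => 2 ^ k * g t + 1) = (letterMap k * g : Equiv.Perm ℚ) := by
        funext t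
        rw [Equiv.Perm.mul_apply, letterMap_apply h]
      rw [e] at this
      simpa [exec, n2, n6, Ne.symm n10] using this
  · have := Nat.mul_le_mul_right 26 hR
    omega

/-- The map in the arrays `24`, …, `27` at the position `v`. -/
abbrev _root_.Mem.RepAt (σ : Mem) (g : Equiv.Perm ℚ) (v : ℕ) : Prop :=
  AffineRep g (σ.arr (.scratch 24) v) (σ.arr (.scratch 25) v) (σ.arr (.scratch 26) v)
    (σ.arr (.scratch 27) v)

/-- The map in the registers `14`, …, `17`. -/
abbrev _root_.Mem.RepReg (σ : Mem) (g : Equiv.Perm ℚ) : Prop :=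
  AffineRep g (σ.reg (.scratch 14)) (σ.reg (.scratch 15)) (σ.reg (.scratch 16))
    (σ.reg (.scratch 17))

/-- Compute the map at the target of the edge `scratch 18` from the map at its source. -/
def edgeStep : Prog :=
  (.set (.scratch 19) (.arr (.scratch 16) (.reg (.scratch 18))) ;;
    .set (.scratch 14) (.arr (.scratch 24) (.reg (.scratch 19))) ;;
    .set (.scratch 15) (.arr (.scratch 25) (.reg (.scratch 19))) ;;
    .set (.scratch 16) (.arr (.scratch 26) (.reg (.scratch 19))) ;;
    .set (.scratch 17) (.arr (.scratch 27) (.reg (.scratch 19))) ;;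
    .set (.scratch 19) (.arr (.scratch 17) (.reg (.scratch 18)))) ;;
  appendLetter (.scratch 14) (.scratch 15) (.scratch 16) (.scratch 17) (.scratch 19) (.scratch 5) ;;
  .set (.scratch 19) (.arr (.scratch 18) (.reg (.scratch 18))) ;;
  appendLetter (.scratch 15) (.scratch 14) (.scratch 17) (.scratch 16) (.scratch 19) (.scratch 5)

/-- Multiplication by an inverse on the right is reduced to the left: `h * φ⁻¹ = (φ * h⁻¹)⁻¹`.
Inversion costs nothing, as it only exchanges the roles of `P`, `N` and of `X`, `Y`; the second call
of `appendLetter` has its registers exchanged accordingly. -/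
theorem Ter.edgeStep {σ : Mem} {R e : ℕ} {g : Equiv.Perm ℚ} (he : σ.reg (.scratch 18) = e)
    (hR : σ.arr (.scratch 17) e ≤ R) (hR' : σ.arr (.scratch 18) e ≤ R)
    (hg : σ.RepAt g (σ.arr (.scratch 16) e)) :
    Prog.edgeStep.Ter σ (R * 52 + 70) (fun τ =>
      τ.RepReg (letterMap (σ.arr (.scratch 17) e) * g * (letterMap (σ.arr (.scratch 18) e))⁻¹)) := by
  refine Ter.le (B := 24 + ((R * 26 + 20) + (3 + (R * 26 + 20)))) (Ter.seq ((Ter.straight (Q := fun τ =>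
    τ.RepReg g ∧ τ.reg (.scratch 19) = σ.arr (.scratch 17) e) (by rfl) ?_).imp ?_)) (by omega)
  · simpa [exec, he, Mem.RepReg] using hg
  rintro τ1 F1 ⟨h1, h2⟩ -
  refine Ter.seq ((Ter.appendLetter (by decide) h2 hR h1).imp ?_)
  intro τ2 F2 h3 _
  have h18 : τ2.arr (.scratch 18) = σ.arr (.scratch 18) := by
    rw [F2.arr _ (by rfl), F1.arr _ (by rfl)]
  have he2 : τ2.reg (.scratch 18) = e := by
    rw [F2.reg _ (by rfl), F1.reg _ (by rfl), he]
  refine Ter.seq (Ter.set fun F3 => ?_)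
  refine (Ter.appendLetter (g := (letterMap (σ.arr (.scratch 17) e) * g)⁻¹) (by decide) ?_ hR'
    ?_).imp ?_
  · simp [he2, h18]
  · simpa using h3.inv
  · intro τ4 _ h4
    have := h4.inv
    rwa [mul_inv_rev, inv_inv] at this

/-- The parent edge of a vertex starts at an earlier vertex and the order has no repetition, so the
potential can be defined vertex by vertex. -/
theorem _root_.SearchInv.exists_val {G : Type*} [Group G] {S D : ℕ → ℕ} {M V x : ℕ}
    {vis ord par : ℕ → ℕ} {c : ℕ} (hI : SearchInv S D M V x vis ord par c) (a b : ℕ → G) :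
    ∃ val : ℕ → G, val x = 1 ∧
      ∀ i < c, i ≠ 0 → val (ord i) = a (par i) * val (S (par i)) * b (par i) := by
  suffices ∀ k ≤ c, ∃ val : ℕ → G, val x = 1 ∧
      ∀ i < k, i ≠ 0 → val (ord i) = a (par i) * val (S (par i)) * b (par i) from this c le_rfl
  intro k hk
  induction k with
  | zero => exact ⟨1, rfl, by simp⟩
  | succ k ih =>
    obtain ⟨val, h0, h1⟩ := ih (by omega)
    by_cases hk0 : k = 0
    · exact ⟨val, h0, fun i hi hi0 => by omega⟩
    have hne : ∀ i < k, ord i ≠ ord k := fun i hi h => hi.ne (hI.inj i (by omega) k (by omega) h)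
    have hsrc : ∀ i ≤ k, i ≠ 0 → S (par i) ≠ ord k := by
      intro i hi hi0
      obtain ⟨-, -, j, hj, h⟩ := hI.tree i (by omega) hi0
      rw [← h]
      exact hne j (by omega)
    refine ⟨Function.update val (ord k) (a (par k) * val (S (par k)) * b (par k)), ?_, ?_⟩
    · rw [Function.update_of_ne, h0]
      rw [← hI.first]
      exact hne 0 (by omega)
    · intro i hi hi0
      rw [Function.update_of_ne (hsrc i (by omega) hi0)]
      obtain hi | rfl := Nat.lt_succ_iff_lt_or_eq.1 hi
      · rw [Function.update_of_ne (hne i hi), h1 i hi hi0]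
      · rw [Function.update_self]

/-- Compute the maps at the visited vertices along the edges of the search tree. -/
def assign : Prog :=
  (.write (.scratch 24) (.reg (.scratch 10)) (.const 1) ;;
    .write (.scratch 25) (.reg (.scratch 10)) (.const 1) ;;
    .write (.scratch 26) (.reg (.scratch 10)) (.const 0) ;;
    .write (.scratch 27) (.reg (.scratch 10)) (.const 0)) ;;
  loop (.scratch 3) (.scratch 11) (.ite (.reg (.scratch 3))
    (.set (.scratch 18) (.arr (.scratch 23) (.reg (.scratch 3))) ;; edgeStep ;;
      (.set (.scratch 19) (.arr (.scratch 22) (.reg (.scratch 3))) ;;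
      .write (.scratch 24) (.reg (.scratch 19)) (.reg (.scratch 14)) ;;
      .write (.scratch 25) (.reg (.scratch 19)) (.reg (.scratch 15)) ;;
      .write (.scratch 26) (.reg (.scratch 19)) (.reg (.scratch 16)) ;;
      .write (.scratch 27) (.reg (.scratch 19)) (.reg (.scratch 17)))) .skip)

/-- Vertices are treated in the order of the search, so the map at the source of a parent edge is in
memory when it is needed. -/
theorem Ter.assign {σ : Mem} {S D Y Z : ℕ → ℕ} {M V x R c : ℕ} {vis : ℕ → ℕ}
    {val : ℕ → Equiv.Perm ℚ} (hx : σ.reg (.scratch 10) = x) (hc : σ.reg (.scratch 11) = c)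
    (hS : σ.arr (.scratch 16) = S) (hY : σ.arr (.scratch 17) = Y) (hZ : σ.arr (.scratch 18) = Z)
    (hYR : ∀ e < M, Y e ≤ R) (hZR : ∀ e < M, Z e ≤ R)
    (hI : SearchInv S D M V x vis (σ.arr (.scratch 22)) (σ.arr (.scratch 23)) c)
    (h0 : val x = 1) (ht : ∀ i < c, i ≠ 0 → val (σ.arr (.scratch 22) i) =
      letterMap (Y (σ.arr (.scratch 23) i)) * val (S (σ.arr (.scratch 23) i)) *
        (letterMap (Z (σ.arr (.scratch 23) i)))⁻¹) :
    Prog.assign.Ter σ (V * (R * 52 + 110) + 30) (fun τ =>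
      ∀ v < V, vis v ≠ 0 → τ.RepAt (val v) v) := by
  refine Ter.le (B := 16 + (c * ((R * 52 + 97) + 10) + 8)) (Ter.seq ((Ter.straight (Q := fun τ =>
    τ.RepAt 1 x) (by rfl) (by simp [exec, hx, Mem.RepAt]; exact AffineRep.one)).imp ?_)) ?_
  swap
  · have := Nat.mul_le_mul_right (R * 52 + 107) hI.card_le
    ring_nf at this ⊢
    omega
  intro τ1 F1 h1 _
  refine (Ter.loop (fun i τ => τ.RepAt 1 x ∧
    ∀ j < i, τ.RepAt (val (σ.arr (.scratch 22) j)) (σ.arr (.scratch 22) j)) (R * 52 + 97) c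
    (by rw [F1.reg _ rfl, hc]) (by decide) (by decide) (by decide) ?_ ?_).imp ?_
  · exact ⟨h1, by simp⟩
  · rintro i hi τ hF hτi ⟨hx1, hI'⟩
    have a22 : τ.arr (.scratch 22) = σ.arr (.scratch 22) := by rw [hF.arr _ rfl, F1.arr _ rfl]
    have a23 : τ.arr (.scratch 23) = σ.arr (.scratch 23) := by rw [hF.arr _ rfl, F1.arr _ rfl]
    have a16 : τ.arr (.scratch 16) = S := by rw [hF.arr _ rfl, F1.arr _ rfl, hS]
    have a17 : τ.arr (.scratch 17) = Y := by rw [hF.arr _ rfl, F1.arr _ rfl, hY]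
    have a18 : τ.arr (.scratch 18) = Z := by rw [hF.arr _ rfl, F1.arr _ rfl, hZ]
    refine Ter.le (B := 1 + (3 + ((R * 52 + 70) + 20)) + 1) (Ter.ite ?_ ?_) (by omega)
    · intro he
      have hi0 : i ≠ 0 := by simpa [hτi] using he
      obtain ⟨t1, t2, j, hj, t3⟩ := hI.tree i hi hi0
      refine Ter.seq (Ter.set fun _ => ?_)
      refine Ter.seq ((Ter.edgeStep (R := R) (e := σ.arr (.scratch 23) i)
        (g := val (S (σ.arr (.scratch 23) i))) ?_ ?_ ?_ ?_).imp ?_)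
      · simp [hτi, a23]
      · simpa [a17] using hYR _ t1
      · simpa [a18] using hZR _ t1
      · have := hI' j hj
        rw [t3] at this
        simpa [a16, Mem.RepAt] using this
      · intro υ Fυ hυ _
        simp only [Mem.setReg_arr, a17, a18] at hυ
        rw [← ht i hi hi0] at hυ
        have r3 : υ.reg (.scratch 3) = i := by
          rw [Fυ.reg _ rfl]
          simpa using hτi
        have b22 : υ.arr (.scratch 22) = σ.arr (.scratch 22) := by rw [Fυ.arr _ rfl, ← a22]; rfl
        have b24 : υ.arr (.scratch 24) = τ.arr (.scratch 24) := by rw [Fυ.arr _ rfl]; rfl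
        have b25 : υ.arr (.scratch 25) = τ.arr (.scratch 25) := by rw [Fυ.arr _ rfl]; rfl
        have b26 : υ.arr (.scratch 26) = τ.arr (.scratch 26) := by rw [Fυ.arr _ rfl]; rfl
        have b27 : υ.arr (.scratch 27) = τ.arr (.scratch 27) := by rw [Fυ.arr _ rfl]; rfl
        -- The maps stored earlier survive, because the new vertex differs from all earlier ones.
        have hne : ∀ j < i, σ.arr (.scratch 22) j ≠ σ.arr (.scratch 22) i :=
          fun j hj h => hj.ne (hI.inj j (by omega) i hi h)
        refine Ter.straight (by rfl) ⟨?_, fun j hj => ?_⟩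
        · have hne0 := hne 0 (by omega)
          rw [hI.first] at hne0
          simpa [exec, r3, b22, b24, b25, b26, b27, hne0, Mem.RepAt] using hx1
        · obtain hj | rfl := Nat.lt_succ_iff_lt_or_eq.1 hj
          · simpa [exec, r3, b22, b24, b25, b26, b27, hne j hj, Mem.RepAt] using hI' j hj
          · simpa [exec, r3, b22, Mem.RepAt, Mem.RepReg] using hυ
    · intro he
      have hi0 : i = 0 := by simpa [hτi] using he
      refine Ter.le (B := 1) (Ter.skip ⟨hx1, fun j hj => ?_⟩) (by omega)
      obtain rfl : j = 0 := by omega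
      rw [hI.first, h0]
      exact hx1
  · rintro τ - ⟨-, h⟩ v hv hvis
    obtain ⟨i, hi, rfl⟩ := hI.ord_vis v hv hvis
    exact h i hi

/-- Clear the verdict unless the map in the registers `14`, …, `17` is the map at `v`. -/
def compare (v : Exp) : Prog :=
  .ite (.eq (.arr (.scratch 24) v) (.reg (.scratch 14)))
    (.ite (.eq (.arr (.scratch 25) v) (.reg (.scratch 15)))
      (.ite (.eq (.add (.arr (.scratch 26) v) (.reg (.scratch 17)))
          (.add (.reg (.scratch 16)) (.arr (.scratch 27) v)))
        .skip (.set .verdict (.const 0)))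
      (.set .verdict (.const 0)))
    (.set .verdict (.const 0))

theorem exec_compare {v : Exp} {σ : Mem} {g g' : Equiv.Perm ℚ} (hg : σ.RepAt g (v.eval σ))
    (hg' : σ.RepReg g') :
    ((compare v).exec σ).reg .verdict ≠ 0 ↔ σ.reg .verdict ≠ 0 ∧ g = g' := by
  rw [hg.eq_iff hg']
  by_cases h1 : σ.arr (.scratch 24) (v.eval σ) = σ.reg (.scratch 14) <;>
    by_cases h2 : σ.arr (.scratch 25) (v.eval σ) = σ.reg (.scratch 15) <;>
    by_cases h3 : σ.arr (.scratch 26) (v.eval σ) + σ.reg (.scratch 17) =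
      σ.reg (.scratch 16) + σ.arr (.scratch 27) (v.eval σ) <;>
    simp [compare, exec, h1, h2, h3]

/-- Check the edges between visited vertices of `28` and vertices of `29`, and the sink. -/
def checkEdges : Prog :=
  .set .verdict (.const 1) ;;
  loop (.scratch 3) (.scratch 8) (.ite (.arr (.scratch 28) (.arr (.scratch 16) (.reg (.scratch 3))))
    (.ite (.arr (.scratch 29) (.arr (.scratch 19) (.reg (.scratch 3))))
      (.set (.scratch 18) (.reg (.scratch 3)) ;; edgeStep ;;
        compare (.arr (.scratch 19) (.reg (.scratch 3)))) .skip) .skip) ;;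
  .ite (.arr (.scratch 28) (.reg (.scratch 7)))
    (.set (.scratch 14) (.const 1) ;; .set (.scratch 15) (.const 1) ;;
      .set (.scratch 16) (.const 0) ;; .set (.scratch 17) (.const 0) ;;
      compare (.reg (.scratch 7))) .skip

/-- The verdict is the criterion of `walkStep_unique_iff`, with array `28` for reachable and array
`29` for co-reachable vertices. By `hvis` the target of an edge from a visited vertex is visited, so
its map is in memory. -/
theorem Ter.checkEdges {σ : Mem} {S D Y Z : ℕ → ℕ} {M V N R : ℕ} {val : ℕ → Equiv.Perm ℚ}
    (hM : σ.reg (.scratch 8) = M) (hN : σ.reg (.scratch 7) = N) (hNV : N < V)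
    (hS : σ.arr (.scratch 16) = S) (hY : σ.arr (.scratch 17) = Y) (hZ : σ.arr (.scratch 18) = Z)
    (hD : σ.arr (.scratch 19) = D) (hSV : ∀ e < M, S e < V) (hDV : ∀ e < M, D e < V)
    (hYR : ∀ e < M, Y e ≤ R) (hZR : ∀ e < M, Z e ≤ R)
    (hvis : ∀ e < M, σ.arr (.scratch 28) (S e) ≠ 0 → σ.arr (.scratch 28) (D e) ≠ 0)
    (hval : ∀ v < V, σ.arr (.scratch 28) v ≠ 0 → σ.RepAt (val v) v) :
    Prog.checkEdges.Ter σ (M * (R * 52 + 160) + 100) (fun τ => τ.reg .verdict ≠ 0 ↔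
      (∀ e < M, σ.arr (.scratch 28) (S e) ≠ 0 → σ.arr (.scratch 29) (D e) ≠ 0 →
        val (D e) = letterMap (Y e) * val (S e) * (letterMap (Z e))⁻¹) ∧
      (σ.arr (.scratch 28) N ≠ 0 → val N = 1)) := by
  refine Ter.le (B := 1 + 1 + ((M * ((R * 52 + 150) + 10) + 8) + 80)) (Ter.seq (Ter.set fun F1 => ?_))
    (by ring_nf; omega)
  refine Ter.seq ((Ter.loop (fun i τ => τ.reg .verdict ≠ 0 ↔ ∀ e < i, σ.arr (.scratch 28) (S e) ≠ 0 →
    σ.arr (.scratch 29) (D e) ≠ 0 → val (D e) = letterMap (Y e) * val (S e) * (letterMap (Z e))⁻¹)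
    (R * 52 + 150) M (by simpa using hM) (by decide) (by decide) (by decide) (by simp) ?_).imp ?_)
  · intro i hi τ hF hτi hI
    have ra : ∀ a, Prog.checkEdges.writesArr a = false → τ.arr a = σ.arr a := fun a ha => by
      rw [hF.arr a (by
        simp only [Prog.checkEdges, writesArr, Bool.or_eq_false_iff] at ha
        exact ha.2.1)]
      rfl
    -- A round conjoins one condition `p` to the verdict; for an edge that need not be checked, `p`
    -- is `True`.
    have hstep : ∀ {υ : Mem} {p : Prop}, (υ.reg .verdict ≠ 0 ↔ τ.reg .verdict ≠ 0 ∧ p) →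
        (p ↔ (σ.arr (.scratch 28) (S i) ≠ 0 →
          σ.arr (.scratch 29) (D i) ≠ 0 →
          val (D i) = letterMap (Y i) * val (S i) * (letterMap (Z i))⁻¹)) →
        ((υ.setReg (.scratch 3) (i + 1)).reg .verdict ≠ 0 ↔ ∀ e < i + 1,
          σ.arr (.scratch 28) (S e) ≠ 0 → σ.arr (.scratch 29) (D e) ≠ 0 →
          val (D e) = letterMap (Y e) * val (S e) * (letterMap (Z e))⁻¹) := by
      intro υ p h hp
      have : (υ.setReg (.scratch 3) (i + 1)).reg .verdict = υ.reg .verdict := by simp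
      rw [this, h, hI, hp]
      constructor
      · rintro ⟨h1, h2⟩ e he
        obtain he | rfl := Nat.lt_succ_iff_lt_or_eq.1 he
        exacts [h1 e he, h2]
      · exact fun h => ⟨fun e he => h e (by omega), h i (by omega)⟩
    have a28 := ra (.scratch 28) rfl
    have a29 := ra (.scratch 29) rfl
    have a16 : τ.arr (.scratch 16) = S := (ra _ rfl).trans hS
    have a17 : τ.arr (.scratch 17) = Y := (ra _ rfl).trans hY
    have a18 : τ.arr (.scratch 18) = Z := (ra _ rfl).trans hZ
    have a19 : τ.arr (.scratch 19) = D := (ra _ rfl).trans hD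
    refine Ter.le (B := 3 + (3 + (2 + ((R * 52 + 70) + 70)) + 1) + 1) (Ter.ite (fun h1 => ?_) fun h1 => ?_)
      (by omega)
    swap
    · simp only [Exp.eval, a28, a16, hτi] at h1
      exact (Ter.skip (hstep (p := True) (by simp) (by simp [h1]))).le (by omega)
    refine Ter.ite (fun h2 => ?_) fun h2 => ?_
    swap
    · simp only [Exp.eval, a29, a19, hτi] at h2
      exact (Ter.skip (hstep (p := True) (by simp) (by simp [h2]))).le (by omega)
    simp only [Exp.eval, a28, a29, a16, a19, hτi] at h1 h2
    have hrep : ∀ v < V, σ.arr (.scratch 28) v ≠ 0 → τ.RepAt (val v) v := by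
      intro v hv hvv
      have := hval v hv hvv
      rwa [Mem.RepAt, ← ra (.scratch 24) rfl, ← ra (.scratch 25) rfl, ← ra (.scratch 26) rfl,
        ← ra (.scratch 27) rfl] at this
    refine Ter.seq (Ter.set fun F2 => ?_)
    refine Ter.seq ((Ter.edgeStep (R := R) (e := i) (g := val (S i)) (by simpa using hτi)
      (by simpa [a17] using hYR i hi) (by simpa [a18] using hZR i hi)
      (by simpa [a16, Mem.RepAt] using hrep _ (hSV i hi) h1)).imp ?_)
    intro υ Fυ hυ _
    simp only [Mem.setReg_arr, a17, a18] at hυ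
    have r3 : υ.reg (.scratch 3) = i := by
      rw [Fυ.reg _ rfl]
      simpa using hτi
    have rv : υ.reg .verdict = τ.reg .verdict := by
      rw [Fυ.reg _ rfl]
      simp
    have rυ : ∀ a, Prog.edgeStep.writesArr a = false → υ.arr a = τ.arr a := fun a ha => Fυ.arr a ha
    refine Ter.straight (by rfl) ?_
    have := exec_compare (σ := υ) (v := .arr (.scratch 19) (.reg (.scratch 3))) (g := val (D i))
      (g' := _) ?_ hυ
    · rw [rv] at this
      exact hstep this (by simp [h1, h2])
    · have h3 := hrep _ (hDV i hi) (hvis i hi h1)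
      simp only [Exp.eval, r3, rυ (.scratch 19) rfl, a19]
      rwa [Mem.RepAt, rυ (.scratch 24) rfl, rυ (.scratch 25) rfl, rυ (.scratch 26) rfl,
        rυ (.scratch 27) rfl]
  · intro τ hF hI _
    have ra : ∀ a, τ.arr a = σ.arr a := fun a => by rw [hF.arr a rfl]; rfl
    have r7 : τ.reg (.scratch 7) = N := by
      rw [hF.reg _ rfl]
      simpa using hN
    refine Ter.straight (by rfl) ?_
    by_cases h : σ.arr (.scratch 28) N = 0
    · rw [exec_ite_of_eq_zero (by simpa [r7, ra] using h)]
      simp only [exec, hI, h, ne_eq, not_true_eq_false, false_imp_iff, and_true]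
    · rw [exec_ite_of_ne_zero (by simpa [r7, ra] using h)]
      simp only [exec_seq, exec_set, Exp.eval]
      rw [exec_compare (g := val N) (g' := 1)]
      · simp only [Mem.setReg_reg, reduceCtorEq, if_false, hI, h, ne_eq, not_false_eq_true,
          true_imp_iff]
      · have := hval N hNV h
        simp only [Mem.RepAt, ← ra] at this
        simpa [Mem.RepAt, r7] using this
      · simpa [Mem.RepReg] using AffineRep.one

end Prog

/-! ### The functionality test as a program. -/

theorem List.length_flatMap_le {α β : Type*} {l : List α} {f : α → List β} {k : ℕ}
    (h : ∀ x ∈ l, (f x).length ≤ k) : (l.flatMap f).length ≤ l.length * k := by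
  induction l with
  | nil => simp
  | cons x l ih =>
    have h1 := h x (by simp)
    have h2 := ih fun y hy => h y (by simp [hy])
    simp only [List.flatMap_cons, List.length_append, List.length_cons, Nat.add_mul]
    omega

namespace Prog

/-- The edges between pairs of states, for a list of transitions with numbered output labels. -/
def pairList (P : ℕ) (E : List Quad) : List Quad :=
  E.flatMap fun t => E.flatMap fun t' => if t'.2.1 = t.2.1 then
    [(t.1 * P + t'.1, t.2.2.1, t'.2.2.1, t.2.2.2 * P + t'.2.2.2)] else []

/-- The edges from the pairs of final states to the sink. -/
def sinkList (P : ℕ) (F : ℕ → ℕ) : List Quad :=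
  (List.range P).flatMap fun p => if F p ≠ 0 then (List.range P).flatMap fun q =>
    if F q ≠ 0 then [(p * P + q, 0, 0, P * P)] else [] else []

theorem length_pairList (P : ℕ) (E : List Quad) :
    (pairList P E).length ≤ E.length * E.length := by
  refine List.length_flatMap_le fun t _ => (List.length_flatMap_le (k := 1) fun t' _ => ?_).trans
    (mul_one _).le
  split_ifs <;> simp

theorem length_sinkList (P : ℕ) (F : ℕ → ℕ) : (sinkList P F).length ≤ P * P := by
  refine (List.length_flatMap_le (k := P) fun t _ => ?_).trans (by simp)
  split_ifs
  · refine (List.length_flatMap_le (k := 1) fun t' _ => ?_).trans (by simp)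
    split_ifs <;> simp
  · simp

/-- Construct the list of the transitions with the empty moves. -/
def extList : Prog :=
  loop (.scratch 3) (.numTrans .product)
    (push (.scratch 6) (.scratch 2) (.scratch 3) (.scratch 4) (.scratch 5)
      (.arr (.src .product) (.reg (.scratch 3))) (.arr (.inp .product) (.reg (.scratch 3)))
      (.arr (.scratch 1) (.reg (.scratch 3))) (.arr (.dst .product) (.reg (.scratch 3)))) ;;
  loop (.scratch 3) (.numStates .product)
    (push (.scratch 6) (.scratch 2) (.scratch 3) (.scratch 4) (.scratch 5)
      (.reg (.scratch 3)) (.const 0) (.const 0) (.reg (.scratch 3)))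

/-- Construct the edges of the graph of pairs. -/
def pairGraph : Prog :=
  loop (.scratch 3) (.scratch 6) (loop (.scratch 4) (.scratch 6)
    (.ite (.eq (.arr (.scratch 3) (.reg (.scratch 4))) (.arr (.scratch 3) (.reg (.scratch 3))))
      (push (.scratch 8) (.scratch 16) (.scratch 17) (.scratch 18) (.scratch 19)
        (.add (.arr (.scratch 6) (.arr (.scratch 2) (.reg (.scratch 3))))
          (.arr (.scratch 2) (.reg (.scratch 4))))
        (.arr (.scratch 4) (.reg (.scratch 3))) (.arr (.scratch 4) (.reg (.scratch 4)))
        (.add (.arr (.scratch 6) (.arr (.scratch 5) (.reg (.scratch 3))))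
          (.arr (.scratch 5) (.reg (.scratch 4))))) .skip)) ;;
  loop (.scratch 3) (.numStates .product) (.ite (.arr (.final .product) (.reg (.scratch 3)))
    (loop (.scratch 4) (.numStates .product) (.ite (.arr (.final .product) (.reg (.scratch 4)))
      (push (.scratch 8) (.scratch 16) (.scratch 17) (.scratch 18) (.scratch 19)
        (.add (.arr (.scratch 6) (.reg (.scratch 3))) (.reg (.scratch 4)))
        (.const 0) (.const 0) (.reg (.scratch 7))) .skip)) .skip)

theorem Ter.extList {σ : Mem} {P : ℕ} {l : List Quad}
    (hP : σ.reg (.numStates .product) = P) (h6 : σ.reg (.scratch 6) = 0)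
    (hl : σ.list (.numTrans .product) (.src .product) (.inp .product) (.scratch 1)
      (.dst .product) = l) :
    Prog.extList.Ter σ ((l.length + P) * 40 + 16) (fun τ =>
      τ.list (.scratch 6) (.scratch 2) (.scratch 3) (.scratch 4) (.scratch 5) =
        l ++ (List.range P).flatMap fun q => [(q, 0, 0, q)]) := by
  refine (Ter.seq (B := l.length * (30 + 10) + 8) (B' := P * (30 + 10) + 8)
    ((Ter.loop_forEach (fun t => [t]) 30 hl (by decide)
    (by decide) (by decide) (by decide) (m := .scratch 6) (a := .scratch 2) (b := .scratch 3)
    (c := .scratch 4) (d := .scratch 5) (l := []) (by simp [Mem.list, h6]) ?_).imp ?_)).le (by omega)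
  · intro j hj τ hF hij _ l' hl'
    refine Ter.push (by decide) hl' (by decide) ?_
    intro ω hr ha
    simp [hr, ha, hij, Mem.row, hF.arr (.src .product) (by decide),
      hF.arr (.inp .product) (by decide), hF.arr (.dst .product) (by decide),
      hF.arr (.scratch 1) (by decide)]
  · intro τ hF h _
    simp only [List.nil_append, List.flatMap_singleton'] at h
    refine Ter.loop_append (fun q => [(q, 0, 0, q)]) 30 P ?_ (by decide) (by decide) (by decide)
      (by decide) h ?_
    · rw [hF.reg _ (by decide), hP]
    · intro j hj τ hF hij l' hl'
      refine Ter.push (by decide) hl' (by decide) ?_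
      intro ω hr ha
      simp [hr, hij]

/-- Arrays `16` to `19` receive the source, the two output numbers and the target of each edge. A
pair `(p, q)` has the code `p * P + q`, computed with the table in array `6`, and `P * P` is the
sink. -/
theorem Ter.pairGraph {σ : Mem} {P : ℕ} {E : List Quad}
    (hP : σ.reg (.numStates .product) = P) (h8 : σ.reg (.scratch 8) = 0)
    (h7 : σ.reg (.scratch 7) = P * P) (h6 : ∀ p < P, σ.arr (.scratch 6) p = p * P)
    (hE : σ.list (.scratch 6) (.scratch 2) (.scratch 3) (.scratch 4) (.scratch 5) = E)
    (hEP : ∀ t ∈ E, t.1 < P ∧ t.2.2.2 < P) :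
    Prog.pairGraph.Ter σ ((E.length * (E.length * 80 + 18) + 8) + (P * (P * 60 + 22) + 8)) (fun τ =>
      τ.list (.scratch 8) (.scratch 16) (.scratch 17) (.scratch 18) (.scratch 19) =
        pairList P E ++ sinkList P (σ.arr (.final .product))) := by
  refine Ter.seq ((Ter.loop_forEach (fun t => E.flatMap fun t' => if t'.2.1 = t.2.1 then
    [(t.1 * P + t'.1, t.2.2.1, t'.2.2.1, t.2.2.2 * P + t'.2.2.2)] else [])
    (E.length * (70 + 10) + 8) hE (by decide) (by decide) (by decide) (by decide)
    (m := .scratch 8) (a := .scratch 16) (b := .scratch 17)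
    (c := .scratch 18) (d := .scratch 19) (l := []) (by simp [Mem.list, h8]) ?_).imp ?_)
  · intro i hi τ F hτi hiE l hl
    have hEτ : τ.list (.scratch 6) (.scratch 2) (.scratch 3) (.scratch 4) (.scratch 5) = E := by
      rw [← hE]
      exact Mem.list_congr (F.reg _ (by decide)) (F.arr _ (by decide)) (F.arr _ (by decide))
        (F.arr _ (by decide)) (F.arr _ (by decide))
    refine Ter.loop_forEach _ _ hEτ (by decide) (by decide) (by decide) (by decide) hl ?_
    intro j hj υ F' hυj hjE l' hl'
    have r3 : υ.reg (.scratch 3) = i := by rw [F'.reg _ (by decide), hτi]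
    have ra : ∀ a ∈ [Arr.scratch 2, .scratch 3, .scratch 4, .scratch 5, .scratch 6],
        τ.arr a = σ.arr a ∧ υ.arr a = σ.arr a := by
      intro a ha
      have h2 : υ.arr a = τ.arr a := F'.arr a (by revert a; decide)
      have h1 : τ.arr a = σ.arr a := F.arr a (by clear h2; revert a; decide)
      exact ⟨h1, h2.trans h1⟩
    obtain ⟨a2, b2⟩ := ra (.scratch 2) (by decide)
    obtain ⟨a3, b3⟩ := ra (.scratch 3) (by decide)
    obtain ⟨a4, b4⟩ := ra (.scratch 4) (by decide)
    obtain ⟨a5, b5⟩ := ra (.scratch 5) (by decide)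
    obtain ⟨-, b6⟩ := ra (.scratch 6) (by decide)
    refine Ter.le (B := 13 + 50 + 1) (Ter.ite (fun he => ?_) fun he => ?_) (by omega)
    · simp only [Exp.eval_eq, Exp.eval, hυj, r3, b3] at he
      have he : σ.arr (.scratch 3) j = σ.arr (.scratch 3) i := by by_contra h; simp [h] at he
      simp only [Mem.row, a2, a3, a4, a5, he, if_true]
      refine Ter.push (by decide) hl' (by decide) ?_
      intro ω hr ha
      have e1 := h6 _ (hEP _ hiE).1
      have e2 := h6 _ (hEP _ hiE).2
      simp only [Mem.row] at e1 e2
      simp [hr, ha, r3, hυj, b2, b4, b5, b6, e1, e2]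
    · simp only [Exp.eval_eq, Exp.eval, hυj, r3, b3] at he
      have he : σ.arr (.scratch 3) j ≠ σ.arr (.scratch 3) i := by intro h; simp [h] at he
      refine (Ter.skip ?_).le (by omega)
      simp only [Mem.row, a3, if_neg he, hl', List.append_nil]
  · intro τ F h _
    rw [List.nil_append] at h
    have hf : τ.arr (.final .product) = σ.arr (.final .product) := F.arr _ (by decide)
    have hPτ : τ.reg (.numStates .product) = P := (F.reg _ (by decide)).trans hP
    rw [sinkList]
    refine (Ter.loop_append (fun p => if σ.arr (.final .product) p ≠ 0 then
      (List.range P).flatMap fun q => if σ.arr (.final .product) q ≠ 0 then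
        [(p * P + q, 0, 0, P * P)] else [] else []) (2 + (P * (50 + 10) + 8) + 1) P hPτ (by decide)
        (by decide) (by decide) (by decide) h ?_).le (by ring_nf; omega)
    intro i hi υ F' hυi l hl
    have hfυ : υ.arr (.final .product) = σ.arr (.final .product) := (F'.arr _ (by decide)).trans hf
    have hPυ : υ.reg (.numStates .product) = P := (F'.reg _ (by decide)).trans hPτ
    refine Ter.ite (fun he => ?_) fun he => ?_
    swap
    · simp only [Exp.eval, hυi, hfυ] at he
      refine (Ter.skip ?_).le (by omega)
      simp [he, hl]
    simp only [Exp.eval, hυi, hfυ] at he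
    rw [if_pos he]
    refine Ter.loop_append _ _ P hPυ (by decide) (by decide) (by decide) (by decide) hl ?_
    intro j hj ω F'' hωj l' hl'
    refine Ter.le (B := 2 + 40 + 1) (Ter.ite (fun he' => ?_) fun he' => ?_) (by omega)
    · simp only [Exp.eval, hωj, F''.arr (.final .product) (by decide), hfυ] at he'
      rw [if_pos he']
      refine Ter.push (by decide) hl' (by decide) ?_
      intro ρ hr ha
      simp [hr, ha, hωj, F''.reg (.scratch 3) (by decide), hυi, F''.arr (.scratch 6) (by decide),
        F'.arr (.scratch 6) (by decide), F.arr (.scratch 6) (by decide), h6 i hi,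
        F''.reg (.scratch 7) (by decide), F'.reg (.scratch 7) (by decide),
        F.reg (.scratch 7) (by decide), h7]
    · simp only [Exp.eval, hωj, F''.arr (.final .product) (by decide), hfυ] at he'
      refine (Ter.skip ?_).le (by omega)
      simp [he', hl']

/-- The added records `(q, 0, 0, q)` are the empty moves. They have input code `0`, so equality of
input codes covers both a common symbol and a transition with empty input made against a resting
partner. -/
theorem isPairGraph_pairList {P : Type} [Fintype P] {num : P ≃ Fin (Fintype.card P)}
    {T : Transducer P} {f : ℕ → ℕ} {n : ℕ} (hn : Fintype.card P = n) (h0 : f 0 = 0)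
    {F : ℕ → ℕ} {l : List Quad}
    (hl : ∀ x, x ∈ l ↔ ∃ t ∈ T.trans,
      ((num t.1 : ℕ), labelCode t.2.1, f (labelCode t.2.2.1), (num t.2.2.2 : ℕ)) = x)
    (hF : ∀ p, F (num p) ≠ 0 ↔ p ∈ T.final) :
    T.IsPairGraph (fun p p' => num p * n + num p') f
      (n * n)
      (pairList n (l ++ (List.range n).flatMap fun q => [(q, 0, 0, q)])
        ++ sinkList n F) := by
  subst hn
  have hE : ∀ x, x ∈ l ++ (List.range (Fintype.card P)).flatMap (fun q => [(q, 0, 0, q)]) ↔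
      ∃ t, T.Ext t ∧
        ((num t.1 : ℕ), labelCode t.2.1, f (labelCode t.2.2.1), (num t.2.2.2 : ℕ)) = x := by
    intro x
    simp only [List.mem_append, hl, List.mem_flatMap, List.mem_range, List.mem_singleton]
    constructor
    · rintro (⟨t, ht, rfl⟩ | ⟨q, hq, rfl⟩)
      · exact ⟨t, .inl ht, rfl⟩
      · exact ⟨(num.symm ⟨q, hq⟩, none, none, num.symm ⟨q, hq⟩), .inr ⟨rfl, rfl, rfl⟩,
          by simp [labelCode, h0]⟩
    · rintro ⟨⟨p, x, y, q⟩, ht | ⟨hx, hy, hpq⟩, rfl⟩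
      · exact .inl ⟨_, ht, rfl⟩
      · simp only at hx hy hpq
        subst hx hy hpq
        exact .inr ⟨num p, (num p).2, by simp [labelCode, h0]⟩
  intro r
  rw [List.mem_append]
  refine or_congr ?_ ?_
  · simp only [pairList, List.mem_flatMap (l := l ++ _), hE]
    constructor
    · rintro ⟨_, ⟨t, ht, rfl⟩, _, ⟨t', ht', rfl⟩, h⟩
      simp only at h
      split_ifs at h with h1
      · exact ⟨t, t', ht, ht', (labelCode_injective h1).symm, (List.mem_singleton.1 h).symm⟩
      · simp at h
    · rintro ⟨t, t', ht, ht', h, rfl⟩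
      exact ⟨_, ⟨t, ht, rfl⟩, _, ⟨t', ht', rfl⟩, by simp [h]⟩
  · simp only [sinkList, List.mem_flatMap, List.mem_range]
    constructor
    · rintro ⟨p, hp, h⟩
      split_ifs at h with h1
      · obtain ⟨q, hq, h⟩ := List.mem_flatMap.1 h
        split_ifs at h with h2
        · rw [List.mem_singleton] at h
          refine ⟨num.symm ⟨p, hp⟩, (hF _).1 (by simpa using h1), num.symm ⟨q, List.mem_range.1 hq⟩,
            (hF _).1 (by simpa using h2), by simp [h]⟩
        · simp at h
      · simp at h
    · rintro ⟨p, hp, q, hq, rfl⟩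
      refine ⟨num p, (num p).2, ?_⟩
      rw [if_pos ((hF p).2 hp)]
      refine List.mem_flatMap.2 ⟨num q, List.mem_range.2 (num q).2, ?_⟩
      rw [if_pos ((hF q).2 hq)]
      simp

/-- Decide whether a transducer is functional. -/
def functional : Prog :=
  dedupe (.arr (.out .product) (.reg (.scratch 0))) (.numTrans .product) ;;
  mulTable (.scratch 6) (.scratch 7) (.scratch 3) (.numStates .product) (.numStates .product) ;;
  (.set (.scratch 6) (.const 0) ;; .set (.scratch 8) (.const 0) ;;
    .set (.scratch 9) (.add (.reg (.scratch 7)) (.const 1)) ;;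
    .set (.scratch 10) (.reg (.scratch 7))) ;;
  extList ;; pairGraph ;;
  search (.scratch 19) (.scratch 16) (.scratch 29) ;;
  .set (.scratch 10) (.add (.arr (.scratch 6) (.reg (.start .product))) (.reg (.start .product))) ;;
  search (.scratch 16) (.scratch 19) (.scratch 28) ;;
  assign ;; checkEdges

/-- Number the members of a list by their positions, and all other numbers arbitrarily. -/
def rank (C : List ℕ) (c : ℕ) : ℕ := if c ∈ C then C.idxOf c else c + C.length

/-- Numbers outside the list are shifted beyond its length, away from the positions.
`Transducer.functional_iff` asks for a numbering that is injective everywhere, although only labels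
that occur are ever looked up. -/
theorem rank_injective (C : List ℕ) : Function.Injective (rank C) := by
  intro a b h
  unfold rank at h
  split_ifs at h with ha hb hb
  · exact (List.idxOf_inj ha).1 h
  · have := List.idxOf_lt_length_of_mem ha
    omega
  · have := List.idxOf_lt_length_of_mem hb
    omega
  · omega

/-- The part of `functional` after the construction of the graph. -/
theorem Ter.functional_search {σ : Mem} {P : Type} [Fintype P] {T : Transducer P}
    {num : P ≃ Fin (Fintype.card P)} {f : ℕ → ℕ} {l : List Quad} {R n : ℕ}
    (hn : Fintype.card P = n)
    (hl : σ.list (.scratch 8) (.scratch 16) (.scratch 17) (.scratch 18) (.scratch 19) = l)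
    (hg : T.IsPairGraph (fun p p' => num p * n + num p') f (n * n) l)
    (hf : Function.Injective f) (h0 : f 0 = 0) (hR : ∀ r ∈ l, r.2.1 ≤ R ∧ r.2.2.1 ≤ R)
    (h7 : σ.reg (.scratch 7) = n * n) (h9 : σ.reg (.scratch 9) = n * n + 1)
    (h10 : σ.reg (.scratch 10) = n * n) (h6 : ∀ p < n, σ.arr (.scratch 6) p = p * n)
    (hs : σ.reg (.start .product) = num T.start) :
    (Prog.search (.scratch 19) (.scratch 16) (.scratch 29) ;;
    .set (.scratch 10) (.add (.arr (.scratch 6) (.reg (.start .product)))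
      (.reg (.start .product))) ;;
    Prog.search (.scratch 16) (.scratch 19) (.scratch 28) ;;
    Prog.assign ;; Prog.checkEdges).Ter σ
      (((n * n + 1) + l.length) * (R * 52 + 360) + 250)
      (fun τ => τ.reg .verdict ≠ 0 ↔ T.Functional) := by
  obtain ⟨V, hV⟩ : ∃ V, V = n * n + 1 := ⟨_, rfl⟩
  obtain ⟨M, hM⟩ : ∃ M, M = σ.reg (.scratch 8) := ⟨_, rfl⟩
  have hMl : l.length = M := by rw [← hl, Mem.length_list, hM]
  -- Codes of pairs stay below `n * n`, so this number is free for the sink and there are `V = n * n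
  -- + 1` vertices.
  have hpcV : ∀ p p' : P, num p * n + num p' < n * n := by
    intro p p'
    have h1 := (num p).2
    have h2 := (num p').2
    calc num p * n + num p' < num p * n + n := by omega
      _ = (num p + 1) * n := by ring
      _ ≤ n * n := Nat.mul_le_mul_right _ (by omega)
  have hlV : ∀ r ∈ l, r.1 < V ∧ r.2.2.2 < V := by
    intro r hr
    obtain ⟨t, t', -, -, -, rfl⟩ | ⟨p, -, p', -, rfl⟩ := (hg r).1 hr
    · exact ⟨(hpcV _ _).trans (by omega), (hpcV _ _).trans (by omega)⟩
    · exact ⟨(hpcV _ _).trans (by omega), by simp only; omega⟩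
  have hrow : ∀ e < M, σ.row (.scratch 16) (.scratch 17) (.scratch 18) (.scratch 19) e ∈ l :=
    fun e he => hl ▸ Mem.row_mem_list (hM ▸ he) _ _ _ _
  have hSV : ∀ e < M, σ.arr (.scratch 16) e < V := fun e he => (hlV _ (hrow e he)).1
  have hDV : ∀ e < M, σ.arr (.scratch 19) e < V := fun e he => (hlV _ (hrow e he)).2
  have hYR : ∀ e < M, σ.arr (.scratch 17) e ≤ R := fun e he => (hR _ (hrow e he)).1
  have hZR : ∀ e < M, σ.arr (.scratch 18) e ≤ R := fun e he => (hR _ (hrow e he)).2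
  have hstart : num T.start * n + num T.start < V := (hpcV _ _).trans (by omega)
  rw [hMl, ← hV]
  refine Ter.le (B := ((V + M) * 100 + 50) + (5 + (((V + M) * 100 + 50) +
    ((V * (R * 52 + 110) + 30) + (M * (R * 52 + 160) + 100))))) (Ter.seq ((Ter.search (by decide)
    (by decide) (by decide) hM.symm (h9.trans hV.symm) h10 rfl rfl hSV (by omega)).imp ?_))
    (by ring_nf; omega)
  -- The first search used the reversed edges and started at the sink: array `29` marks the vertices
  -- from which the sink can be reached.
  rintro τ1 F1 ⟨-, hco⟩ -
  refine Ter.seq (Ter.set fun F2 => ?_)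
  obtain ⟨τ2, hτ2⟩ : ∃ τ2, τ2 = τ1.setReg (.scratch 10) (Exp.eval τ1 (.add (.arr (.scratch 6)
    (.reg (.start .product))) (.reg (.start .product)))) := ⟨_, rfl⟩
  rw [← hτ2] at F2 ⊢
  have hx2 : τ2.reg (.scratch 10) = num T.start * n + num T.start := by
    rw [hτ2]
    simp only [Mem.setReg_reg, if_true, Exp.eval, F1.reg (.start .product) (by decide), hs,
      F1.arr (.scratch 6) (by decide)]
    rw [h6 _ (hn ▸ (num T.start).2)]
  have a2 : ∀ a, a ∈ [Arr.scratch 16, .scratch 17, .scratch 18, .scratch 19] →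
      τ2.arr a = σ.arr a := fun a ha =>
    (F2.arr a (by revert a; decide)).trans (F1.arr a (by revert a; decide))
  refine Ter.seq ((Ter.search (M := M) (V := V) (by decide)
    (by decide) (by decide) ?_ ?_ hx2 (a2 _ (by decide)) (a2 _ (by decide)) hDV
    hstart).imp ?_)
  · rw [F2.reg _ (by decide), F1.reg _ (by decide), hM]
  · rw [F2.reg _ (by decide), F1.reg _ (by decide), h9, hV]
  rintro τ3 F3 ⟨hI, hvis⟩ -
  obtain ⟨val, hval0, hval⟩ := hI.exists_val (fun e => letterMap (σ.arr (.scratch 17) e))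
    (fun e => (letterMap (σ.arr (.scratch 18) e))⁻¹)
  have a3 : ∀ a, a ∈ [Arr.scratch 16, .scratch 17, .scratch 18, .scratch 19] →
      τ3.arr a = σ.arr a := fun a ha => (F3.arr a (by revert a; decide)).trans (a2 a ha)
  refine Ter.seq ((Ter.assign (M := M) (V := V) (R := R) (vis := τ3.arr (.scratch 28)) (val := val)
    ((F3.reg _ (by decide)).trans hx2) rfl (a3 _ (by decide)) (a3 _ (by decide)) (a3 _ (by decide))
    hYR hZR hI hval0 hval).imp ?_)
  rintro τ4 F4 h4 -
  have hMap : (List.range M).map (fun e => (σ.arr (.scratch 16) e, σ.arr (.scratch 17) e,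
      σ.arr (.scratch 18) e, σ.arr (.scratch 19) e)) = l := by rw [← hl, Mem.list, hM]; rfl
  have e28 : τ4.arr (.scratch 28) = τ3.arr (.scratch 28) := F4.arr _ (by decide)
  have e29 : τ4.arr (.scratch 29) = τ1.arr (.scratch 29) := by
    rw [F4.arr _ (by decide), F3.arr _ (by decide), F2.arr _ (by decide)]
  have a4 : ∀ a, a ∈ [Arr.scratch 16, .scratch 17, .scratch 18, .scratch 19] →
      τ4.arr a = σ.arr a := fun a ha => (F4.arr a (by revert a; decide)).trans (a3 a ha)
  refine (Ter.checkEdges (M := M) (V := V) (N := n * n) (R := R) (val := val) ?_ ?_ (by omega)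
    (a4 _ (by decide)) (a4 _ (by decide)) (a4 _ (by decide)) (a4 _ (by decide)) hSV hDV hYR hZR ?_
    ?_).imp ?_
  · rw [F4.reg _ (by decide), F3.reg _ (by decide), F2.reg _ (by decide), F1.reg _ (by decide), hM]
  · rw [F4.reg _ (by decide), F3.reg _ (by decide), F2.reg _ (by decide), F1.reg _ (by decide), h7]
  · intro e he h
    rw [e28] at h ⊢
    exact (hvis _ (hDV e he)).2 (((hvis _ (hSV e he)).1 h).tail ⟨e, he, rfl, rfl⟩)
  · intro v hv h
    rw [e28] at h
    exact h4 v hv h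
  · intro τ5 _ h5
    rw [h5, Transducer.functional_iff hg _ _ hf h0, e28, e29]
    · exact (walkStep_unique_iff (φ := letterMap) hI hSV hDV (by omega) hvis hco hMap hval0
        hval).symm
    · intro p p' q q' h
      obtain ⟨h1, h2⟩ := pair_code_injective (hn ▸ (num p').2) (hn ▸ (num q').2) h
      exact ⟨num.injective (Fin.ext h1), num.injective (Fin.ext h2)⟩
    · intro p p'
      exact (hpcV p p').ne

/-- `U` bounds the number of output labels. There are at most `(m + n) ^ 2 + n ^ 2` edges between
the pairs and to the sink, where `m` and `n` count transitions and states, and each takes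
`O(U.card)` steps. Only outputs are renumbered; input labels are merely compared. -/
theorem Ter.functional {P : Type} [Fintype P] {T : Transducer P} {σ : Mem}
    (hT : σ.HoldsTransducer .product T) {U : Finset ℕ} (hU0 : 0 ∈ U)
    (hU : ∀ t ∈ T.trans, labelCode t.2.2.1 ∈ U) :
    functional.Ter σ (4000 * ((T.trans.card + Fintype.card P) ^ 2 * U.card))
      (fun τ => τ.reg .verdict ≠ 0 ↔ T.Functional) := by
  have hm0 := hT.numTrans_eq
  obtain ⟨num, hnd, hmem, h1, h2, h3⟩ := Mem.holdsTransducer_iff.1 hT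
  obtain ⟨m, hm⟩ : ∃ m, m = T.trans.card := ⟨_, rfl⟩
  obtain ⟨n, hn⟩ : ∃ n, n = Fintype.card P := ⟨_, rfl⟩
  have hn1 : 1 ≤ n := hn ▸ Fintype.card_pos_iff.2 ⟨T.start⟩
  have hU1 : 1 ≤ U.card := Finset.card_pos.2 ⟨0, hU0⟩
  have hout : ∀ j < m, σ.arr (.out .product) j ∈ U := by
    intro j hj
    obtain ⟨t, ht, h⟩ := (hmem _).1 (Mem.row_mem_list (σ := σ) (n := .numTrans .product) (i := j)
      (by rw [hm0, ← hm]; exact hj) _ _ _ _)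
    simp only [transRecord, Mem.row, Prod.mk.injEq] at h
    rw [← h.2.2.1]
    exact hU t ht
  rw [← hm, ← hn]
  refine Ter.le (B := (m * (U.card * 32 + 44) + 20) + ((n * 18 + 10) + (12 + (((m + n) * 40 + 16) +
    ((((m + n) * ((m + n) * 80 + 18) + 8) + (n * (n * 60 + 22) + 8)) +
    (((n * n + 1) + ((m + n) * (m + n) + n * n)) * (U.card * 52 + 360) + 250))))))
    (Ter.seq ((Ter.dedupe (f := σ.arr (.out .product)) (R := U.card) (hm0.trans hm.symm)
      (by decide) (by decide) ?_ ?_).imp ?_)) ?_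
  · intro j hj τ F h
    simp [h, F.arr (.out .product) (by decide)]
  · intro j hj C hC
    exact hC.length_le hU0 fun i hi => hout i (by omega)
  · rintro τ1 F1 ⟨C, hC, -, hrank⟩ -
    have hCU : C.length ≤ U.card := hC.length_le hU0 hout
    refine Ter.seq ((Ter.mulTable (m := n) (N := n) (by decide) (by decide) (by decide)
      ((F1.reg _ (by decide)).trans (h1.trans hn.symm))
      ((F1.reg _ (by decide)).trans (h1.trans hn.symm))).imp ?_)
    rintro τ2 F2 ⟨h6, h7⟩ -
    refine Ter.seq ((Ter.straight (Q := fun τ => τ.reg (.scratch 6) = 0 ∧ τ.reg (.scratch 8) = 0 ∧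
      τ.reg (.scratch 9) = n * n + 1 ∧ τ.reg (.scratch 10) = n * n) (by rfl)
      (by simp [exec, h7])).imp ?_)
    rintro τ3 F3 ⟨k6, k8, k9, k10⟩ -
    have a3 : ∀ a, a ∈ [Arr.src .product, .inp .product, .dst .product, .out .product,
        .final .product] → τ3.arr a = σ.arr a := by
      intro a ha
      rw [F3.arr a (by revert a; decide), F2.arr a (by revert a; decide),
        F1.arr a (by revert a; decide)]
    have r3 : ∀ x, x ∈ [Reg.numStates .product, .numTrans .product, .start .product] →
        τ3.reg x = σ.reg x := by
      intro a ha
      rw [F3.reg a (by revert a; decide), F2.reg a (by revert a; decide),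
        F1.reg a (by revert a; decide)]
    obtain ⟨l, hl⟩ : ∃ l, l = τ3.list (.numTrans .product) (.src .product) (.inp .product)
      (.scratch 1) (.dst .product) := ⟨_, rfl⟩
    have hlen : l.length = m := by rw [hl, Mem.length_list, r3 _ (by decide), hm0, hm]
    have hrank3 : ∀ j < m, τ3.arr (.scratch 1) j = rank C (σ.arr (.out .product) j) := by
      intro j hj
      rw [F3.arr _ (by decide), F2.arr _ (by decide), hrank j hj, rank, if_pos (hC.mem hj)]
    have hlm : ∀ x, x ∈ l ↔ ∃ t ∈ T.trans, ((num t.1 : ℕ), labelCode t.2.1,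
        rank C (labelCode t.2.2.1), (num t.2.2.2 : ℕ)) = x := by
      intro x
      rw [hl, Mem.mem_list, r3 _ (by decide), hm0, ← hm]
      constructor
      · rintro ⟨i, hi, rfl⟩
        obtain ⟨t, ht, h⟩ := (hmem _).1 (Mem.row_mem_list (σ := σ) (n := .numTrans .product)
          (by rw [hm0, ← hm]; exact hi) _ _ _ _)
        refine ⟨t, ht, ?_⟩
        simp only [transRecord, Mem.row, Prod.mk.injEq] at h ⊢
        rw [hrank3 i hi, ← h.2.2.1, a3 _ (by decide), a3 _ (by decide), a3 _ (by decide)]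
        exact ⟨h.1, h.2.1, rfl, h.2.2.2⟩
      · rintro ⟨t, ht, rfl⟩
        obtain ⟨i, hi, h⟩ := Mem.mem_list.1 ((hmem _).2 ⟨t, ht, rfl⟩)
        rw [hm0, ← hm] at hi
        refine ⟨i, hi, ?_⟩
        simp only [transRecord, Mem.row, Prod.mk.injEq] at h ⊢
        rw [hrank3 i hi, h.2.2.1, a3 _ (by decide), a3 _ (by decide), a3 _ (by decide)]
        exact ⟨h.1, h.2.1, rfl, h.2.2.2⟩
    have hn3 : τ3.reg (.numStates .product) = n := by rw [r3 _ (by decide), h1, hn]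
    refine Ter.seq (((Ter.extList hn3 k6 hl.symm).le (by rw [hlen])).imp ?_)
    rintro τ4 F4 h4 -
    obtain ⟨E, hE⟩ : ∃ E, E = l ++ (List.range n).flatMap fun q => [(q, 0, 0, q)] := ⟨_, rfl⟩
    have hElen : E.length = m + n := by simp [hE, hlen, List.length_flatMap]
    rw [← hE] at h4
    have hf4 : τ4.arr (.final .product) = σ.arr (.final .product) := by
      rw [F4.arr _ (by decide), a3 _ (by decide)]
    refine Ter.seq (((Ter.pairGraph (P := n) (E := E) ((F4.reg _ (by decide)).trans hn3)
      ((F4.reg _ (by decide)).trans k8) ?_ ?_ h4 ?_).le (by rw [hElen])).imp ?_)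
    · rw [F4.reg _ (by decide), F3.reg _ (by decide), h7]
    · intro p hp
      rw [F4.arr _ (by decide), F3.arr _ (by decide), h6 p hp]
    · intro t ht
      rw [hE, List.mem_append, hlm] at ht
      obtain ⟨t, -, rfl⟩ | ht := ht
      · exact ⟨by rw [hn]; exact (num _).2, by rw [hn]; exact (num _).2⟩
      · simp only [List.mem_flatMap, List.mem_range, List.mem_singleton] at ht
        obtain ⟨q, hq, rfl⟩ := ht
        exact ⟨hq, hq⟩
    rintro τ5 F5 h5 -
    rw [hf4] at h5
    have h00 : rank C 0 = 0 := by rw [rank, if_pos hC.zero_mem, hC.idxOf_zero]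
    have hg := isPairGraph_pairList (num := num) (T := T) (F := σ.arr (.final .product)) hn.symm h00 hlm
      (fun p => by
        obtain ⟨b1, b2⟩ := h3 p
        by_cases hp : p ∈ T.final <;> simp_all)
    rw [← hE, ← h5] at hg
    have hlen5 : (τ5.list (.scratch 8) (.scratch 16) (.scratch 17) (.scratch 18)
        (.scratch 19)).length ≤ (m + n) * (m + n) + n * n := by
      rw [h5, List.length_append]
      exact Nat.add_le_add (hElen ▸ length_pairList _ _) (length_sinkList _ _)
    have hrankU : ∀ t ∈ T.trans, rank C (labelCode t.2.2.1) ≤ U.card := by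
      intro t ht
      obtain ⟨i, hi, h⟩ := Mem.mem_list.1 ((hmem _).2 ⟨t, ht, rfl⟩)
      rw [hm0, ← hm] at hi
      simp only [transRecord, Mem.row, Prod.mk.injEq] at h
      rw [← h.2.2.1, rank, if_pos (hC.mem hi)]
      exact (List.idxOf_lt_length_of_mem (hC.mem hi)).le.trans hCU
    have hext : ∀ t, T.Ext t → rank C (labelCode t.2.2.1) ≤ U.card := by
      rintro t (ht | ⟨-, ht, -⟩)
      · exact hrankU t ht
      · rw [ht, labelCode, h00]
        exact Nat.zero_le _
    refine (Ter.functional_search (R := U.card) hn.symm rfl hg (rank_injective C) h00 ?_ ?_ ?_ ?_ ?_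
      ?_).le ?_
    · intro r hr
      obtain ⟨t, t', ht, ht', -, rfl⟩ | ⟨p, -, p', -, rfl⟩ := (hg r).1 hr
      · exact ⟨hext t ht, hext t' ht'⟩
      · simp
    · rw [F5.reg _ (by decide), F4.reg _ (by decide), F3.reg _ (by decide), h7]
    · rw [F5.reg _ (by decide), F4.reg _ (by decide), k9]
    · rw [F5.reg _ (by decide), F4.reg _ (by decide), k10]
    · intro p hp
      rw [F5.arr _ (by decide), F4.arr _ (by decide), F3.arr _ (by decide), h6 p hp]
    · rw [F5.reg _ (by decide), F4.reg _ (by decide), r3 _ (by decide), h2]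
    · gcongr
  · obtain ⟨a, ha⟩ : ∃ a, a = m + n := ⟨_, rfl⟩
    obtain ⟨R, hR⟩ : ∃ R, R = U.card := ⟨_, rfl⟩
    have hna : n ≤ a := by omega
    have hma : m ≤ a := by omega
    rw [← ha, ← hR]
    rw [← hR] at hU1
    have ha1 : 1 ≤ a := by omega
    calc _ ≤ (a * (R * 32 + 44) + 20) + ((a * 18 + 10) + (12 + ((a * 40 + 16) +
        (((a * (a * 80 + 18) + 8) + (a * (a * 60 + 22) + 8)) +
        (((a * a + 1) + (a * a + a * a)) * (R * 52 + 360) + 250))))) := by gcongr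
      _ ≤ (a ^ 2 * R * 76 + 20 * (a ^ 2 * R)) + ((a ^ 2 * R * 18 + 10 * (a ^ 2 * R)) +
        (12 * (a ^ 2 * R) + ((a ^ 2 * R * 40 + 16 * (a ^ 2 * R)) +
        (((a ^ 2 * R * 98 + 8 * (a ^ 2 * R)) + (a ^ 2 * R * 82 + 8 * (a ^ 2 * R))) +
        (4 * 412 * (a ^ 2 * R) + 250 * (a ^ 2 * R)))))) := by
          have e1 : 1 ≤ a ^ 2 * R := Nat.mul_pos (by positivity) hU1
          have e0 : a ≤ a ^ 2 := by nlinarith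
          have e2 : a ≤ a ^ 2 * R := e0.trans (Nat.le_mul_of_pos_right _ hU1)
          have e3 : a * R ≤ a ^ 2 * R := Nat.mul_le_mul_right _ e0
          have e4 : a ^ 2 ≤ a ^ 2 * R := Nat.le_mul_of_pos_right _ hU1
          have e5 : R ≤ a ^ 2 * R := Nat.le_mul_of_pos_left _ (by positivity)
          ring_nf at e1 e2 e3 e4 e5 ⊢
          omega
      _ ≤ _ := by ring_nf; omega

end Prog

/-! ### Two members of a set -/

/-- The numbers `a`, `b` are two different members of `S`, or as many as there are; the others
are `0`. -/
structure TwoOf (S : Set ℕ) (a b : ℕ) : Prop where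
  mem_fst : a ≠ 0 → a ∈ S
  mem_snd : b ≠ 0 → b ∈ S ∧ a ≠ 0 ∧ b ≠ a
  empty : a = 0 → ∀ x, x ∉ S
  single : b = 0 → ∀ x ∈ S, x = a

/-- Insert `x` in a pair, if there is room. -/
def insPair (a b x : ℕ) : ℕ × ℕ :=
  if x = 0 then (a, b) else if a = 0 then (x, b) else if a = x then (a, b) else
    if b = 0 then (a, x) else (a, b)

theorem insPair_of_ne_zero {a b : ℕ} (ha : a ≠ 0) (hb : b ≠ 0) (x : ℕ) :
    insPair a b x = (a, b) := by
  rw [insPair, if_neg ha, if_neg hb]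
  split_ifs <;> rfl

namespace TwoOf

variable {S T : Set ℕ} {a b c d : ℕ}

theorem ins (h : TwoOf S a b) (x : ℕ) :
    TwoOf {y | y ∈ S ∨ y = x ∧ x ≠ 0} (insPair a b x).1 (insPair a b x).2 := by
  by_cases hx : x = 0
  · simpa [insPair, hx] using h
  by_cases ha : a = 0
  · have hb : b = 0 := by
      by_contra hb
      exact (h.mem_snd hb).2.1 ha
    have := h.empty ha
    simp only [insPair, hx, ha, hb, if_false, if_true]
    refine ⟨?_, ?_, ?_, ?_⟩ <;> simp_all
  by_cases hax : a = x
  · simp only [insPair, hax, hx, if_false, if_true]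
    subst hax
    refine ⟨fun _ => .inl (h.mem_fst ha), fun hb => ⟨.inl (h.mem_snd hb).1, (h.mem_snd hb).2⟩,
      fun h0 => absurd h0 ha, ?_⟩
    rintro hb y (hy | ⟨rfl, -⟩)
    exacts [h.single hb y hy, rfl]
  by_cases hb : b = 0
  · simp only [insPair, ha, hax, hx, hb, if_false, if_true]
    exact ⟨fun _ => .inl (h.mem_fst ha), fun _ => ⟨.inr ⟨rfl, hx⟩, ha, Ne.symm hax⟩,
      fun h0 => absurd h0 ha, fun h0 => absurd h0 hx⟩
  · simp only [insPair, ha, hax, hx, hb, if_false]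
    exact ⟨fun _ => .inl (h.mem_fst ha), fun _ => ⟨.inl (h.mem_snd hb).1, (h.mem_snd hb).2⟩,
      fun h0 => absurd h0 ha, fun h0 => absurd h0 hb⟩

theorem mono (h : TwoOf S a b) (hST : S ⊆ T) (h0 : (∀ x, x ∉ S) → ∀ x, x ∉ T)
    (h1 : ∀ z, (∀ x ∈ S, x = z) → ∀ x ∈ T, x = z) : TwoOf T a b :=
  ⟨fun ha => hST (h.mem_fst ha), fun hb => ⟨hST (h.mem_snd hb).1, (h.mem_snd hb).2⟩,
    fun ha => h0 (h.empty ha), fun hb => h1 a (h.single hb)⟩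

/-- Two members of a union are found from two members of the parts. -/
theorem union_image (h : TwoOf S a b) (k : TwoOf T c d) {f : ℕ → ℕ} (hf : Function.Injective f)
    (hf0 : ∀ x, f x ≠ 0) {c' d' a' b' : ℕ} (hc : c' = if c = 0 then 0 else f c)
    (hd : d' = if d = 0 then 0 else f d) (hi : (a', b') = insPair a b c') :
    TwoOf (S ∪ f '' T) (insPair a' b' d').1 (insPair a' b' d').2 := by
  have h1 := (h.ins c').ins d'
  rw [← hi] at h1
  refine h1.mono ?_ ?_ ?_
  · rintro y ((hy | ⟨rfl, hy⟩) | ⟨rfl, hy⟩)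
    · exact .inl hy
    · have h0 : c ≠ 0 := fun h0 => hy (by simp [hc, h0])
      exact .inr ⟨c, k.mem_fst h0, by simp [hc, h0]⟩
    · have h0 : d ≠ 0 := fun h0 => hy (by simp [hd, h0])
      exact .inr ⟨d, (k.mem_snd h0).1, by simp [hd, h0]⟩
  · rintro h0 y (hy | ⟨z, hz, rfl⟩)
    · exact h0 y (.inl (.inl hy))
    · by_cases hc0 : c = 0
      · exact k.empty hc0 z hz
      · refine h0 (f c) (.inl (.inr ?_))
        simp [hc, hc0, hf0]
  -- If nothing but `z` was available for insertion, `T` has at most one member: two members would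
  -- have two different images under `f`.
  · rintro z h0 y (hy | ⟨w, hw, rfl⟩)
    · exact h0 y (.inl (.inl hy))
    · by_cases hc0 : c = 0
      · exact absurd hw (k.empty hc0 w)
      have e1 : f c = z := h0 (f c) (.inl (.inr (by simp [hc, hc0, hf0])))
      by_cases hd0 : d = 0
      · rw [k.single hd0 w hw, e1]
      · have e2 : f d = z := h0 (f d) (.inr (by simp [hd, hd0, hf0]))
        exact absurd (hf (e2.trans e1.symm)) (k.mem_snd hd0).2.2

end TwoOf

/-- The numbers `u`, `v` are the first two different members of the sets `W 0`, …, `W (l - 1)`. -/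
structure FirstTwo (W : ℕ → Set ℕ) (l u v : ℕ) : Prop where
  zero : u = 0 → v = 0 ∧ ∀ i < l, ∀ x, x ∉ W i
  fst : u ≠ 0 → ∃ i < l, u ∈ W i ∧ ∀ k < l, ∀ x ∈ W k, i ≤ k
  single : v = 0 → ∀ k < l, ∀ x ∈ W k, x = u
  snd : v ≠ 0 → v ≠ u ∧ ∃ i < l, v ∈ W i ∧ ∀ k < l, ∀ x ∈ W k, x ≠ u → i ≤ k

namespace FirstTwo

variable {W : ℕ → Set ℕ} {l u v c d : ℕ}

theorem init : FirstTwo W 0 0 0 := by constructor <;> simp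

theorem succ_fst (h : FirstTwo W l u v) (hu : u ≠ 0) :
    ∃ i < l + 1, u ∈ W i ∧ ∀ k < l + 1, ∀ x ∈ W k, i ≤ k := by
  obtain ⟨i, hi, h1, h2⟩ := h.fst hu
  refine ⟨i, by omega, h1, fun k hk x hx => ?_⟩
  obtain hk | rfl := Nat.lt_succ_iff_lt_or_eq.1 hk
  exacts [h2 k hk x hx, hi.le]

/-- Two candidates from layer `l` suffice, since at most one of them can coincide with `u`. A number
found in an earlier layer is never replaced, which keeps the choice a shortest one. -/
theorem succ (h : FirstTwo W l u v) (k : TwoOf (W l) c d) {a b : ℕ}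
    (hi : (a, b) = insPair u v c) :
    FirstTwo W (l + 1) (insPair a b d).1 (insPair a b d).2 := by
  have lift : ∀ {p : ℕ → Prop}, (∀ i < l, p i) → p l → ∀ i < l + 1, p i := by
    intro p h1 h2 i hi
    obtain hi | rfl := Nat.lt_succ_iff_lt_or_eq.1 hi
    exacts [h1 i hi, h2]
  by_cases hu : u = 0
  · obtain ⟨hv, hW⟩ := h.zero hu
    by_cases hc : c = 0
    · have hd : d = 0 := by
        by_contra hd
        exact (k.mem_snd hd).2.1 hc
      simp only [insPair, hc, if_true, Prod.mk.injEq] at hi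
      obtain ⟨rfl, rfl⟩ := hi
      simp only [insPair, hd, if_true]
      have hW' : ∀ i < l + 1, ∀ x, x ∉ W i := lift hW (k.empty hc)
      exact ⟨fun _ => ⟨hv, hW'⟩, fun h0 => absurd hu h0, fun _ i hi x hx => absurd hx (hW' i hi x),
        fun h0 => absurd hv h0⟩
    · simp only [insPair, hc, hu, hv, if_true, if_false, Prod.mk.injEq] at hi
      obtain ⟨rfl, rfl⟩ := hi
      have h1 : ∀ i < l + 1, ∀ x ∈ W i, l ≤ i :=
        lift (fun i hi x hx => absurd hx (hW i hi x)) (fun _ _ => le_rfl)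
      by_cases hd : d = 0
      · simp only [insPair, hd, if_true]
        exact ⟨fun h0 => absurd h0 hc, fun _ => ⟨l, by omega, k.mem_fst hc, h1⟩,
          fun _ => lift (fun i hi x hx => absurd hx (hW i hi x)) (k.single hd), by simp⟩
      · obtain ⟨h2, -, h3⟩ := k.mem_snd hd
        simp only [insPair, hd, hc, Ne.symm h3, if_true, if_false]
        exact ⟨fun h0 => absurd h0 hc, fun _ => ⟨l, by omega, k.mem_fst hc, h1⟩,
          fun h0 => absurd h0 hd, fun _ => ⟨h3, l, by omega, h2, fun i hi x hx _ => h1 i hi x hx⟩⟩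
  have hfst := h.succ_fst hu
  by_cases hv : v = 0
  · have hsing := h.single hv
    have new : ∀ y, y ≠ u → y ∈ W l → y ≠ 0 → FirstTwo W (l + 1) u y := by
      intro y hyu hyW hy0
      refine ⟨fun h0 => absurd h0 hu, fun _ => hfst, fun h0 => absurd h0 hy0, fun _ =>
        ⟨hyu, l, by omega, hyW, ?_⟩⟩
      exact lift (fun i hi x hx hxu => absurd (hsing i hi x hx) hxu) (fun _ _ _ => le_rfl)
    have old : (∀ x ∈ W l, x = u) → FirstTwo W (l + 1) u v := fun hx =>
      ⟨fun h0 => absurd h0 hu, fun _ => hfst, fun _ => lift hsing hx, fun h0 => absurd hv h0⟩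
    by_cases hc : c = 0
    · have hd : d = 0 := by
        by_contra hd
        exact (k.mem_snd hd).2.1 hc
      simp only [insPair, hc, if_true, Prod.mk.injEq] at hi
      obtain ⟨rfl, rfl⟩ := hi
      simp only [insPair, hd, if_true]
      exact old fun x hx => absurd hx (k.empty hc x)
    · by_cases huc : u = c
      · simp only [insPair, hc, huc, if_true, if_false, Prod.mk.injEq] at hi
        obtain ⟨rfl, rfl⟩ := hi
        subst huc
        by_cases hd : d = 0
        · simp only [insPair, hd, if_true]
          exact old fun x hx => k.single hd x hx
        · obtain ⟨h2, -, h3⟩ := k.mem_snd hd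
          simp only [insPair, hd, hu, hv, Ne.symm h3, if_true, if_false]
          exact new d h3 h2 hd
      · simp only [insPair, hc, hu, huc, hv, if_true, if_false, Prod.mk.injEq] at hi
        obtain ⟨rfl, rfl⟩ := hi
        rw [insPair_of_ne_zero hu hc]
        exact new b (Ne.symm huc) (k.mem_fst hc) hc
  · rw [insPair_of_ne_zero hu hv] at hi
    simp only [Prod.mk.injEq] at hi
    obtain ⟨rfl, rfl⟩ := hi
    rw [insPair_of_ne_zero hu hv]
    obtain ⟨h1, i, h2, h3, h4⟩ := h.snd hv
    exact ⟨fun h0 => absurd h0 hu, fun _ => hfst, fun h0 => absurd h0 hv, fun _ =>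
      ⟨h1, i, by omega, h3, lift h4 (fun _ _ _ => by omega)⟩⟩

end FirstTwo

/-- The numbers of the words of length `l` that lead from the state `p` to a final state. -/
def layerSet (E : ℕ) (S D J F : ℕ → ℕ) : ℕ → ℕ → Set ℕ
  | 0, p => {x | x = 1 ∧ F p ≠ 0}
  | l + 1, p => {x | ∃ i < E, S i = p ∧ ∃ y ∈ layerSet E S D J F l (D i), 2 ^ J i * y + 1 = x}

/-! ### Computing the layers of coded words. -/

namespace Prog

/-- Insert a number in a pair kept in two arrays. -/
def insert (a b : Arr) (i : Exp) (x : Reg) : Prog :=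
  .ite (.reg x) (.ite (.arr a i) (.ite (.eq (.arr a i) (.reg x)) .skip
    (.ite (.arr b i) .skip (.write b i (.reg x)))) (.write a i (.reg x))) .skip

theorem exec_insert {a b : Arr} {i : Exp} {x : Reg} {σ : Mem} (hab : a ≠ b) {p q : ℕ}
    (hpq : (p, q) = insPair (σ.arr a (i.eval σ)) (σ.arr b (i.eval σ)) (σ.reg x)) :
    ((insert a b i x).exec σ).reg = σ.reg ∧
      (∀ j, ((insert a b i x).exec σ).arr a j = if j = i.eval σ then p else σ.arr a j) ∧
      (∀ j, ((insert a b i x).exec σ).arr b j = if j = i.eval σ then q else σ.arr b j) ∧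
      ∀ c, c ≠ a → c ≠ b → ((insert a b i x).exec σ).arr c = σ.arr c := by
  have key : ∀ τ : Mem, τ = σ → (p, q) = (σ.arr a (i.eval σ), σ.arr b (i.eval σ)) →
      τ.reg = σ.reg ∧ (∀ j, τ.arr a j = if j = i.eval σ then p else σ.arr a j) ∧
      (∀ j, τ.arr b j = if j = i.eval σ then q else σ.arr b j) ∧
      ∀ c, c ≠ a → c ≠ b → τ.arr c = σ.arr c := by
    rintro _ rfl h
    simp only [Prod.mk.injEq] at h
    refine ⟨rfl, fun j => ?_, fun j => ?_, fun _ _ _ => rfl⟩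
    · split_ifs with hj
      · rw [hj, h.1]
      · rfl
    · split_ifs with hj
      · rw [hj, h.2]
      · rfl
  by_cases hx : σ.reg x = 0
  · simp only [insPair, hx, if_true] at hpq
    exact key _ (by simp [insert, exec, hx]) hpq
  by_cases h1 : σ.arr a (i.eval σ) = 0
  · simp only [insPair, hx, h1, if_true, if_false, Prod.mk.injEq] at hpq
    obtain ⟨rfl, rfl⟩ := hpq
    simp only [insert, exec, Exp.eval, hx, h1, if_true, if_false]
    refine ⟨rfl, fun j => by simp, fun j => ?_, fun c hc _ => Mem.setArr_arr_ne _ hc _ _⟩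
    simp only [Mem.setArr_arr, Ne.symm hab, false_and, if_false]
    split_ifs with hj
    · rw [hj]
    · rfl
  by_cases h2 : σ.arr a (i.eval σ) = σ.reg x
  · simp only [insPair, hx, h2, if_true, if_false] at hpq
    exact key _ (by simp [insert, exec, hx, h2]) (by rw [h2]; exact hpq)
  by_cases h3 : σ.arr b (i.eval σ) = 0
  · simp only [insPair, hx, h1, h2, h3, if_true, if_false, Prod.mk.injEq] at hpq
    obtain ⟨rfl, rfl⟩ := hpq
    simp only [insert, exec, Exp.eval, Exp.eval_eq, hx, h1, h2, h3, if_true, if_false]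
    refine ⟨rfl, fun j => ?_, fun j => by simp, fun c _ hc => Mem.setArr_arr_ne _ hc _ _⟩
    simp only [Mem.setArr_arr, hab, false_and, if_false]
    split_ifs with hj
    · rw [hj]
    · rfl
  · simp only [insPair, hx, h1, h2, h3, if_false] at hpq
    exact key _ (by simp [insert, exec, hx, h1, h2, h3]) hpq

/-- Prefix the symbol numbered `j` to the word with the number `x`, if `x` is not `0`. -/
def prefixLetter (x j c : Reg) : Prog :=
  .ite (.reg x) (loop c j (.set x (.add (.reg x) (.reg x))) ;;
    .set x (.add (.reg x) (.const 1))) .skip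

theorem Ter.prefixLetter {x j c : Reg} {σ : Mem} {y k R : ℕ} (hne : [x, j, c].Nodup)
    (hx : σ.reg x = y) (hk : σ.reg j = k) (hR : k ≤ R) :
    (Prog.prefixLetter x j c).Ter σ (R * 14 + 20)
      (fun τ => τ.reg x = if y = 0 then 0 else 2 ^ k * y + 1) := by
  simp only [List.nodup_cons, List.mem_cons, List.not_mem_nil, or_false, not_or] at hne
  obtain ⟨⟨n1, n2⟩, n3, -⟩ := hne
  refine Ter.le (B := 1 + ((k * (4 + 10) + 8) + 4) + 1) (Ter.ite (fun he => ?_) fun he => ?_) ?_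
  · have hy : y ≠ 0 := by simpa [hx] using he
    rw [if_neg hy]
    refine Ter.seq ((Ter.loop (fun i τ => τ.reg x = 2 ^ i * y) 4 k hk ?_ ?_ n3 ?_ ?_).imp ?_)
    · simp [Ne.symm n2]
    · simp [Ne.symm n1]
    · simp [n2, hx]
    · intro i hi τ hF hτi hI
      refine Ter.straight (by rfl) ?_
      simp only [exec, Exp.eval, Mem.setReg_reg, n2, if_false, if_true, hI]
      ring
    · intro τ _ h _
      exact Ter.straight (by rfl) (by simp [exec, h])
  · have hy : y = 0 := by simpa [hx] using he
    exact (Ter.skip (by simp [hx, hy])).le (by omega)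
  · have := Nat.mul_le_mul_right 14 hR
    omega

/-- Compute the words of the next length from those in the arrays `30` and `31`. -/
def nextLayer : Prog :=
  loop (.scratch 3) (.numStates .input) (.write (.scratch 32) (.reg (.scratch 3)) (.const 0) ;;
    .write (.scratch 33) (.reg (.scratch 3)) (.const 0)) ;;
  loop (.scratch 3) (.numTrans .input) (
    .set (.scratch 8) (.arr (.scratch 1) (.reg (.scratch 3))) ;;
    .set (.scratch 7) (.arr (.scratch 30) (.arr (.dst .input) (.reg (.scratch 3)))) ;;
    prefixLetter (.scratch 7) (.scratch 8) (.scratch 5) ;;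
    insert (.scratch 32) (.scratch 33) (.arr (.src .input) (.reg (.scratch 3))) (.scratch 7) ;;
    .set (.scratch 7) (.arr (.scratch 31) (.arr (.dst .input) (.reg (.scratch 3)))) ;;
    prefixLetter (.scratch 7) (.scratch 8) (.scratch 5) ;;
    insert (.scratch 32) (.scratch 33) (.arr (.src .input) (.reg (.scratch 3))) (.scratch 7)) ;;
  loop (.scratch 3) (.numStates .input)
    (.write (.scratch 30) (.reg (.scratch 3)) (.arr (.scratch 32) (.reg (.scratch 3))) ;;
    .write (.scratch 31) (.reg (.scratch 3)) (.arr (.scratch 33) (.reg (.scratch 3))))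

/-- The new pairs are collected in arrays `32`, `33`, as the old ones are needed until all
transitions have been treated. Transition `i` contributes the image of `W (D i)` under the injective
map `y ↦ 2 ^ J i * y + 1`, so by `TwoOf.union_image` its two stored members are enough. -/
theorem Ter.nextLayer {σ : Mem} {E n R : ℕ} {S D J : ℕ → ℕ} {W : ℕ → Set ℕ}
    (hn : σ.reg (.numStates .input) = n) (hE : σ.reg (.numTrans .input) = E)
    (hS : σ.arr (.src .input) = S) (hD : σ.arr (.dst .input) = D) (hJ : σ.arr (.scratch 1) = J)
    (hDn : ∀ i < E, D i < n) (hJR : ∀ i < E, J i ≤ R)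
    (hW : ∀ q < n, TwoOf (W q) (σ.arr (.scratch 30) q) (σ.arr (.scratch 31) q)) :
    nextLayer.Ter σ (n * 38 + E * (R * 28 + 130) + 24) (fun τ => ∀ p < n,
      TwoOf {x | ∃ i < E, S i = p ∧ ∃ y ∈ W (D i), 2 ^ J i * y + 1 = x}
        (τ.arr (.scratch 30) p) (τ.arr (.scratch 31) p)) := by
  refine Ter.le (B := (n * (8 + 10) + 8) + ((E * ((R * 28 + 120) + 10) + 8) + (n * (10 + 10) + 8)))
    (Ter.seq ((Ter.loop (fun i τ => ∀ q < i, τ.arr (.scratch 32) q = 0 ∧ τ.arr (.scratch 33) q = 0)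
      8 n hn (by decide) (by decide) (by decide) (by simp) ?_).imp ?_)) (by ring_nf; omega)
  · intro i hi τ _ hτi hI
    refine Ter.straight (by rfl) fun q hq => ?_
    simp only [exec, Exp.eval, Mem.setReg_arr, Mem.setArr_arr, Mem.setArr_reg, hτi]
    by_cases h : q = i
    · simp [h]
    · simpa [h] using hI q (by omega)
  intro τ1 F1 h1 _
  refine Ter.seq ((Ter.loop (fun i τ => ∀ p < n,
    TwoOf {x | ∃ j < i, S j = p ∧ ∃ y ∈ W (D j), 2 ^ J j * y + 1 = x}
      (τ.arr (.scratch 32) p) (τ.arr (.scratch 33) p)) (R * 28 + 120) E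
    ((F1.reg _ (by decide)).trans hE) (by decide) (by decide) (by decide) ?_ ?_).imp ?_)
  · intro p hp
    obtain ⟨h2, h3⟩ := h1 p hp
    simp only [Mem.setReg_arr, h2, h3]
    constructor <;> simp
  · intro i hi τ F2 hτi hI
    have a0 : ∀ a, a ≠ .scratch 32 → a ≠ .scratch 33 → τ.arr a = σ.arr a := fun a k1 k2 => by
      rw [F2.arr a (by simp [Prog.insert, Prog.prefixLetter, k1, k2]), F1.arr a (by simp [k1, k2])]
    refine Ter.le (B := 3 + (4 + ((R * 14 + 20) + (30 + (4 + ((R * 14 + 20) + 30)))))) (Ter.seq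
      (Ter.set fun G1 => Ter.seq (Ter.set fun G2 => ?_))) (by omega)
    obtain ⟨υ, hυ⟩ : ∃ υ, υ = (τ.setReg (.scratch 8) (J i)).setReg (.scratch 7)
      (σ.arr (.scratch 30) (D i)) := ⟨_, rfl⟩
    have hυ' : (τ.setReg (.scratch 8) ((Exp.arr (.scratch 1) (.reg (.scratch 3))).eval τ)).setReg
        (.scratch 7) ((Exp.arr (.scratch 30) (.arr (.dst .input) (.reg (.scratch 3)))).eval
        (τ.setReg (.scratch 8) ((Exp.arr (.scratch 1) (.reg (.scratch 3))).eval τ))) = υ := by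
      simp only [hυ, Exp.eval, hτi, Mem.setReg_arr, Mem.setReg_reg, a0 (.scratch 1) (by decide)
        (by decide), a0 (.scratch 30) (by decide) (by decide), a0 (.dst .input) (by decide)
        (by decide), hJ, hD]
      simp
    rw [hυ']
    refine Ter.seq ((Ter.prefixLetter (y := σ.arr (.scratch 30) (D i)) (k := J i) (R := R)
      (by decide) (by simp [hυ]) (by simp [hυ]) (hJR i hi)).imp ?_)
    intro ω1 G3 hω1 _
    obtain ⟨p1, q1, hpq1⟩ : ∃ p1 q1, (p1, q1) = insPair (τ.arr (.scratch 32) (S i))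
      (τ.arr (.scratch 33) (S i)) (if σ.arr (.scratch 30) (D i) = 0 then 0 else
        2 ^ J i * σ.arr (.scratch 30) (D i) + 1) := ⟨_, _, rfl⟩
    have b1 : ω1.arr = τ.arr := by
      funext a
      rw [G3.arr a (by simp [Prog.prefixLetter]), hυ]
      rfl
    have c3 : ω1.reg (.scratch 3) = i := by
      rw [G3.reg _ (by decide), hυ]
      simpa using hτi
    have c8 : ω1.reg (.scratch 8) = J i := by
      rw [G3.reg _ (by decide), hυ]
      simp
    have hs1 : (Exp.arr (.src .input) (.reg (.scratch 3))).eval ω1 = S i := by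
      simp only [Exp.eval, c3, b1, a0 (.src .input) (by decide) (by decide), hS]
    obtain ⟨d1, d2, d3, d4⟩ := exec_insert (a := .scratch 32) (b := .scratch 33)
      (i := .arr (.src .input) (.reg (.scratch 3))) (x := .scratch 7) (σ := ω1) (by decide)
      (p := p1) (q := q1) (by rw [hs1, hω1, b1]; exact hpq1)
    refine Ter.seq (Ter.straight (by rfl) fun _ => ?_)
    obtain ⟨ω2, hω2⟩ : ∃ ω2, ω2 = exec (Prog.insert (.scratch 32) (.scratch 33)
      (.arr (.src .input) (.reg (.scratch 3))) (.scratch 7)) ω1 := ⟨_, rfl⟩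
    rw [← hω2] at d1 d2 d3 d4 ⊢
    rw [hs1] at d2 d3
    refine Ter.seq (Ter.set fun _ => ?_)
    refine Ter.seq ((Ter.prefixLetter (y := σ.arr (.scratch 31) (D i)) (k := J i) (R := R)
      (by decide) ?_ ?_ (hJR i hi)).imp ?_)
    · simp only [Mem.setReg_reg, if_true, Exp.eval, d1, c3, d4 (.dst .input) (by decide) (by decide),
        d4 (.scratch 31) (by decide) (by decide), b1, a0 (.dst .input) (by decide) (by decide),
        a0 (.scratch 31) (by decide) (by decide), hD]
    · simp [d1, c8]
    intro ω3 G5 hω3 _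
    have b3 : ω3.arr = ω2.arr := by
      funext a
      rw [G5.arr a (by simp [Prog.prefixLetter])]
      rfl
    have hs3 : (Exp.arr (.src .input) (.reg (.scratch 3))).eval ω3 = S i := by
      simp only [Exp.eval, b3, d4 (.src .input) (by decide) (by decide), b1]
      rw [a0 (.src .input) (by decide) (by decide), hS, G5.reg _ (by decide)]
      simp [d1, c3]
    obtain ⟨p2, q2, hpq2⟩ : ∃ p2 q2, (p2, q2) = insPair p1 q1
      (if σ.arr (.scratch 31) (D i) = 0 then 0 else
        2 ^ J i * σ.arr (.scratch 31) (D i) + 1) := ⟨_, _, rfl⟩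
    obtain ⟨e1, e2, e3, e4⟩ := exec_insert (a := .scratch 32) (b := .scratch 33)
      (i := .arr (.src .input) (.reg (.scratch 3))) (x := .scratch 7) (σ := ω3) (by decide)
      (p := p2) (q := q2) (by rw [hs3, hω3, b3, d2, d3, if_pos rfl, if_pos rfl]; exact hpq2)
    rw [hs3] at e2 e3
    refine Ter.straight (by rfl) fun p hp => ?_
    simp only [Mem.setReg_arr, e2, e3, b3, d2, d3, b1]
    have hinj : Function.Injective fun y => 2 ^ J i * y + 1 := fun y z h =>
      Nat.eq_of_mul_eq_mul_left (by positivity) (Nat.succ_injective h)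
    by_cases hpS : p = S i
    · rw [if_pos hpS, if_pos hpS]
      have h2 := (hI p hp).union_image (hW _ (hDn i hi)) hinj (by simp) rfl rfl
        (a' := p1) (b' := q1) (by rw [hpS]; exact hpq1)
      rw [← hpq2] at h2
      convert h2 using 1
      ext x
      simp only [Set.mem_ofPred_eq, Set.mem_union, Set.mem_image]
      constructor
      · rintro ⟨j, hj, h3, h4⟩
        obtain hj | rfl := Nat.lt_succ_iff_lt_or_eq.1 hj
        exacts [.inl ⟨j, hj, h3, h4⟩, .inr h4]
      · rintro (⟨j, hj, h3, h4⟩ | h4)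
        exacts [⟨j, by omega, h3, h4⟩, ⟨i, by omega, hpS.symm, h4⟩]
    · simp only [if_neg hpS]
      convert hI p hp using 1
      ext x
      simp only [Set.mem_ofPred_eq]
      constructor
      · rintro ⟨j, hj, h3, h4⟩
        obtain hj | rfl := Nat.lt_succ_iff_lt_or_eq.1 hj
        exacts [⟨j, hj, h3, h4⟩, absurd h3.symm hpS]
      · rintro ⟨j, hj, h3, h4⟩
        exact ⟨j, by omega, h3, h4⟩
  intro τ2 F2 h2 _
  refine (Ter.loop (fun i τ => ∀ q < i, τ.arr (.scratch 30) q = τ2.arr (.scratch 32) q ∧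
    τ.arr (.scratch 31) q = τ2.arr (.scratch 33) q) 10 n ?_ (by decide) (by decide) (by decide)
    (by simp) ?_).imp ?_
  · rw [F2.reg _ (by decide), F1.reg _ (by decide), hn]
  · intro i hi τ F hτi hI
    refine Ter.straight (by rfl) fun q hq => ?_
    simp only [exec, Exp.eval, Mem.setReg_arr, Mem.setArr_arr, Mem.setArr_reg, hτi]
    by_cases h : q = i
    · simp [h, F.arr (.scratch 32) (by decide), F.arr (.scratch 33) (by decide)]
    · simpa [h] using hI q (by omega)
  · intro τ3 _ h3 p hp
    obtain ⟨h4, h5⟩ := h3 p hp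
    rw [h4, h5]
    exact h2 p hp

end Prog

/-! ### The recursion for the edit distance -/

/-- The edit distance, by recursion. -/
def editRec {α : Type} [DecidableEq α] : List α → List α → ℕ
  | [], v => v.length
  | _ :: u, [] => u.length + 1
  | a :: u, b :: v => min (min (editRec u (b :: v) + 1) (editRec (a :: u) v + 1))
      (editRec u v + if a = b then 0 else 1)
  termination_by u v => u.length + v.length

section EditDist

variable {α : Type} [DecidableEq α]

@[simp] theorem editRec_nil_left (v : List α) : editRec [] v = v.length := by
  rw [editRec]

@[simp] theorem editRec_nil_right (u : List α) : editRec u [] = u.length := by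
  cases u <;> simp [editRec]

theorem editRec_cons_cons (a b : α) (u v : List α) : editRec (a :: u) (b :: v) =
    min (min (editRec u (b :: v) + 1) (editRec (a :: u) v + 1))
      (editRec u v + if a = b then 0 else 1) := by
  rw [editRec]

theorem editRec_cons_left (a : α) (u v : List α) : editRec (a :: u) v ≤ editRec u v + 1 := by
  cases v with
  | nil => simp
  | cons b v =>
    rw [editRec_cons_cons]
    exact (min_le_left _ _).trans (min_le_left _ _)

theorem editRec_cons_right (b : α) (u v : List α) : editRec u (b :: v) ≤ editRec u v + 1 := by
  cases u with
  | nil => simp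
  | cons a u =>
    rw [editRec_cons_cons]
    exact (min_le_left _ _).trans (min_le_right _ _)

theorem editRec_le_editWeight (h : List (EditOp α)) :
    editRec (editInp h) (editOut h) ≤ editWeight h := by
  induction h with
  | nil => simp [editInp, editOut]
  | cons e h ih =>
    obtain ⟨⟨x, y⟩, hxy⟩ := e
    have hw : editWeight (⟨(x, y), hxy⟩ :: h) = editWeight h + if x = y then 0 else 1 := by
      simp only [editWeight, List.countP_cons]
      by_cases h : x = y <;> simp [h]
    rw [hw]
    rcases x with _ | a <;> rcases y with _ | b
    · exact absurd rfl hxy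
    · have := editRec_cons_right b (editInp h) (editOut h)
      simp only [editInp, editOut, List.filterMap_cons] at ih this ⊢
      simp only [reduceCtorEq, if_false]
      omega
    · have := editRec_cons_left a (editInp h) (editOut h)
      simp only [editInp, editOut, List.filterMap_cons] at ih this ⊢
      simp only [reduceCtorEq, if_false]
      omega
    · have : editRec (a :: editInp h) (b :: editOut h) ≤ editRec (editInp h) (editOut h) +
          if a = b then 0 else 1 := by
        rw [editRec_cons_cons]
        exact min_le_right _ _
      simp only [editInp, editOut, List.filterMap_cons, Option.some.injEq] at ih this ⊢
      omega

theorem exists_editWeight_eq (u v : List α) :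
    ∃ h : List (EditOp α), editInp h = u ∧ editOut h = v ∧ editWeight h = editRec u v := by
  have cons : ∀ (x y : Option α) (hxy : (x, y) ≠ (none, none)) (u v : List α) (w : ℕ),
      (∃ h : List (EditOp α), editInp h = u ∧ editOut h = v ∧ editWeight h = w) →
      ∃ h : List (EditOp α), editInp h = x.toList ++ u ∧ editOut h = y.toList ++ v ∧
        editWeight h = w + if x = y then 0 else 1 := by
    rintro x y hxy u v w ⟨h, rfl, rfl, rfl⟩
    refine ⟨⟨(x, y), hxy⟩ :: h, ?_, ?_, ?_⟩
    · cases x <;> simp [editInp]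
    · cases y <;> simp [editOut]
    · simp only [editWeight, List.countP_cons]
      by_cases h : x = y <;> simp [h]
  induction u, v using editRec.induct with
  | case1 v =>
    induction v with
    | nil => exact ⟨[], rfl, rfl, by simp [editWeight]⟩
    | cons b v ih => simpa using cons none (some b) (by simp) _ _ _ ih
  | case2 a u =>
    have : ∀ u : List α, ∃ h : List (EditOp α), editInp h = u ∧ editOut h = [] ∧
        editWeight h = u.length := by
      intro u
      induction u with
      | nil => exact ⟨[], rfl, rfl, by simp [editWeight]⟩
      | cons a u ih => simpa using cons (some a) none (by simp) _ _ _ ih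
    simpa using this (a :: u)
  | case3 a u b v ih1 ih2 ih3 =>
    rw [editRec_cons_cons]
    rcases min_choice (min (editRec u (b :: v) + 1) (editRec (a :: u) v + 1))
      (editRec u v + if a = b then 0 else 1) with h | h <;> rw [h]
    · rcases min_choice (editRec u (b :: v) + 1) (editRec (a :: u) v + 1) with h | h <;> rw [h]
      · simpa using cons (some a) none (by simp) _ _ _ ih1
      · simpa using cons none (some b) (by simp) _ _ _ ih2
    · simpa using cons (some a) (some b) (by simp) _ _ _ ih3

/-- Each case of the recursion is realized by one edit operation, and conversely prefixing an
operation to an edit string raises the recursive value by at most the weight of the operation. -/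
theorem editDist_eq_editRec (u v : List α) : editDist u v = editRec u v := by
  refine le_antisymm (Nat.sInf_le (exists_editWeight_eq u v)) ?_
  refine le_csInf ⟨_, exists_editWeight_eq u v⟩ ?_
  rintro _ ⟨h, rfl, rfl, rfl⟩
  exact editRec_le_editWeight h

theorem exists_editWeight_eq_editDist (u v : List α) :
    ∃ h : List (EditOp α), editInp h = u ∧ editOut h = v ∧ editWeight h = editDist u v := by
  rw [editDist_eq_editRec]
  exact exists_editWeight_eq u v

theorem editDist_le_editWeight (h : List (EditOp α)) :
    editDist (editInp h) (editOut h) ≤ editWeight h := by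
  rw [editDist_eq_editRec]
  exact editRec_le_editWeight h

/-- Reversing an edit string keeps its weight. This is needed because the table is indexed by
prefixes, whereas `editRec` takes letters off the front. -/
theorem editDist_reverse_le (u v : List α) : editDist u.reverse v.reverse ≤ editDist u v := by
  obtain ⟨h, rfl, rfl, hw⟩ := exists_editWeight_eq_editDist u v
  have := editDist_le_editWeight h.reverse
  simp only [editInp, editOut, editWeight, List.filterMap_reverse, List.countP_reverse] at this hw ⊢
  exact this.trans hw.le

theorem editDist_reverse (u v : List α) : editDist u.reverse v.reverse = editDist u v :=
  (editDist_reverse_le u v).antisymm (by simpa using editDist_reverse_le u.reverse v.reverse)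

theorem editRec_map {β : Type} [DecidableEq β] {f : α → β} (hf : Function.Injective f)
    (u v : List α) : editRec (u.map f) (v.map f) = editRec u v := by
  induction u, v using editRec.induct with
  | case1 v => simp
  | case2 a u => simp
  | case3 a u b v ih1 ih2 ih3 =>
    simp only [List.map_cons] at ih1 ih2 ih3 ⊢
    rw [editRec_cons_cons, editRec_cons_cons, ih1, ih2, ih3]
    simp [hf.eq_iff]

theorem editDist_map {β : Type} [DecidableEq β] {f : α → β} (hf : Function.Injective f)
    (u v : List α) : editDist (u.map f) (v.map f) = editDist u v := by
  rw [editDist_eq_editRec, editDist_eq_editRec, editRec_map hf]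

end EditDist

/-! ### Decoding words and tabulating the edit distance. -/

namespace Prog

/-- Write the word with the number `scratch 7` into the array `a`. -/
def decode (a : Arr) (len : Reg) : Prog :=
  .set len (.const 0) ;;
  .while (.le (.const 2) (.reg (.scratch 7))) (
    .set (.scratch 7) (.sub (.reg (.scratch 7)) (.const 1)) ;; .set (.scratch 8) (.const 0) ;;
    .while (.eq (.add (.half (.reg (.scratch 7))) (.half (.reg (.scratch 7)))) (.reg (.scratch 7)))
      (.set (.scratch 7) (.half (.reg (.scratch 7))) ;;
        .set (.scratch 8) (.add (.reg (.scratch 8)) (.const 1))) ;;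
    .write a (.reg len) (.reg (.scratch 8)) ;; .set len (.add (.reg len) (.const 1)))

/-- The test compares a number with twice its half, that is, it asks whether the number is even; as
`y` is odd, the loop stops after exactly `i` halvings. -/
theorem Ter.halve {σ : Mem} {i y : ℕ} (hy : Odd y) (h7 : σ.reg (.scratch 7) = 2 ^ i * y)
    (h8 : σ.reg (.scratch 8) = 0) :
    (Prog.while (.eq (.add (.half (.reg (.scratch 7))) (.half (.reg (.scratch 7))))
      (.reg (.scratch 7))) (.set (.scratch 7) (.half (.reg (.scratch 7))) ;;
        .set (.scratch 8) (.add (.reg (.scratch 8)) (.const 1)))).Ter σ (i * 25 + 17 + 1)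
      (fun τ => τ.reg (.scratch 7) = y ∧ τ.reg (.scratch 8) = i) := by
  refine (Ter.while_rule (I := fun T τ => ∃ k, T = k * 25 ∧ τ.reg (.scratch 7) = 2 ^ k * y ∧
    τ.reg (.scratch 8) + k = i) ?_ ⟨i, rfl, h7, by omega⟩).imp ?_
  · rintro _ τ ⟨k, rfl, k1, k2⟩ he
    refine ⟨7, ?_⟩
    rcases k with _ | k
    · exfalso
      simp only [Exp.eval_eq, Exp.eval, k1, pow_zero, one_mul] at he
      obtain ⟨z, rfl⟩ := hy
      refine he (if_neg ?_)
      omega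
    · refine Ter.straight (by rfl) ⟨_, ?_, k, rfl, ?_, ?_⟩
      · simp only [Exp.eq, Exp.cost]; omega
      · simp only [exec, Exp.eval, Mem.setReg_reg, k1, pow_succ]
        simp only [Reg.scratch.injEq, Nat.reduceEqDiff, if_false, if_true]
        rw [show 2 ^ k * 2 * y = 2 ^ k * y * 2 by ring]
        exact Nat.mul_div_cancel _ (by norm_num)
      · simp [exec]
        omega
  · rintro τ - ⟨T, ⟨k, -, k1, k2⟩, he⟩
    rcases k with _ | k
    · exact ⟨by simpa using k1, by omega⟩
    · exfalso
      simp only [Exp.eval_eq, Exp.eval, k1, pow_succ, ite_eq_right_iff, one_ne_zero, imp_false] at he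
      rw [show 2 ^ k * 2 * y = 2 ^ k * y * 2 by ring] at he
      exact he (by rw [Nat.mul_div_cancel _ (by norm_num)]; ring)

/-- Inverts `wordVal`: after subtracting 1, the exponent of 2 is the next letter and the odd part is
the code of the remaining word. The code `1` of the empty word ends the loop. -/
theorem Ter.decode {a : Arr} {len : Reg} {σ : Mem} {w : List ℕ} {R : ℕ}
    (hl : len ≠ .scratch 7 ∧ len ≠ .scratch 8) (hw : ∀ j ∈ w, 0 < j ∧ j ≤ R)
    (h7 : σ.reg (.scratch 7) = wordVal w) :
    (Prog.decode a len).Ter σ (w.length * (R * 25 + 50) + 10)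
      (fun τ => (List.range (τ.reg len)).map (τ.arr a) = w) := by
  obtain ⟨hl7, hl8⟩ := hl
  refine Ter.le (B := 2 + (w.length * (R * 25 + 50) + 3 + 1)) (Ter.seq ((Ter.set (Q := fun τ =>
    τ.reg len = 0 ∧ τ.reg (.scratch 7) = wordVal w) (by simp [h7, Ne.symm hl7])).imp ?_)) (by omega)
  rintro τ0 - ⟨h0, h7⟩ -
  refine (Ter.while_rule (I := fun T τ => ∃ w1 w2, w1 ++ w2 = w ∧ T = w2.length * (R * 25 + 50) ∧
    τ.reg (.scratch 7) = wordVal w2 ∧ (List.range (τ.reg len)).map (τ.arr a) = w1) ?_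
    ⟨[], w, rfl, rfl, h7, by simp [h0]⟩).imp ?_
  · rintro _ τ ⟨w1, w2, hw12, rfl, k1, k2⟩ he
    rcases w2 with _ | ⟨j, w2⟩
    · simp [k1, wordVal] at he
    have hj := hw j (by rw [← hw12]; simp)
    have hodd : Odd (wordVal w2) := odd_wordVal fun i hi => (hw i (by rw [← hw12]; simp [hi])).1
    have hlen : τ.reg len = w1.length := by simpa using congrArg List.length k2
    refine ⟨4 + (2 + ((j * 25 + 17 + 1) + 7)), ?_⟩
    refine Ter.seq (Ter.set fun _ => Ter.seq (Ter.set fun _ => Ter.seq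
      ((Ter.halve hodd (i := j) ?_ ?_).imp ?_)))
    · simp [k1, wordVal]
    · simp
    rintro υ F ⟨k3, k4⟩ -
    have l1 : υ.reg len = τ.reg len := by
      rw [F.reg _ (by simp [hl7, hl8])]
      simp [hl7, hl8]
    have l2 : υ.arr a = τ.arr a := by
      rw [F.arr _ rfl]
      rfl
    refine Ter.straight (by rfl) ⟨w2.length * (R * 25 + 50), ?_, w1 ++ [j], w2, by simp [← hw12],
      rfl, ?_, ?_⟩
    · have := Nat.mul_le_mul_right 25 hj.2
      simp only [Exp.cost, List.length_cons, Nat.add_mul]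
      omega
    · simp [exec, Ne.symm hl7, k3]
    · simp only [exec, Exp.eval, Mem.setReg_reg, Mem.setArr_reg, if_true, l1, List.range_succ,
        List.map_append, List.map_cons, List.map_nil, Mem.setReg_arr, Mem.setArr_arr, true_and, k4]
      congr 1
      rw [← k2]
      refine List.map_inj_left.2 fun i hi => ?_
      rw [Mem.setArr_arr, if_neg fun h => (List.mem_range.1 hi).ne h.2, l2]
  · rintro τ - ⟨T, ⟨w1, w2, hw12, -, k1, k2⟩, he⟩
    rcases w2 with _ | ⟨j, w2⟩
    · rw [k2, ← hw12, List.append_nil]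
    · exfalso
      have : 1 ≤ 2 ^ j * wordVal w2 := Nat.mul_pos (by positivity) (wordVal_pos w2)
      simp only [Exp.eval, k1, wordVal, ite_eq_right_iff, one_ne_zero, imp_false] at he
      omega

/-- Compute the edit distance of the words in the arrays `36` and `37`. -/
def editTable : Prog :=
  loop (.scratch 3) (.scratch 11) (.write (.scratch 38) (.reg (.scratch 3)) (.reg (.scratch 3))) ;;
  .write (.scratch 38) (.reg (.scratch 11)) (.reg (.scratch 11)) ;;
  loop (.scratch 3) (.scratch 10) (
    (.set (.scratch 7) (.arr (.scratch 38) (.const 0)) ;;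
    .write (.scratch 38) (.const 0) (.add (.reg (.scratch 3)) (.const 1))) ;;
    loop (.scratch 4) (.scratch 11) (
      .set (.scratch 8) (.arr (.scratch 38) (.add (.reg (.scratch 4)) (.const 1))) ;;
      .write (.scratch 38) (.add (.reg (.scratch 4)) (.const 1))
        (.min (.min (.add (.reg (.scratch 8)) (.const 1))
            (.add (.arr (.scratch 38) (.reg (.scratch 4))) (.const 1)))
          (.add (.reg (.scratch 7)) (.sub (.const 1)
            (.eq (.arr (.scratch 36) (.reg (.scratch 3))) (.arr (.scratch 37) (.reg (.scratch 4))))))) ;;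
      .set (.scratch 7) (.reg (.scratch 8)))) ;;
  .set .bound (.arr (.scratch 38) (.reg (.scratch 11)))

/-- The entries of the table that `editTable` computes. -/
def tableEntry (u v : List ℕ) (i j : ℕ) : ℕ := editRec (u.take i).reverse (v.take j).reverse

theorem tableEntry_succ_succ {u v : List ℕ} {i j : ℕ} (hi : i < u.length) (hj : j < v.length) :
    tableEntry u v (i + 1) (j + 1) = min (min (tableEntry u v i (j + 1) + 1)
      (tableEntry u v (i + 1) j + 1)) (tableEntry u v i j + (1 - if u[i] = v[j] then 1 else 0)) := by
  simp only [tableEntry, List.take_succ_eq_append_getElem hi, List.take_succ_eq_append_getElem hj,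
    List.reverse_append, List.reverse_cons, List.reverse_nil, List.nil_append, List.singleton_append,
    editRec_cons_cons]
  split_ifs <;> rfl

theorem tableEntry_zero_left {u v : List ℕ} {j : ℕ} (hj : j ≤ v.length) :
    tableEntry u v 0 j = j := by simp [tableEntry, hj]

theorem tableEntry_zero_right {u v : List ℕ} {i : ℕ} (hi : i ≤ u.length) :
    tableEntry u v i 0 = i := by simp [tableEntry, hi]

/-- Only one row of the table is stored. Register `7` saves the diagonal entry and register `8` the
entry above, both of which would otherwise be overwritten. -/
theorem Ter.editTable {σ : Mem} {u v : List ℕ}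
    (hu : (List.range (σ.reg (.scratch 10))).map (σ.arr (.scratch 36)) = u)
    (hv : (List.range (σ.reg (.scratch 11))).map (σ.arr (.scratch 37)) = v) :
    Prog.editTable.Ter σ (v.length * 13 + u.length * (v.length * 80 + 40) + 40)
      (fun τ => τ.reg .bound = editDist u v) := by
  have hul : σ.reg (.scratch 10) = u.length := by simpa using congrArg List.length hu
  have hvl : σ.reg (.scratch 11) = v.length := by simpa using congrArg List.length hv
  have hu' : ∀ i (hi : i < u.length), σ.arr (.scratch 36) i = u[i] := by
    intro i hi
    simp [← hu]
  have hv' : ∀ i (hi : i < v.length), σ.arr (.scratch 37) i = v[i] := by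
    intro i hi
    simp [← hv]
  have hdist : tableEntry u v u.length v.length = editDist u v := by
    rw [tableEntry, ← editDist_eq_editRec, List.take_length, List.take_length, editDist_reverse]
  refine Ter.le (B := (v.length * (3 + 10) + 8) + (3 + ((u.length * ((9 + (v.length * (70 + 10) + 8))
    + 10) + 8) + 3))) (Ter.seq ((Ter.loop (fun i τ => ∀ j < i, τ.arr (.scratch 38) j = j) 3 v.length
    hvl (by decide) (by decide) (by decide) (by simp) ?_).imp ?_)) (by ring_nf; omega)
  · intro i hi τ _ hτi hI
    refine Ter.straight (by rfl) fun j hj => ?_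
    simp only [exec, Exp.eval, Mem.setReg_arr, Mem.setArr_arr, hτi]
    by_cases h : j = i
    · simp [h]
    · simpa [h] using hI j (by omega)
  intro τ1 F1 h1 _
  refine Ter.seq ((Ter.write (Q := fun τ => ∀ j ≤ v.length,
    τ.arr (.scratch 38) j = tableEntry u v 0 j) ?_).imp ?_)
  · intro j hj
    rw [tableEntry_zero_left hj]
    simp only [Exp.eval, F1.reg (.scratch 11) (by decide), hvl, Mem.setArr_arr, true_and]
    by_cases h : j = v.length
    · simp [h]
    · simpa [h] using h1 j (by omega)
  intro τ2 F2 h2 _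
  refine Ter.seq ((Ter.loop (fun i τ => ∀ j ≤ v.length,
    τ.arr (.scratch 38) j = tableEntry u v i j) _ u.length ?_ (by decide) (by decide) (by decide)
    h2 ?_).imp ?_)
  · rw [F2.reg _ (by decide), F1.reg _ (by decide), hul]
  · intro i hi τ F3 hτi hI
    refine Ter.seq ((Ter.straight (Q := fun υ => υ.reg (.scratch 7) = tableEntry u v i 0 ∧
      ∀ j ≤ v.length, υ.arr (.scratch 38) j = if j = 0 then tableEntry u v (i + 1) 0 else
        tableEntry u v i j) (by rfl) ?_).imp ?_)
    · refine ⟨by simp [exec, hI 0 (by omega)], fun j hj => ?_⟩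
      rw [tableEntry_zero_right (by omega)]
      simp only [exec, Exp.eval, Mem.setReg_reg, Mem.setReg_arr, Mem.setArr_arr, true_and]
      by_cases h : j = 0
      · simp [h, hτi]
      · simpa [h] using hI j hj
    rintro υ F4 ⟨h4, h5⟩ -
    -- Up to position `b` the array already holds row `i + 1`, beyond it still row `i`; register `7`
    -- holds the old entry at `b`.
    refine (Ter.loop (fun b ω => ω.reg (.scratch 7) = tableEntry u v i b ∧
      ∀ j ≤ v.length, ω.arr (.scratch 38) j = if j ≤ b then tableEntry u v (i + 1) j else
        tableEntry u v i j) 70 v.length ?_ (by decide) (by decide) (by decide) ?_ ?_).imp ?_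
    · rw [F4.reg _ (by decide), F3.reg _ (by decide), F2.reg _ (by decide), F1.reg _ (by decide), hvl]
    · refine ⟨by simpa using h4, fun j hj => ?_⟩
      have := h5 j hj
      by_cases h : j = 0
      · subst h
        simpa using this
      · simpa [h] using this
    · rintro b hb ω F5 hωb ⟨h6, h7⟩
      have r3 : ω.reg (.scratch 3) = i := by rw [F5.reg _ (by decide), F4.reg _ (by decide), hτi]
      have a36 : ω.arr (.scratch 36) i = u[i] := by
        rw [F5.arr _ (by decide), F4.arr _ (by decide), F3.arr _ (by decide), F2.arr _ (by decide),
          F1.arr _ (by decide), hu' i hi]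
      have a37 : ω.arr (.scratch 37) b = v[b] := by
        rw [F5.arr _ (by decide), F4.arr _ (by decide), F3.arr _ (by decide), F2.arr _ (by decide),
          F1.arr _ (by decide), hv' b hb]
      have e1 := h7 (b + 1) hb
      rw [if_neg (by omega)] at e1
      have e2 := h7 b hb.le
      rw [if_pos le_rfl] at e2
      refine Ter.straight (by rfl) ⟨?_, fun j hj => ?_⟩
      · simp [exec, hωb, e1]
      · by_cases h : j = b + 1
        · subst h
          rw [if_pos le_rfl, tableEntry_succ_succ hi hb]
          simp [exec, hωb, e1, e2, h6, r3, a36, a37]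
        · have : j ≤ b + 1 ↔ j ≤ b := by omega
          simpa [exec, hωb, h, this] using h7 j hj
    · rintro ω _ ⟨-, h7⟩ j hj
      have := h7 j hj
      rwa [if_pos hj] at this
  · intro τ3 F3 h3 _
    refine Ter.set ?_
    have r11 : τ3.reg (.scratch 11) = v.length := by
      rw [F3.reg _ (by decide), F2.reg _ (by decide), F1.reg _ (by decide), hvl]
    simp [r11, h3 _ le_rfl, hdist]

end Prog

/-! ### Short words of an automaton -/

namespace Automaton

variable {Q : Type} (A : Automaton Q)

/-- `A` can go from `p` to `q` reading the word `w`. -/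
def Reads (p : Q) (w : List ℕ) (q : Q) : Prop := q ∈ A.toNFA.evalFrom {p} w

variable {A}

theorem reads_nil {p q : Q} : A.Reads p [] q ↔ p = q := by
  simp [Reads, eq_comm]

theorem reads_cons {p q : Q} {a : ℕ} {w : List ℕ} :
    A.Reads p (a :: w) q ↔ ∃ s, (p, a, s) ∈ A.trans ∧ A.Reads s w q := by
  rw [Reads, NFA.evalFrom_cons, NFA.stepSet_singleton, NFA.mem_evalFrom_iff_exists]
  rfl

theorem reads_append {p q : Q} {v w : List ℕ} :
    A.Reads p (v ++ w) q ↔ ∃ s, A.Reads p v s ∧ A.Reads s w q := by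
  rw [Reads, NFA.evalFrom_append, NFA.mem_evalFrom_iff_exists]
  rfl

theorem mem_language {w : List ℕ} : w ∈ A.language ↔ ∃ q ∈ A.final, A.Reads A.start w q :=
  Iff.rfl

/-- Among the prefixes of length `0, …, n`, with `n` the number of states, two lead to the same
state of an accepting run. Cutting out the part between them removes at least one and at most `n`
letters. -/
theorem exists_shorter [Fintype Q] {w : List ℕ} (hw : w ∈ A.language)
    (hlen : Fintype.card Q ≤ w.length) :
    ∃ v ∈ A.language, v.length < w.length ∧ w.length ≤ v.length + Fintype.card Q := by
  obtain ⟨q, hq, hr⟩ := mem_language.1 hw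
  have hsplit : ∀ i, ∃ s, A.Reads A.start (w.take i) s ∧ A.Reads s (w.drop i) q := fun i =>
    reads_append.1 (by rwa [List.take_append_drop])
  choose st h1 h2 using hsplit
  obtain ⟨i, j, hij, h⟩ := Fintype.exists_ne_map_eq_of_card_lt
    (fun i : Fin (Fintype.card Q + 1) => st i) (by simp)
  wlog hlt : i < j generalizing i j
  · exact this j i hij.symm h.symm (by omega)
  refine ⟨w.take i ++ w.drop j, mem_language.2 ⟨q, hq, reads_append.2 ⟨st i, h1 i, ?_⟩⟩, ?_, ?_⟩
  · have : st i = st j := h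
    rw [this]
    exact h2 j
  · simp only [List.length_append, List.length_take, List.length_drop]
    omega
  · simp only [List.length_append, List.length_take, List.length_drop]
    omega

/-- There are two words that are shorter than twice the number of states. -/
theorem exists_two_short [Fintype Q] (h : ∃ u ∈ A.language, ∃ v ∈ A.language, u ≠ v) :
    ∃ u ∈ A.language, ∃ v ∈ A.language, u ≠ v ∧ u.length < 2 * Fintype.card Q ∧
      v.length < 2 * Fintype.card Q := by
  have hmin : ∀ p : List ℕ → Prop, (∃ w, p w) → ∃ w, p w ∧ ∀ w', p w' → w.length ≤ w'.length := by
    rintro p ⟨w, hw⟩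
    have := WellFounded.has_min (measure (List.length (α := ℕ))).wf {w | p w} ⟨w, hw⟩
    obtain ⟨w, hw, hmin⟩ := this
    exact ⟨w, hw, fun w' hw' => not_lt.1 (hmin w' hw')⟩
  obtain ⟨w, hw, w', hw', hne⟩ := h
  obtain ⟨u, hu, humin⟩ := hmin (· ∈ A.language) ⟨w, hw⟩
  obtain ⟨v, ⟨hv, hvu⟩, hvmin⟩ := hmin (fun v => v ∈ A.language ∧ v ≠ u) (by
    by_cases h : w = u
    · exact ⟨w', hw', fun h' => hne (h.trans h'.symm)⟩
    · exact ⟨w, hw, h⟩)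
  have hu' : u.length < Fintype.card Q := by
    by_contra hlen
    obtain ⟨x, hx, hlt, -⟩ := exists_shorter hu (not_lt.1 hlen)
    exact absurd (humin x hx) (by omega)
  refine ⟨u, hu, v, hv, hvu.symm, by omega, ?_⟩
  by_contra hlen
  -- At most as many letters as there are states are removed from `v`, so `x` is still longer than
  -- `u`. Hence `x ≠ u`, against the minimality of `v`.
  obtain ⟨x, hx, hlt, hge⟩ := exists_shorter hv (by omega)
  have := hvmin x ⟨hx, by rintro rfl; omega⟩
  omega

/-- The numbers of the words that lead from `p` to a final state are those of the paths in the
numbered graph. -/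
theorem mem_layerSet_iff {n E : ℕ} {num : Q ≃ Fin n} {S I D J F f : ℕ → ℕ}
    (h1 : ∀ t ∈ A.trans, ∃ i < E, S i = num t.1 ∧ I i = t.2.1 ∧ D i = num t.2.2)
    (h2 : ∀ i < E, ∃ t ∈ A.trans, S i = num t.1 ∧ I i = t.2.1 ∧ D i = num t.2.2)
    (hJ : ∀ i < E, J i = f (I i)) (hF : ∀ q, F (num q) ≠ 0 ↔ q ∈ A.final) (l : ℕ) (p : Q) (x : ℕ) :
    x ∈ layerSet E S D J F l (num p) ↔ ∃ w : List ℕ, w.length = l ∧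
      (∃ q ∈ A.final, A.Reads p w q) ∧ wordVal (w.map f) = x := by
  induction l generalizing p x with
  | zero =>
    simp only [layerSet, Set.mem_ofPred_eq, hF, List.length_eq_zero_iff]
    constructor
    · rintro ⟨rfl, hp⟩
      exact ⟨[], rfl, ⟨p, hp, reads_nil.2 rfl⟩, rfl⟩
    · rintro ⟨_, rfl, ⟨q, hq, hr⟩, rfl⟩
      rw [reads_nil.1 hr]
      exact ⟨rfl, hq⟩
  | succ l ih =>
    simp only [layerSet, Set.mem_ofPred_eq]
    constructor
    · rintro ⟨i, hi, hS, y, hy, rfl⟩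
      obtain ⟨⟨p', a, s⟩, ht, e1, e2, e3⟩ := h2 i hi
      rw [e3, ih] at hy
      obtain ⟨w, rfl, ⟨q, hq, hr⟩, rfl⟩ := hy
      obtain rfl : p' = p := num.injective (Fin.ext (e1.symm.trans hS))
      refine ⟨a :: w, rfl, ⟨q, hq, reads_cons.2 ⟨s, ht, hr⟩⟩, ?_⟩
      rw [hJ i hi, e2]
      rfl
    · rintro ⟨_ | ⟨a, w⟩, hw, ⟨q, hq, hr⟩, rfl⟩
      · simp at hw
      obtain ⟨s, ht, hr⟩ := reads_cons.1 hr
      obtain ⟨i, hi, e1, e2, e3⟩ := h1 _ ht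
      refine ⟨i, hi, e1, wordVal (w.map f), ?_, ?_⟩
      · rw [e3, ih]
        exact ⟨w, by simpa using hw, ⟨q, hq, hr⟩, rfl⟩
      · rw [hJ i hi, e2]
        rfl

theorem reads_mem_alphabet {p q : Q} {w : List ℕ} (h : A.Reads p w q) :
    ∀ a ∈ w, a ∈ A.alphabet := by
  induction w generalizing p with
  | nil => simp
  | cons b w ih =>
    obtain ⟨s, ht, hr⟩ := reads_cons.1 h
    intro a ha
    obtain rfl | ha := List.mem_cons.1 ha
    · exact Finset.mem_image.2 ⟨_, ht, rfl⟩
    · exact ih hr a ha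

end Automaton

/-- The first two numbers of words are those of two shortest words. -/
theorem FirstTwo.areTwoShortest {L : Language ℕ} {W : ℕ → Set ℕ} {g : List ℕ → ℕ} {N c d : ℕ}
    (h : FirstTwo W N c d) (hW : ∀ i x, x ∈ W i ↔ ∃ w ∈ L, w.length = i ∧ g w = x)
    (hg : Function.Injective g)
    (hL : ∃ u ∈ L, ∃ v ∈ L, u ≠ v ∧ u.length < N ∧ v.length < N) :
    ∃ u v, AreTwoShortest L u v ∧ u.length < N ∧ v.length < N ∧ g u = c ∧ g v = d := by
  obtain ⟨u, hu, v, hv, huv, hul, hvl⟩ := hL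
  have hd : d ≠ 0 := fun hd => huv <| hg <|
    (h.single hd _ hul _ ((hW _ _).2 ⟨u, hu, rfl, rfl⟩)).trans
      (h.single hd _ hvl _ ((hW _ _).2 ⟨v, hv, rfl, rfl⟩)).symm
  have hc : c ≠ 0 := fun hc => hd (h.zero hc).1
  obtain ⟨i, hi, h1, h2⟩ := h.fst hc
  obtain ⟨hdc, j, hj, h3, h4⟩ := h.snd hd
  obtain ⟨x, hx, rfl, rfl⟩ := (hW _ _).1 h1
  obtain ⟨y, hy, rfl, rfl⟩ := (hW _ _).1 h3
  refine ⟨x, y, ⟨hx, hy, fun h => hdc (by rw [h]), fun w hw => ?_, fun w hw hwx => ?_⟩, hi, hj, rfl,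
    rfl⟩
  · by_cases hwl : w.length < N
    · exact h2 _ hwl _ ((hW _ _).2 ⟨w, hw, rfl, rfl⟩)
    · omega
  · by_cases hwl : w.length < N
    · exact h4 _ hwl _ ((hW _ _).2 ⟨w, hw, rfl, rfl⟩) fun h => hwx (hg h)
    · omega

/-! ### Computing the distance of two shortest words. -/

namespace Prog

/-- Find the numbers of the first two words that lead from the start state to a final state. -/
def twoWords : Prog :=
  (.set (.scratch 6) (.add (.reg (.numStates .input)) (.reg (.numStates .input))) ;;
    .write (.scratch 34) (.const 0) (.const 0) ;; .write (.scratch 35) (.const 0) (.const 0)) ;;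
  loop (.scratch 3) (.numStates .input)
    (.write (.scratch 30) (.reg (.scratch 3)) (.arr (.final .input) (.reg (.scratch 3))) ;;
      .write (.scratch 31) (.reg (.scratch 3)) (.const 0)) ;;
  loop (.scratch 4) (.scratch 6)
    ((.set (.scratch 7) (.arr (.scratch 30) (.reg (.start .input))) ;;
      insert (.scratch 34) (.scratch 35) (.const 0) (.scratch 7)) ;;
    (.set (.scratch 7) (.arr (.scratch 31) (.reg (.start .input))) ;;
      insert (.scratch 34) (.scratch 35) (.const 0) (.scratch 7)) ;; nextLayer)

/-- In round `l` the stored words of length `l` from the start state are offered to the pair in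
arrays `34`, `35`, and then the next layer is computed. Array `30` starts as a copy of the final
flags, because the code of the empty word and the flag of a final state are both `1`. -/
theorem Ter.twoWords {σ : Mem} {E n s R : ℕ} {S D J F : ℕ → ℕ}
    (hn : σ.reg (.numStates .input) = n) (hE : σ.reg (.numTrans .input) = E)
    (hs : σ.reg (.start .input) = s) (hsn : s < n)
    (hS : σ.arr (.src .input) = S) (hD : σ.arr (.dst .input) = D) (hJ : σ.arr (.scratch 1) = J)
    (hF : σ.arr (.final .input) = F) (hF1 : ∀ q < n, F q = 0 ∨ F q = 1)
    (hDn : ∀ i < E, D i < n) (hJR : ∀ i < E, J i ≤ R) :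
    Prog.twoWords.Ter σ (n * 20 + (n + n) * (n * 38 + E * (R * 28 + 130) + 110) + 40)
      (fun τ => FirstTwo (fun l => layerSet E S D J F l s) (n + n)
        (τ.arr (.scratch 34) 0) (τ.arr (.scratch 35) 0)) := by
  refine Ter.le (B := 12 + ((n * (8 + 10) + 8) + ((n + n) * ((30 + (30 +
    (n * 38 + E * (R * 28 + 130) + 24))) + 10) + 8))) (Ter.seq ((Ter.straight (Q := fun τ =>
    τ.reg (.scratch 6) = n + n ∧ τ.arr (.scratch 34) 0 = 0 ∧ τ.arr (.scratch 35) 0 = 0) (by rfl)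
    (by simp [exec, hn])).imp ?_)) (by ring_nf; omega)
  rintro τ1 F1 ⟨h6, h34, h35⟩ -
  refine Ter.seq ((Ter.loop (fun i τ => ∀ q < i, τ.arr (.scratch 30) q = F q ∧
    τ.arr (.scratch 31) q = 0) 8 n ((F1.reg _ (by decide)).trans hn) (by decide) (by decide)
    (by decide) (by simp) ?_).imp ?_)
  · intro i hi τ F2 hτi hI
    refine Ter.straight (by rfl) fun q hq => ?_
    simp only [exec, Exp.eval, Mem.setReg_arr, Mem.setArr_arr, Mem.setArr_reg, hτi,
      F2.arr (.final .input) (by decide), F1.arr (.final .input) (by decide), hF]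
    by_cases h : q = i
    · simp [h]
    · simpa [h] using hI q (by omega)
  intro τ2 F2 h2 _
  refine (Ter.loop (fun l τ => FirstTwo (fun l => layerSet E S D J F l s) l
    (τ.arr (.scratch 34) 0) (τ.arr (.scratch 35) 0) ∧ ∀ q < n, TwoOf (layerSet E S D J F l q)
      (τ.arr (.scratch 30) q) (τ.arr (.scratch 31) q)) _ (n + n) ((F2.reg _ (by decide)).trans h6)
    (by decide) (by decide) (by decide) ?_ ?_).imp fun τ _ h => h.1
  · refine ⟨?_, fun q hq => ?_⟩
    · rw [Mem.setReg_arr, F2.arr _ (by decide), F2.arr _ (by decide), h34, h35]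
      exact FirstTwo.init
    · obtain ⟨e1, e2⟩ := h2 q hq
      rw [Mem.setReg_arr, e1, e2]
      rcases hF1 q hq with h | h <;> rw [h] <;> constructor <;> simp [layerSet, h]
  · rintro l hl τ F3 hτl ⟨hI1, hI2⟩
    have rs : τ.reg (.start .input) = s := by
      rw [F3.reg _ (by decide), F2.reg _ (by decide), F1.reg _ (by decide), hs]
    obtain ⟨p, q, hpq⟩ : ∃ p q, (p, q) = insPair (τ.arr (.scratch 34) 0) (τ.arr (.scratch 35) 0)
      (τ.arr (.scratch 30) s) := ⟨_, _, rfl⟩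
    have hnew := hI1.succ (hI2 s hsn) hpq
    obtain ⟨p', q', hpq'⟩ : ∃ p' q', (p', q') = insPair p q (τ.arr (.scratch 31) s) := ⟨_, _, rfl⟩
    rw [← hpq'] at hnew
    obtain ⟨τ', hτ'⟩ : ∃ τ', τ' = τ.setReg (.scratch 7) (τ.arr (.scratch 30) s) := ⟨_, rfl⟩
    obtain ⟨d1, d2, d3, d4⟩ := exec_insert (a := .scratch 34) (b := .scratch 35)
      (i := .const 0) (x := .scratch 7) (σ := τ') (by decide) (p := p) (q := q)
      (by rw [hpq, hτ']; simp)
    simp only [Exp.eval] at d2 d3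
    refine Ter.seq (Ter.straight (Q := fun υ => υ = (Prog.insert (.scratch 34) (.scratch 35)
      (.const 0) (.scratch 7)).exec τ') (by rfl) (by rw [exec_seq, exec_set, hτ', Exp.eval, Exp.eval,
        rs]) |>.imp ?_)
    rintro υ G1 rfl -
    obtain ⟨υ, hυ⟩ : ∃ υ, υ = (Prog.insert (.scratch 34) (.scratch 35)
      (.const 0) (.scratch 7)).exec τ' := ⟨_, rfl⟩
    rw [← hυ] at G1 d1 d2 d3 d4 ⊢
    obtain ⟨υ', hυ'⟩ : ∃ υ', υ' = υ.setReg (.scratch 7) (τ.arr (.scratch 31) s) := ⟨_, rfl⟩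
    obtain ⟨e1, e2, e3, e4⟩ := exec_insert (a := .scratch 34) (b := .scratch 35)
      (i := .const 0) (x := .scratch 7) (σ := υ') (by decide) (p := p') (q := q')
      (by rw [hpq', hυ']; simp [d2, d3])
    simp only [Exp.eval] at e2 e3
    refine Ter.seq (Ter.straight (Q := fun ω => ω = (Prog.insert (.scratch 34) (.scratch 35)
      (.const 0) (.scratch 7)).exec υ') (by rfl) (by
        rw [exec_seq, exec_set, hυ', Exp.eval, Exp.eval, G1.reg _ (by decide), rs,
          G1.arr _ (by decide)]) |>.imp ?_)
    rintro ω G2 rfl -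
    obtain ⟨ω, hω⟩ : ∃ ω, ω = (Prog.insert (.scratch 34) (.scratch 35)
      (.const 0) (.scratch 7)).exec υ' := ⟨_, rfl⟩
    rw [← hω] at G2 e1 e2 e3 e4 ⊢
    have ra : ∀ a, a ∈ [Arr.src .input, .dst .input, .scratch 1] → ω.arr a = σ.arr a := by
      intro a ha
      have g1 : τ1.arr a = σ.arr a := F1.arr a (by revert a; decide)
      have g2 : τ2.arr a = τ1.arr a := F2.arr a (by clear g1; revert a; decide)
      have g3 : τ.arr a = τ2.arr a := F3.arr a (by clear g1 g2; revert a; decide)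
      have g4 : υ.arr a = τ.arr a := G1.arr a (by clear g1 g2 g3; revert a; decide)
      have g5 : ω.arr a = υ.arr a := G2.arr a (by clear g1 g2 g3 g4; revert a; decide)
      rw [g5, g4, g3, g2, g1]
    have rr : ∀ x, x ∈ [Reg.numStates .input, .numTrans .input] → ω.reg x = σ.reg x := by
      intro a ha
      have g1 : τ1.reg a = σ.reg a := F1.reg a (by revert a; decide)
      have g2 : τ2.reg a = τ1.reg a := F2.reg a (by clear g1; revert a; decide)
      have g3 : τ.reg a = τ2.reg a := F3.reg a (by clear g1 g2; revert a; decide)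
      have g4 : υ.reg a = τ.reg a := G1.reg a (by clear g1 g2 g3; revert a; decide)
      have g5 : ω.reg a = υ.reg a := G2.reg a (by clear g1 g2 g3 g4; revert a; decide)
      rw [g5, g4, g3, g2, g1]
    refine (Ter.nextLayer (W := layerSet E S D J F l) (R := R) ((rr _ (by decide)).trans hn)
      ((rr _ (by decide)).trans hE) ((ra _ (by decide)).trans hS) ((ra _ (by decide)).trans hD)
      ((ra _ (by decide)).trans hJ) hDn hJR ?_).imp ?_
    · intro q hq
      rw [G2.arr _ (by decide), G2.arr _ (by decide), G1.arr _ (by decide), G1.arr _ (by decide)]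
      exact hI2 q hq
    · intro ρ F4 h4
      refine ⟨?_, h4⟩
      rw [Mem.setReg_arr, F4.arr _ (by decide), F4.arr _ (by decide)]
      convert hnew using 1
      · exact (e2 0).trans (if_pos rfl)
      · exact (e3 0).trans (if_pos rfl)

/-- Compute the edit distance of two shortest words. -/
def bound : Prog :=
  dedupe (.add (.arr (.inp .input) (.reg (.scratch 0))) (.const 1)) (.numTrans .input) ;;
  twoWords ;; .set (.scratch 7) (.arr (.scratch 34) (.const 0)) ;;
  decode (.scratch 36) (.scratch 10) ;; .set (.scratch 7) (.arr (.scratch 35) (.const 0)) ;;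
  decode (.scratch 37) (.scratch 11) ;; editTable

/-- `2 * n` rounds suffice by `Automaton.exists_two_short`, where `n` is the number of states. The
words are found in renumbered symbols; the renumbering is injective, so it changes neither which
words are shortest nor their distance (`editDist_map`). -/
theorem Ter.bound {Q : Type} [Fintype Q] {A : Automaton Q} {σ : Mem} (hA : σ.HoldsAutomaton A)
    (hL : ∃ u ∈ A.language, ∃ v ∈ A.language, u ≠ v) :
    Prog.bound.Ter σ (3000 * (A.size ^ 2 * (A.alphabet.card + 1)))
      (fun τ => IsShortestWordsBound A.language (τ.reg .bound)) := by
  obtain ⟨num, hnd, hmem, h1, h2, h3, h4⟩ := hA.elim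
  obtain ⟨E, hE⟩ : ∃ E, E = A.trans.card := ⟨_, rfl⟩
  obtain ⟨n, hn⟩ : ∃ n, n = Fintype.card Q := ⟨_, rfl⟩
  obtain ⟨R, hR⟩ : ∃ R, R = A.alphabet.card + 1 := ⟨_, rfl⟩
  obtain ⟨f, hf⟩ : ∃ f : List ℕ → ℕ → ℕ, f = fun C a => rank C (a + 1) := ⟨_, rfl⟩
  have ht1 : ∀ t ∈ A.trans, ∃ i < E, σ.arr (.src .input) i = num t.1 ∧
      σ.arr (.inp .input) i = t.2.1 ∧ σ.arr (.dst .input) i = num t.2.2 := by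
    intro t ht
    obtain ⟨i, hi, h⟩ := Mem.mem_list.1 ((hmem _).2 ⟨t, ht, rfl⟩)
    simp only [Mem.row, autRecord, Prod.mk.injEq] at h
    exact ⟨i, by omega, h.1, h.2.1, h.2.2.2⟩
  have ht2 : ∀ i < E, ∃ t ∈ A.trans, σ.arr (.src .input) i = num t.1 ∧
      σ.arr (.inp .input) i = t.2.1 ∧ σ.arr (.dst .input) i = num t.2.2 := by
    intro i hi
    obtain ⟨t, ht, h⟩ := (hmem _).1 (Mem.row_mem_list (σ := σ) (n := .numTrans .input) (i := i)
      (by omega) _ _ _ _)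
    simp only [Mem.row, autRecord, Prod.mk.injEq] at h
    exact ⟨t, ht, h.1.symm, h.2.1.symm, h.2.2.2.symm⟩
  have hU : ∀ j ≤ E, ∀ C, IsNumbering (fun j => σ.arr (.inp .input) j + 1) j C → C.length ≤ R := by
    intro j hj C hC
    refine (hC.length_le (S := {0} ∪ A.alphabet.image (· + 1)) (by simp) ?_).trans ?_
    · intro i hi
      obtain ⟨t, ht, -, e, -⟩ := ht2 i (by omega)
      rw [e]
      have ha : t.2.1 ∈ A.alphabet := Finset.mem_image.2 ⟨t, ht, rfl⟩
      exact Finset.mem_union.2 (.inr (Finset.mem_image.2 ⟨_, ha, rfl⟩))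
    · have h1 := Finset.card_union_le {0} (A.alphabet.image (· + 1))
      have h2 := Finset.card_image_le (s := A.alphabet) (f := (· + 1))
      rw [Finset.card_singleton] at h1
      omega
  have hn1 : 1 ≤ n := hn ▸ Fintype.card_pos_iff.2 ⟨A.start⟩
  have hsize : A.size = n + E := by rw [Automaton.size, hn, hE]
  rw [hsize, ← hR]
  obtain ⟨N, hN⟩ : ∃ N, N = n + n := ⟨_, rfl⟩
  refine Ter.le (B := (E * (R * 32 + 44) + 20) + ((n * 20 + (n + n) *
    (n * 38 + E * (R * 28 + 130) + 110) + 40) + (3 + ((N * (R * 25 + 50) + 10) + (3 +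
    ((N * (R * 25 + 50) + 10) + (N * 13 + N * (N * 80 + 40) + 40))))))) (Ter.seq
    ((Ter.dedupe (f := fun j => σ.arr (.inp .input) j + 1) (R := R) (h4.trans hE.symm)
      (by decide) (by decide) ?_ hU).imp ?_)) ?_
  · intro j hj τ F h
    simp [h, F.arr (.inp .input) (by decide)]
  · rintro τ1 F1 ⟨C, hC, -, hrank⟩ -
    have hCR := hU E le_rfl C hC
    have hinj : Function.Injective (f C) := by
      intro a b h
      rw [hf] at h
      simpa using rank_injective C h
    have hpos : ∀ a, 0 < f C a := by
      intro a
      rw [Nat.pos_iff_ne_zero]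
      intro h0
      have h00 : rank C 0 = 0 := by rw [rank, if_pos hC.zero_mem, hC.idxOf_zero]
      rw [hf] at h0
      exact absurd (rank_injective C (h0.trans h00.symm)) (by simp)
    have hJ : ∀ i < E, τ1.arr (.scratch 1) i = f C (σ.arr (.inp .input) i) := by
      intro i hi
      rw [hrank i hi, hf]
      simp only [rank]
      rw [if_pos (hC.mem hi)]
    have hJle : ∀ a ∈ A.alphabet, f C a ≤ R := by
      intro a ha
      obtain ⟨t, ht, rfl⟩ := Finset.mem_image.1 ha
      obtain ⟨i, hi, -, e, -⟩ := ht1 t ht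
      rw [← e, ← hJ i hi, hrank i hi]
      exact (List.idxOf_lt_length_of_mem (hC.mem hi)).le.trans hCR
    have hJR : ∀ i < E, τ1.arr (.scratch 1) i ≤ R := by
      intro i hi
      obtain ⟨t, ht, -, e, -⟩ := ht2 i hi
      rw [hJ i hi, e]
      exact hJle _ (Finset.mem_image.2 ⟨t, ht, rfl⟩)
    refine Ter.seq ((Ter.twoWords (n := n) (E := E) (s := num A.start) (R := R)
      ((F1.reg _ (by decide)).trans (h1.trans hn.symm))
      ((F1.reg _ (by decide)).trans (h4.trans hE.symm))
      ((F1.reg _ (by decide)).trans h2) (by rw [hn]; exact (num _).2) (F1.arr _ (by decide))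
      (F1.arr _ (by decide)) rfl (F1.arr _ (by decide)) ?_ ?_ hJR).imp ?_)
    · intro q hq
      obtain ⟨b1, b2⟩ := h3 (num.symm ⟨q, hn ▸ hq⟩)
      simp only [Equiv.apply_symm_apply] at b1 b2
      by_cases h : num.symm ⟨q, hn ▸ hq⟩ ∈ A.final
      exacts [.inr (b1 h), .inl (b2 h)]
    · intro i hi
      obtain ⟨t, -, -, -, e⟩ := ht2 i hi
      rw [e, hn]
      exact (num _).2
    intro τ2 F2 h5 _
    obtain ⟨u, v, huv, hul, hvl, hu, hv⟩ := h5.areTwoShortest (L := A.language)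
      (g := fun w => wordVal (w.map (f C))) (by
        intro i x
        rw [Automaton.mem_layerSet_iff ht1 ht2 hJ (f := f C)]
        · constructor
          · rintro ⟨w, hw, hr, rfl⟩
            exact ⟨w, Automaton.mem_language.2 hr, hw, rfl⟩
          · rintro ⟨w, hr, hw, rfl⟩
            exact ⟨w, hw, Automaton.mem_language.1 hr, rfl⟩
        · intro p
          obtain ⟨b1, b2⟩ := h3 p
          by_cases hp : p ∈ A.final <;> simp_all)
      (by
        intro w w' h
        refine List.map_injective_iff.2 hinj (wordVal_injective ?_ ?_ h)
        · intro j hj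
          obtain ⟨a, -, rfl⟩ := List.mem_map.1 hj
          exact hpos a
        · intro j hj
          obtain ⟨a, -, rfl⟩ := List.mem_map.1 hj
          exact hpos a)
      (by
        have := Automaton.exists_two_short hL
        rwa [← hn, two_mul] at this)
    have hletters : ∀ w ∈ A.language, ∀ j ∈ w.map (f C), 0 < j ∧ j ≤ R := by
      intro w hw j hj
      obtain ⟨a, ha, rfl⟩ := List.mem_map.1 hj
      obtain ⟨q, -, hr⟩ := Automaton.mem_language.1 hw
      exact ⟨hpos a, hJle a (Automaton.reads_mem_alphabet hr a ha)⟩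
    refine Ter.seq (Ter.set fun _ => ?_)
    refine Ter.seq (((Ter.decode (w := u.map (f C)) (R := R) (by decide) (hletters u huv.1)
      (by simpa using hu.symm)).le ?_).imp ?_)
    · rw [List.length_map]
      gcongr
      omega
    intro τ3 F3 h6 _
    refine Ter.seq (Ter.set fun _ => ?_)
    refine Ter.seq (((Ter.decode (w := v.map (f C)) (R := R) (by decide) (hletters v huv.2.1)
      ?_).le ?_).imp ?_)
    · simp only [Mem.setReg_reg, if_true, Exp.eval, F3.arr (.scratch 35) (by decide)]
      exact hv.symm
    · rw [List.length_map]
      gcongr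
      omega
    intro τ4 F4 h7 _
    refine ((Ter.editTable (u := u.map (f C)) (v := v.map (f C)) ?_ h7).le ?_).imp ?_
    · rw [F4.reg _ (by decide), F4.arr _ (by decide)]
      simpa using h6
    · rw [List.length_map, List.length_map]
      gcongr <;> omega
    · intro τ5 _ h8
      rw [h8, editDist_map hinj]
      exact ⟨u, v, huv, rfl⟩
  · obtain ⟨a, ha⟩ : ∃ a, a = n + E := ⟨_, rfl⟩
    have hna : n ≤ a := by omega
    have hEa : E ≤ a := by omega
    have hNa : N ≤ 2 * a := by omega
    have ha1 : 1 ≤ a := by omega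
    have hR1 : 1 ≤ R := by omega
    rw [← ha]
    calc _ ≤ (a * (R * 32 + 44) + 20) + ((a * 20 + (a + a) *
        (a * 38 + a * (R * 28 + 130) + 110) + 40) + (3 + ((2 * a * (R * 25 + 50) + 10) + (3 +
        ((2 * a * (R * 25 + 50) + 10) + (2 * a * 13 + 2 * a * (2 * a * 80 + 40) + 40)))))) := by
          gcongr
      _ ≤ _ := by
        have e1 : 1 ≤ a ^ 2 * R := Nat.mul_pos (by positivity) hR1
        have e0 : a ≤ a ^ 2 := by nlinarith
        have e2 : a ≤ a ^ 2 * R := e0.trans (Nat.le_mul_of_pos_right _ hR1)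
        have e3 : a * R ≤ a ^ 2 * R := Nat.mul_le_mul_right _ e0
        have e4 : a ^ 2 ≤ a ^ 2 * R := Nat.le_mul_of_pos_right _ hR1
        ring_nf at e1 e2 e3 e4 ⊢
        omega

end Prog

/-! ### Distances of different words -/

theorem editDist_self {α : Type} [DecidableEq α] (u : List α) : editDist u u = 0 := by
  rw [editDist_eq_editRec]
  induction u with
  | nil => simp
  | cons a u ih =>
    rw [editRec_cons_cons, ih]
    simp

theorem eq_of_editDist_eq_zero {α : Type} [DecidableEq α] {u v : List α} (h : editDist u v = 0) :
    u = v := by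
  obtain ⟨e, rfl, rfl, he⟩ := exists_editWeight_eq_editDist u v
  rw [h, editWeight, List.countP_eq_zero] at he
  refine List.filterMap_congr fun x hx => ?_
  simpa using he x hx

section LanguageDistance

variable {α : Type} [DecidableEq α] {L : Language α}

theorem exists_editDist_eq_languageEditDist (h : ∃ u ∈ L, ∃ v ∈ L, u ≠ v) :
    ∃ u ∈ L, ∃ v ∈ L, u ≠ v ∧ editDist u v = languageEditDist L := by
  obtain ⟨u, hu, v, hv, huv⟩ := h
  exact Nat.sInf_mem (s := {n | ∃ u ∈ L, ∃ v ∈ L, u ≠ v ∧ editDist u v = n})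
    ⟨_, u, hu, v, hv, huv, rfl⟩

theorem languageEditDist_le {u v : List α} (hu : u ∈ L) (hv : v ∈ L) (huv : u ≠ v) :
    languageEditDist L ≤ editDist u v :=
  Nat.sInf_le ⟨u, hu, v, hv, huv, rfl⟩

theorem languageEditDist_pos (h : ∃ u ∈ L, ∃ v ∈ L, u ≠ v) : 0 < languageEditDist L := by
  obtain ⟨u, -, v, -, huv, h⟩ := exists_editDist_eq_languageEditDist h
  rw [← h, Nat.pos_iff_ne_zero]
  exact fun h0 => huv (eq_of_editDist_eq_zero h0)

theorem IsShortestWordsBound.languageEditDist_le {d : ℕ} (h : IsShortestWordsBound L d) :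
    languageEditDist L ≤ d := by
  obtain ⟨u, v, ⟨hu, hv, hvu, -⟩, rfl⟩ := h
  exact _root_.languageEditDist_le hu hv hvu.symm

end LanguageDistance

/-! ### The relation realized by the channel -/

theorem mem_sidTransducer_trans {S : Finset ℕ} {k : ℕ} {i j : Fin (k + 1)} {x y : Option ℕ} :
    (i, x, y, j) ∈ (sidTransducer S k).trans ↔
      (x = y ∧ i = j ∧ ∃ a ∈ S, x = some a) ∨
      (x ≠ y ∧ (j : ℕ) = i + 1 ∧ x ∈ Finset.insertNone S ∧ y ∈ Finset.insertNone S) := by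
  simp only [sidTransducer, Finset.mem_union, Finset.mem_image, Finset.mem_product,
    Finset.mem_univ, true_and, Finset.mem_filter, Prod.exists, Prod.mk.injEq]
  constructor
  · rintro (⟨i, a, ha, rfl, rfl, rfl, rfl⟩ | ⟨i, x, y, ⟨⟨hx, hy⟩, hxy⟩, rfl, rfl, rfl, rfl⟩)
    · exact .inl ⟨rfl, rfl, a, ha, rfl⟩
    · exact .inr ⟨hxy, by simp, hx, hy⟩
  · rintro (⟨rfl, rfl, a, ha, rfl⟩ | ⟨hxy, hj, hx, hy⟩)
    · exact .inl ⟨i, a, ha, rfl, rfl, rfl, rfl⟩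
    · exact .inr ⟨⟨i, by omega⟩, x, y, ⟨⟨hx, hy⟩, hxy⟩, rfl, rfl, rfl, Fin.ext hj.symm⟩

/-- The state counts the errors made so far: a path from `i` to `j` spells an edit string of weight
exactly `j - i`. -/
theorem editDist_add_le_of_path {S : Finset ℕ} {k : ℕ} {i j : Fin (k + 1)} {u v : List ℕ}
    (h : (sidTransducer S k).Path i u v j) : editDist u v + i ≤ j := by
  suffices ∃ e : List (EditOp ℕ), editInp e = u ∧ editOut e = v ∧ editWeight e + i = j by
    obtain ⟨e, rfl, rfl, hw⟩ := this
    have := editDist_le_editWeight e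
    omega
  induction h with
  | nil i => exact ⟨[], rfl, rfl, by simp [editWeight]⟩
  | @cons p q s x y u v ht _ ih =>
    obtain ⟨h, rfl, rfl, hw⟩ := ih
    have ht := mem_sidTransducer_trans.1 ht
    have hxy : (x, y) ≠ (none, none) := by
      rintro ⟨⟩
      simp at ht
    refine ⟨⟨(x, y), hxy⟩ :: h, ?_, ?_, ?_⟩
    · cases x <;> simp [editInp]
    · cases y <;> simp [editOut]
    · rw [editWeight] at hw ⊢
      rw [List.countP_cons]
      rcases ht with ⟨rfl, rfl, -⟩ | ⟨hxy, hq, -⟩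
      · simpa using hw
      · simp only [ne_eq, hxy, not_false_eq_true, decide_true, if_true] at hw ⊢
        omega

theorem path_of_editWeight_le {S : Finset ℕ} {k : ℕ} (h : List (EditOp ℕ)) :
    ∀ i : Fin (k + 1), i + editWeight h ≤ k → (∀ a ∈ editInp h, a ∈ S) →
      (∀ a ∈ editOut h, a ∈ S) → ∃ j, (sidTransducer S k).Path i (editInp h) (editOut h) j := by
  induction h with
  | nil => exact fun i _ _ _ => ⟨i, .nil i⟩
  | cons e h ih =>
    obtain ⟨⟨x, y⟩, hxy⟩ := e
    intro i hi hu hv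
    have e1 : editInp (⟨(x, y), hxy⟩ :: h) = x.toList ++ editInp h := by
      cases x <;> simp [editInp]
    have e2 : editOut (⟨(x, y), hxy⟩ :: h) = y.toList ++ editOut h := by
      cases y <;> simp [editOut]
    have e3 : editWeight (⟨(x, y), hxy⟩ :: h) = editWeight h + if x = y then 0 else 1 := by
      rw [editWeight, editWeight, List.countP_cons]
      by_cases h : x = y <;> simp [h]
    rw [e1] at hu ⊢
    rw [e2] at hv ⊢
    rw [e3] at hi
    have hx : x ∈ Finset.insertNone S := by
      cases x <;> simp_all
    have hy : y ∈ Finset.insertNone S := by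
      cases y <;> simp_all
    have hu' := fun a ha => hu a (List.mem_append_right _ ha)
    have hv' := fun a ha => hv a (List.mem_append_right _ ha)
    by_cases h : x = y
    · rw [if_pos h] at hi
      obtain ⟨j, hj⟩ := ih i (by omega) hu' hv'
      refine ⟨j, .cons (mem_sidTransducer_trans.2 (.inl ⟨h, rfl, ?_⟩)) hj⟩
      subst h
      cases x with
      | none => exact absurd rfl hxy
      | some a => exact ⟨a, by simpa using hx, rfl⟩
    · rw [if_neg h] at hi
      obtain ⟨j, hj⟩ := ih ⟨i + 1, by omega⟩ (by simp only; omega) hu' hv'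
      exact ⟨j, .cons (mem_sidTransducer_trans.2 (.inr ⟨h, rfl, hx, hy⟩)) hj⟩

theorem sidTransducer_realizes_iff {S : Finset ℕ} {k : ℕ} {u v : List ℕ}
    (hu : ∀ a ∈ u, a ∈ S) (hv : ∀ a ∈ v, a ∈ S) :
    (sidTransducer S k).Realizes u v ↔ editDist u v ≤ k := by
  constructor
  · rintro ⟨f, -, h⟩
    have h := editDist_add_le_of_path h
    have := f.isLt
    omega
  · intro h
    obtain ⟨e, rfl, rfl, he⟩ := exists_editWeight_eq_editDist u v
    obtain ⟨j, hj⟩ := path_of_editWeight_le e 0 (by simpa using he.trans_le h) hu hv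
    exact ⟨j, Finset.mem_univ _, hj⟩

/-! ### The relation realized by the product -/

theorem Automaton.reads_toList_append {Q : Type} {A : Automaton Q} {p q : Q} {x : Option ℕ}
    {w : List ℕ} : A.Reads p (x.toList ++ w) q ↔ ∃ s, A.Moves p x s ∧ A.Reads s w q := by
  cases x with
  | none => simp [Automaton.Moves]
  | some a => exact Automaton.reads_cons

namespace Transducer

variable {P Q : Type} [Fintype P] [Fintype Q] {T : Transducer P} {A : Automaton Q}

theorem Path.of_restrict {z z' : P × Q × Q} {u v : List ℕ} (h : (T.restrict A).Path z u v z') :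
    T.Path z.1 u v z'.1 ∧ A.Reads z.2.1 u z'.2.1 ∧ A.Reads z.2.2 v z'.2.2 := by
  induction h with
  | nil z => exact ⟨.nil _, Automaton.reads_nil.2 rfl, Automaton.reads_nil.2 rfl⟩
  | cons ht _ ih =>
    obtain ⟨h1, h2, h3⟩ := mem_restrict_trans.1 ht
    exact ⟨.cons h1 ih.1, Automaton.reads_toList_append.2 ⟨_, h2, ih.2.1⟩,
      Automaton.reads_toList_append.2 ⟨_, h3, ih.2.2⟩⟩

theorem Path.restrict {i j : P} {u v : List ℕ} (h : T.Path i u v j) :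
    ∀ {p q p' q' : Q}, A.Reads p u p' → A.Reads q v q' →
      (T.restrict A).Path (i, p, q) u v (j, p', q') := by
  induction h with
  | nil i =>
    intro p q p' q' hp hq
    rw [Automaton.reads_nil.1 hp, Automaton.reads_nil.1 hq]
    exact .nil _
  | cons ht _ ih =>
    intro p q p' q' hp hq
    obtain ⟨s, hs, hp⟩ := Automaton.reads_toList_append.1 hp
    obtain ⟨r, hr, hq⟩ := Automaton.reads_toList_append.1 hq
    exact .cons (mem_restrict_trans.2 ⟨ht, hs, hr⟩) (ih hp hq)

theorem restrict_realizes_iff {u v : List ℕ} :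
    (T.restrict A).Realizes u v ↔ T.Realizes u v ∧ u ∈ A.language ∧ v ∈ A.language := by
  constructor
  · rintro ⟨⟨f, p, q⟩, hf, h⟩
    obtain ⟨hf, hp, hq⟩ : f ∈ T.final ∧ p ∈ A.final ∧ q ∈ A.final := by
      simpa [Transducer.restrict] using hf
    obtain ⟨h1, h2, h3⟩ := h.of_restrict
    exact ⟨⟨f, hf, h1⟩, Automaton.mem_language.2 ⟨p, hp, h2⟩,
      Automaton.mem_language.2 ⟨q, hq, h3⟩⟩
  · rintro ⟨⟨f, hf, h1⟩, hu, hv⟩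
    obtain ⟨p, hp, h2⟩ := Automaton.mem_language.1 hu
    obtain ⟨q, hq, h3⟩ := Automaton.mem_language.1 hv
    exact ⟨(f, p, q), by simp [Transducer.restrict, hf, hp, hq], h1.restrict h2 h3⟩

end Transducer

theorem Automaton.mem_alphabet_of_mem_language {Q : Type} {A : Automaton Q} {w : List ℕ}
    (hw : w ∈ A.language) : ∀ a ∈ w, a ∈ A.alphabet := by
  obtain ⟨q, -, h⟩ := mem_language.1 hw
  exact reads_mem_alphabet h

theorem restrict_sidTransducer_realizes_iff {Q : Type} [Fintype Q] {A : Automaton Q} {k : ℕ}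
    {u v : List ℕ} : ((sidTransducer A.alphabet k).restrict A).Realizes u v ↔
      editDist u v ≤ k ∧ u ∈ A.language ∧ v ∈ A.language := by
  rw [Transducer.restrict_realizes_iff]
  refine and_congr_left fun h => sidTransducer_realizes_iff ?_ ?_
  exacts [Automaton.mem_alphabet_of_mem_language h.1, Automaton.mem_alphabet_of_mem_language h.2]

/-- The channel is error-detecting for the language of `A` as long as the number of errors is less
than the edit distance. -/
theorem restrict_sidTransducer_functional_iff {Q : Type} [Fintype Q] {A : Automaton Q} {k : ℕ}
    (hL : ∃ u ∈ A.language, ∃ v ∈ A.language, u ≠ v) :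
    ((sidTransducer A.alphabet k).restrict A).Functional ↔ k < languageEditDist A.language := by
  constructor
  · intro h
    by_contra hk
    obtain ⟨u, hu, v, hv, huv, hd⟩ := exists_editDist_eq_languageEditDist hL
    -- A word has itself as an output, at distance `0`, so a second accepted word within distance
    -- `k` contradicts functionality.
    refine huv (h u u v (restrict_sidTransducer_realizes_iff.2 ⟨?_, hu, hu⟩)
      (restrict_sidTransducer_realizes_iff.2 ⟨?_, hu, hv⟩))
    · rw [editDist_self]
      exact Nat.zero_le _
    · omega
  · intro hk u
    have key : ∀ v, ((sidTransducer A.alphabet k).restrict A).Realizes u v → u = v := by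
      intro v hv
      by_contra huv
      obtain ⟨h1, h2, h3⟩ := restrict_sidTransducer_realizes_iff.1 hv
      have := languageEditDist_le h2 h3 huv
      omega
    intro v w hv hw
    rw [← key v hv, ← key w hw]

/-! ### The sizes of the constructed transducers -/

theorem card_sidTransducer_trans_le (S : Finset ℕ) (k : ℕ) :
    (sidTransducer S k).trans.card ≤ 2 * (k + 1) * (S.card + 1) ^ 2 := by
  have h1 : ((Finset.insertNone S ×ˢ Finset.insertNone S).filter
      (fun xy => xy.1 ≠ xy.2)).card ≤ (S.card + 1) ^ 2 := by
    refine (Finset.card_filter_le _ _).trans ?_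
    rw [Finset.card_product, Finset.card_insertNone, sq]
  refine (Finset.card_union_le _ _).trans
    ((add_le_add Finset.card_image_le Finset.card_image_le).trans ?_)
  rw [Finset.card_product, Finset.card_product, Finset.card_univ, Finset.card_univ,
    Fintype.card_fin, Fintype.card_fin]
  have h2 : S.card ≤ (S.card + 1) ^ 2 := by nlinarith
  calc _ ≤ (k + 1) * (S.card + 1) ^ 2 + (k + 1) * (S.card + 1) ^ 2 := by
        gcongr
        omega
    _ = _ := by ring

/-- The labels of a product transition are those of its two moves of `A`, and the channel either
stays or advances by one. A channel state, one bit and two moves determine the transition; there are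
`A.size` moves, and no factor for the alphabet arises. -/
theorem card_restrict_sidTransducer_trans_le {Q : Type} [Fintype Q] (A : Automaton Q)
    (S : Finset ℕ) (k : ℕ) :
    ((sidTransducer S k).restrict A).trans.card ≤ 2 * (k + 1) * A.size ^ 2 := by
  -- A move is coded by its state if it stays and by its transition otherwise.
  obtain ⟨f, hf⟩ : ∃ f : Q → Option ℕ → Q → Q ⊕ (Q × ℕ × Q),
      f = fun p x q => x.elim (.inl p) fun a => .inr (p, a, q) := ⟨_, rfl⟩
  have hmem : ∀ {p x q}, A.Moves p x q → f p x q ∈ Finset.univ.disjSum A.trans := by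
    rintro p (_ | a) q h
    · simp [hf]
    · simpa [hf, Automaton.Moves] using h
  have hinj : ∀ {p x q p' x' q'}, A.Moves p x q → A.Moves p' x' q' → f p x q = f p' x' q' →
      p = p' ∧ x = x' ∧ q = q' := by
    rintro p (_ | a) q p' (_ | a') q' h h' he
    · simp only [Automaton.Moves] at h h'
      simp only [hf, Option.elim, Sum.inl.injEq] at he
      subst h h' he
      simp
    · simp [hf] at he
    · simp [hf] at he
    · simpa [hf] using he
  -- `Prop` serves as a two-element type: the bit tells whether the channel state stays.
  refine (Finset.card_le_card_of_injOn (t := ((Finset.univ : Finset (Fin (k + 1))) ×ˢ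
    (Finset.univ : Finset Prop)) ×ˢ (Finset.univ.disjSum A.trans ×ˢ Finset.univ.disjSum A.trans))
    (fun t => ((t.1.1, t.1.1 = t.2.2.2.1), f t.1.2.1 t.2.1 t.2.2.2.2.1,
      f t.1.2.2 t.2.2.1 t.2.2.2.2.2)) ?_ ?_).trans ?_
  · intro t ht
    obtain ⟨-, h2, h3⟩ := Transducer.mem_restrict_trans.1 ht
    exact Finset.mem_product.2 ⟨Finset.mem_product.2 ⟨Finset.mem_univ _, Finset.mem_univ _⟩,
      Finset.mem_product.2 ⟨hmem h2, hmem h3⟩⟩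
  · rintro ⟨⟨i, p, q⟩, x, y, j, r, s⟩ ht ⟨⟨i', p', q'⟩, x', y', j', r', s'⟩ ht' he
    obtain ⟨h1, h2, h3⟩ := Transducer.mem_restrict_trans.1 ht
    obtain ⟨h1', h2', h3'⟩ := Transducer.mem_restrict_trans.1 ht'
    simp only [Prod.mk.injEq] at he
    obtain ⟨⟨rfl, hl⟩, e2, e3⟩ := he
    obtain ⟨rfl, rfl, rfl⟩ := hinj h2 h2' e2
    obtain ⟨rfl, rfl, rfl⟩ := hinj h3 h3' e3
    have hj : j = j' := by
      rcases mem_sidTransducer_trans.1 h1 with ⟨-, h, -⟩ | ⟨-, h, -⟩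
      · exact h.symm.trans (hl.mp h)
      · rcases mem_sidTransducer_trans.1 h1' with ⟨-, h', -⟩ | ⟨-, h', -⟩
        · exact (hl.mpr h').symm.trans h'
        · exact Fin.ext (h.trans h'.symm)
    rw [hj]
  · simp only [Finset.card_product, Finset.card_disjSum, Finset.card_univ, Fintype.card_fin,
      Fintype.card_prop, Automaton.size]
    exact le_of_eq (by ring)

theorem Mem.HoldsAutomaton.of_sameInput {Q : Type} [Fintype Q] {A : Automaton Q} {σ τ : Mem}
    (hA : σ.HoldsAutomaton A) (h : σ.SameInput τ) : τ.HoldsAutomaton A := by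
  obtain ⟨num, l, h1, h2, h3, h4, h5, h6, h7⟩ := hA
  obtain ⟨e1, e2, e3, e4, e5, e6, e7⟩ := h
  refine ⟨num, l, h1, h2, e1.trans h3, e2.trans h4, ?_, e3.trans h6, ?_⟩
  · rw [e4]
    exact h5
  · rw [e5, e6, e7]
    exact h7

/-- Over an empty alphabet only the empty word could be accepted. The time bound needs this, as it
has the size of the alphabet as a factor. -/
theorem Automaton.alphabet_nonempty {Q : Type} {A : Automaton Q}
    (hL : ∃ u ∈ A.language, ∃ v ∈ A.language, u ≠ v) : A.alphabet.Nonempty := by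
  rw [Finset.nonempty_iff_ne_empty]
  intro h0
  have hnil : ∀ w ∈ A.language, w = [] := fun w hw =>
    List.eq_nil_iff_forall_not_mem.2 fun a ha => by
      simpa [h0] using mem_alphabet_of_mem_language hw a ha
  obtain ⟨u, hu, v, hv, huv⟩ := hL
  exact huv ((hnil u hu).trans (hnil v hv).symm)

/-! ### Correctness of the four programs and cost of one test. -/

namespace Prog

/-- The program does not change the given automaton. -/
def keepsInput (c : Prog) : Prop :=
  (∀ x ∈ [Reg.numStates .input, .start .input, .numTrans .input], c.writesReg x = false) ∧
  ∀ a ∈ [Arr.final .input, .src .input, .inp .input, .dst .input], c.writesArr a = false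

instance (c : Prog) : Decidable c.keepsInput := inferInstanceAs (Decidable (_ ∧ _))

/-- The program does not change the registers of the binary search. -/
def keepsControl (c : Prog) : Prop :=
  ∀ x ∈ [Reg.bound, .min, .max, .k], c.writesReg x = false

instance (c : Prog) : Decidable c.keepsControl := List.decidableBAll _ _

theorem Frame.sameInput {c : Prog} {σ τ : Mem} (h : c.Frame σ τ) (hc : c.keepsInput) :
    σ.SameInput τ :=
  ⟨h.reg _ (hc.1 _ (by simp)), h.reg _ (hc.1 _ (by simp)), h.reg _ (hc.1 _ (by simp)),
    h.arr _ (hc.2 _ (by simp)), h.arr _ (hc.2 _ (by simp)), h.arr _ (hc.2 _ (by simp)),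
    h.arr _ (hc.2 _ (by simp))⟩

theorem Frame.sameControl {c : Prog} {σ τ : Mem} (h : c.Frame σ τ) (hc : c.keepsControl) :
    σ.SameControl τ :=
  ⟨h.reg _ (hc _ (by simp)), h.reg _ (hc _ (by simp)), h.reg _ (hc _ (by simp)),
    h.reg _ (hc _ (by simp))⟩

theorem keepsInput_bound : Prog.bound.keepsInput := by decide

theorem keepsInput_channel : Prog.channel.keepsInput := by decide

theorem keepsInput_product : Prog.product.keepsInput := by decide

theorem keepsInput_functional : Prog.functional.keepsInput := by decide

theorem keepsControl_channel : Prog.channel.keepsControl := by decide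

theorem keepsControl_product : Prog.product.keepsControl := by decide

theorem keepsControl_functional : Prog.functional.keepsControl := by decide

theorem computesBound_bound : ComputesBound Prog.bound := by
  intro Q _ A hL σ hA
  obtain ⟨τ, t, h, -, hτ⟩ := Ter.bound hA hL
  exact ⟨τ, t, h, h.frame.sameInput keepsInput_bound, hτ⟩

theorem constructsChannel_channel : ConstructsChannel Prog.channel := by
  intro Q _ A σ hA
  obtain ⟨τ, t, h, -, hτ⟩ := Ter.channel hA rfl
  exact ⟨τ, t, h, h.frame.sameInput keepsInput_channel, h.frame.sameControl keepsControl_channel,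
    hτ⟩

theorem constructsProduct_product : ConstructsProduct Prog.product := by
  intro Q _ A P _ T σ hA hT
  obtain ⟨τ, t, h, -, hτ⟩ := Ter.product hA hT
  exact ⟨τ, t, h, h.frame.sameInput keepsInput_product, h.frame.sameControl keepsControl_product,
    hτ⟩

theorem decidesFunctional_functional : DecidesFunctional Prog.functional := by
  intro P _ T σ hT
  obtain ⟨U, hU⟩ : ∃ U : Finset ℕ, U = {0} ∪ T.trans.image fun t => labelCode t.2.2.1 := ⟨_, rfl⟩
  obtain ⟨τ, t, h, -, hτ⟩ := Ter.functional hT (U := U) (by simp [hU]) (by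
    intro t ht
    rw [hU]
    exact Finset.mem_union.2 (.inr (Finset.mem_image.2 ⟨t, ht, rfl⟩)))
  exact ⟨τ, t, h, h.frame.sameInput keepsInput_functional,
    h.frame.sameControl keepsControl_functional, hτ⟩

/-- One step of the binary search. -/
theorem Ter.testErrors {Q : Type} [Fintype Q] {A : Automaton Q} {σ : Mem} {k D : ℕ}
    (hA : σ.HoldsAutomaton A) (hL : ∃ u ∈ A.language, ∃ v ∈ A.language, u ≠ v)
    (hk : σ.reg .k = k) (hkD : k < D) :
    (Prog.channel ;; Prog.product ;; Prog.functional).Ter σ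
      (79000 * (A.size ^ 4 * A.alphabet.card ^ 4 * D ^ 2))
      (fun τ => σ.SameInput τ ∧ σ.SameControl τ ∧
        (τ.reg .verdict ≠ 0 ↔ k < languageEditDist A.language)) := by
  obtain ⟨r, hr⟩ : ∃ r, r = A.alphabet.card := ⟨_, rfl⟩
  have hr1 : 1 ≤ r := hr ▸ (Automaton.alphabet_nonempty hL).card_pos
  obtain ⟨n, hn⟩ : ∃ n, n = Fintype.card Q := ⟨_, rfl⟩
  obtain ⟨E, hE⟩ : ∃ E, E = A.trans.card := ⟨_, rfl⟩
  obtain ⟨e, he⟩ : ∃ e, e = A.size := ⟨_, rfl⟩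
  have hen : e = n + E := by rw [he, hn, hE, Automaton.size]
  have hn1 : 1 ≤ n := hn ▸ Fintype.card_pos_iff.2 ⟨A.start⟩
  have he1 : 1 ≤ e := by omega
  have hD1 : 1 ≤ D := by omega
  obtain ⟨Y, hY⟩ : ∃ Y, Y = e ^ 4 * r ^ 4 * D ^ 2 := ⟨_, rfl⟩
  rw [← he, ← hr, ← hY]
  obtain ⟨U, hU⟩ : ∃ U : Finset ℕ, U = {0} ∪ A.alphabet.image (· + 1) := ⟨_, rfl⟩
  have hUcard : U.card ≤ 2 * r := by
    have h1 := Finset.card_union_le {0} (A.alphabet.image (· + 1))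
    have h2 := Finset.card_image_le (s := A.alphabet) (f := (· + 1))
    rw [Finset.card_singleton] at h1
    rw [hU]
    omega
  have hpow : ∀ {i j l : ℕ}, i ≤ 4 → j ≤ 4 → l ≤ 2 → e ^ i * r ^ j * D ^ l ≤ Y := by
    intro i j l hi hj hl
    rw [hY]
    gcongr
  have b1 : 200 * ((E + k + 1) * (r + 1) ^ 2) ≤ 1600 * Y := by
    calc 200 * ((E + k + 1) * (r + 1) ^ 2) ≤ 200 * ((e * D + e * D) * (r + r) ^ 2) := by
          have h1 : E ≤ e * D := (show E ≤ e by omega).trans (Nat.le_mul_of_pos_right _ hD1)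
          have h2 : D ≤ e * D := Nat.le_mul_of_pos_left _ he1
          have h3 : E + k + 1 ≤ e * D + e * D := by omega
          have h4 : r + 1 ≤ r + r := by omega
          gcongr
      _ = 1600 * (e ^ 1 * r ^ 2 * D ^ 1) := by ring
      _ ≤ _ := by gcongr; exact hpow (by omega) (by omega) (by omega)
  have c1 : (sidTransducer A.alphabet k).trans.card ≤ 8 * D * r ^ 2 := by
    refine (card_sidTransducer_trans_le _ _).trans ?_
    rw [← hr]
    calc 2 * (k + 1) * (r + 1) ^ 2 ≤ 2 * D * (r + r) ^ 2 := by gcongr; omega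
      _ = _ := by ring
  have b2 : 500 * (((sidTransducer A.alphabet k).trans.card + Fintype.card (Fin (k + 1))) * e ^ 2)
      ≤ 4500 * Y := by
    rw [Fintype.card_fin]
    calc _ ≤ 500 * ((8 * D * r ^ 2 + D * r ^ 2) * e ^ 2) := by
          gcongr
          exact (show k + 1 ≤ D by omega).trans (Nat.le_mul_of_pos_right _ (by positivity))
      _ = 4500 * (e ^ 2 * r ^ 2 * D ^ 1) := by ring
      _ ≤ _ := by gcongr; exact hpow (by omega) (by omega) (by omega)
  have c2 : ((sidTransducer A.alphabet k).restrict A).trans.card ≤ 2 * D * e ^ 2 := by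
    refine (card_restrict_sidTransducer_trans_le A _ k).trans ?_
    rw [← he]
    gcongr
    omega
  -- The dominating term: the product has `O(D e ^ 2)` states and transitions, and the test is
  -- quadratic in them with one factor `r`.
  have b3 : 4000 * ((((sidTransducer A.alphabet k).restrict A).trans.card +
      Fintype.card (Fin (k + 1) × Q × Q)) ^ 2 * U.card) ≤ 72000 * Y := by
    rw [Fintype.card_prod, Fintype.card_prod, Fintype.card_fin, ← hn]
    calc _ ≤ 4000 * ((2 * D * e ^ 2 + D * (e * e)) ^ 2 * (2 * r)) := by
          gcongr <;> omega
      _ = 72000 * (e ^ 4 * r ^ 1 * D ^ 2) := by ring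
      _ ≤ _ := by gcongr; exact hpow (by omega) (by omega) (by omega)
  refine Ter.le (B := 1600 * Y + (4500 * Y + 72000 * Y)) ?_ (by omega)
  refine Ter.seq (((Ter.channel hA hk).le ?_).imp ?_)
  · rw [← hE, ← hr]
    exact b1
  intro τ1 F1 hT _
  have hA1 := hA.of_sameInput (F1.sameInput keepsInput_channel)
  refine Ter.seq (((Ter.product hA1 hT).le ?_).imp ?_)
  · rw [← he]
    exact b2
  intro τ2 F2 hT' _
  refine ((Ter.functional hT' (U := U) (by simp [hU]) ?_).le b3).imp ?_
  -- The output of a product transition is read by the second copy of `A`, so it is empty or a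
  -- symbol of `A`.
  · rintro ⟨⟨i, p, q⟩, x, y, j, p', q'⟩ ht
    obtain ⟨-, -, h⟩ := Transducer.mem_restrict_trans.1 ht
    cases y with
    | none => simp [hU, labelCode]
    | some a =>
      rw [hU]
      exact Finset.mem_union.2 (.inr (Finset.mem_image.2
        ⟨a, Finset.mem_image.2 ⟨(q, a, q'), h, rfl⟩, rfl⟩))
  · intro τ3 F3 hv
    rw [restrict_sidTransducer_functional_iff hL] at hv
    refine ⟨?_, ?_, hv⟩
    · obtain ⟨a1, a2, a3, a4, a5, a6, a7⟩ := F1.sameInput keepsInput_channel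
      obtain ⟨b1, b2, b3, b4, b5, b6, b7⟩ := F2.sameInput keepsInput_product
      obtain ⟨c1, c2, c3, c4, c5, c6, c7⟩ := F3.sameInput keepsInput_functional
      exact ⟨c1.trans (b1.trans a1), c2.trans (b2.trans a2), c3.trans (b3.trans a3),
        c4.trans (b4.trans a4), c5.trans (b5.trans a5), c6.trans (b6.trans a6),
        c7.trans (b7.trans a7)⟩
    · obtain ⟨a1, a2, a3, a4⟩ := F1.sameControl keepsControl_channel
      obtain ⟨b1, b2, b3, b4⟩ := F2.sameControl keepsControl_product
      obtain ⟨c1, c2, c3, c4⟩ := F3.sameControl keepsControl_functional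
      exact ⟨c1.trans (b1.trans a1), c2.trans (b2.trans a2), c3.trans (b3.trans a3),
        c4.trans (b4.trans a4)⟩

end Prog

/-! ### The binary search. -/

namespace Prog

/-- The body of the binary search. -/
def bisect : Prog :=
  .seq (.set .k (.half (.add (.reg .min) (.reg .max)))) <|
  .seq Prog.channel <|
  .seq Prog.product <|
  .seq Prog.functional <|
  .ite (.reg .verdict)
    (.set .min (.add (.reg .k) (.const 1)))
    (.set .max (.sub (.reg .k) (.const 1)))

/-- Regroups a right-nested sequence, so that the three subroutines can be treated as one block. -/
theorem Ter.assoc {a b c d : Prog} {σ : Mem} {B : ℕ} {Q : Mem → Prop}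
    (h : ((a ;; b ;; c) ;; d).Ter σ B Q) : (a ;; b ;; c ;; d).Ter σ B Q := by
  obtain ⟨τ, t, hr, ht, hQ⟩ := h
  cases hr with
  | seq h1 h4 =>
    cases h1 with
    | seq h1 h2 =>
      cases h2 with
      | seq h2 h3 =>
        refine ⟨τ, _, .seq h1 (.seq h2 (.seq h3 h4)), ?_, hQ⟩
        omega

theorem Ter.bisect {Q : Type} [Fintype Q] {A : Automaton Q} {σ : Mem} {m M D : ℕ}
    (hA : σ.HoldsAutomaton A) (hL : ∃ u ∈ A.language, ∃ v ∈ A.language, u ≠ v)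
    (hm : σ.reg .min = m) (hM : σ.reg .max = M) (hmM : m ≤ M) (hMD : M < D) :
    Prog.bisect.Ter σ (79000 * (A.size ^ 4 * A.alphabet.card ^ 4 * D ^ 2) + 11)
      (fun τ => σ.SameInput τ ∧ τ.reg .bound = σ.reg .bound ∧
        (((m + M) / 2 < languageEditDist A.language ∧ τ.reg .min = (m + M) / 2 + 1 ∧
          τ.reg .max = M) ∨
        (languageEditDist A.language ≤ (m + M) / 2 ∧ τ.reg .min = m ∧
          τ.reg .max = (m + M) / 2 - 1))) := by
  obtain ⟨k, hk⟩ : ∃ k, k = (m + M) / 2 := ⟨_, rfl⟩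
  rw [← hk]
  refine Ter.le (B := 5 + (79000 * (A.size ^ 4 * A.alphabet.card ^ 4 * D ^ 2) + 6)) (Ter.seq
    (Ter.set fun F => Ter.assoc (Ter.seq ((Ter.testErrors (k := k) (D := D) ?_ hL ?_ ?_).imp ?_))))
    (by omega)
  · exact hA.of_sameInput (F.sameInput (by decide))
  · simp [hm, hM, hk]
  · omega
  · rintro τ - ⟨h1, ⟨c1, c2, c3, c4⟩, hv⟩ _
    simp only [Mem.setReg_reg, reduceCtorEq, if_false, if_true, Exp.eval, hm, hM, ← hk]
      at c1 c2 c3 c4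
    refine Ter.ite (B := 4) (fun h => Ter.set ⟨h1, ?_⟩) fun h => Ter.set ⟨h1, ?_⟩
    · simp [c1, c3, c4, hv.1 h]
    · have : ¬k < languageEditDist A.language := fun h' => hv.2 h' h
      simp [c1, c2, c4, not_lt.1 this]

/-- The measure of the binary search for intervals of length `x` and `y`. The factor 2 makes the
logarithm drop even when the length falls from 1 to 0, where `Nat.log 2 0 = 0`. -/
theorem log_two_mul_add_one_le {x y : ℕ} (hy : 1 ≤ y) (h : x ≤ y / 2) :
    Nat.log 2 (2 * x) + 1 ≤ Nat.log 2 (2 * y) := by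
  rw [mul_comm 2 y, Nat.log_mul_base one_lt_two (by omega)]
  gcongr
  omega

theorem Ter.binarySearch {Q : Type} [Fintype Q] {A : Automaton Q} {σ : Mem} {D : ℕ}
    (hA : σ.HoldsAutomaton A) (hL : ∃ u ∈ A.language, ∃ v ∈ A.language, u ≠ v)
    (hD : languageEditDist A.language ≤ D) (hb : σ.reg .bound = D) (hm : σ.reg .min = 1)
    (hM : σ.reg .max = D - 1) :
    (Prog.while (.le (.reg .min) (.reg .max)) Prog.bisect).Ter σ
      ((79000 * (A.size ^ 4 * A.alphabet.card ^ 4 * D ^ 2) + 15) * Nat.log 2 (2 * (D - 1)) + 4)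
      (fun τ => τ.reg .bound = D ∧ τ.reg .min = languageEditDist A.language) := by
  obtain ⟨W, hW⟩ : ∃ W, W = 79000 * (A.size ^ 4 * A.alphabet.card ^ 4 * D ^ 2) := ⟨_, rfl⟩
  have hd := languageEditDist_pos hL
  rw [← hW]
  -- The distance lies between `m` and `M + 1`, so both are equal to it when `M < m`. Since `1 ≤ m`,
  -- the midpoint is positive and its truncated predecessor is the true one.
  refine (Ter.while_rule (I := fun T τ => ∃ m M, τ.HoldsAutomaton A ∧ τ.reg .bound = D ∧
    τ.reg .min = m ∧ τ.reg .max = M ∧ 1 ≤ m ∧ m ≤ languageEditDist A.language ∧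
    languageEditDist A.language ≤ M + 1 ∧ M + 1 ≤ D ∧
    T = (W + 15) * Nat.log 2 (2 * (M + 1 - m))) ?_ ?_).imp ?_
  · rintro T τ ⟨m, M, h1, h2, h3, h4, h5, h6, h7, h8, rfl⟩ he
    have hmM : m ≤ M := by
      by_contra h
      simp [h3, h4, h] at he
    refine ⟨W + 11, hW ▸ (Ter.bisect h1 hL h3 h4 hmM h8).imp ?_⟩
    rw [← hW]
    -- A round costs `W + 11` for the body and 4 for the test, which is the price `W + 15` of one
    -- unit of the logarithm.
    have hT : ∀ m' M', M' + 1 - m' ≤ (M + 1 - m) / 2 → (W + 15) * Nat.log 2 (2 * (M' + 1 - m')) +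
        (W + 11) + 3 + 1 ≤ (W + 15) * Nat.log 2 (2 * (M + 1 - m)) := by
      intro m' M' h
      have := Nat.mul_le_mul_left (W + 15) (log_two_mul_add_one_le (by omega) h)
      rw [Nat.mul_add] at this
      omega
    rintro υ - ⟨g1, g2, ⟨g3, g4, g5⟩ | ⟨g3, g4, g5⟩⟩
    · exact ⟨_, hT _ _ (by omega), _, _, h1.of_sameInput g1, g2.trans h2, g4, g5, by omega,
        by omega, h7, h8, rfl⟩
    · exact ⟨_, hT _ _ (by omega), _, _, h1.of_sameInput g1, g2.trans h2, g4, g5, h5, h6,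
        by omega, by omega, rfl⟩
  · refine ⟨1, D - 1, hA, hb, hm, hM, le_rfl, hd, by omega, by omega, ?_⟩
    congr 3
  · rintro τ - ⟨T, ⟨m, M, h1, h2, h3, h4, h5, h6, h7, h8, rfl⟩, he⟩
    have hmM : ¬m ≤ M := by
      intro h
      simp [h3, h4, h] at he
    exact ⟨h2, h3.trans (by omega)⟩

end Prog

/-- With `l = Nat.log 2 (D + 1)` the number of rounds is at most `l + 1 ≤ 2 * l`, and `l ≤ 2 *
Real.log (D + 1)` because `Real.log 2` exceeds one half. As `D ≥ 1` gives `l ≥ 1`, the costs outside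
the loop are absorbed too. -/
theorem add_natLog_le_log {Y D : ℕ} (hY : 1 ≤ Y) (hD : 1 ≤ D) :
    ((6000 * Y + (6 + ((79000 * Y + 15) * Nat.log 2 (2 * (D - 1)) + 4 + 2)) : ℕ) : ℝ) ≤
      480000 * Y * Real.log ((D : ℝ) + 1) := by
  obtain ⟨l, hl⟩ : ∃ l, l = Nat.log 2 (D + 1) := ⟨_, rfl⟩
  have h1 : 1 ≤ l := hl ▸ Nat.log_pos one_lt_two (by omega)
  have h2 : Nat.log 2 (2 * (D - 1)) ≤ l + 1 := by
    rw [hl, ← Nat.log_mul_base one_lt_two (by omega)]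
    exact Nat.log_mono_right (by omega)
  have h3 : (l : ℝ) ≤ 2 * Real.log ((D : ℝ) + 1) := by
    have h : ((2 : ℝ) ^ l) ≤ (D : ℝ) + 1 := by
      exact_mod_cast hl ▸ Nat.pow_log_le_self 2 (show D + 1 ≠ 0 by omega)
    have := Real.log_le_log (by positivity) h
    rw [Real.log_pow] at this
    nlinarith [Real.log_two_gt_d9, (Nat.cast_nonneg l : (0 : ℝ) ≤ l)]
  have h4 : 6000 * Y + (6 + ((79000 * Y + 15) * Nat.log 2 (2 * (D - 1)) + 4 + 2)) ≤
      240000 * Y * l := by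
    calc _ ≤ 6000 * Y + (6 + ((79000 * Y + 15 * Y) * (l + l) + 4 + 2)) := by
          gcongr <;> omega
      _ = 6000 * Y + 12 + 158030 * (Y * l) := by ring
      _ ≤ _ := by
        have h5 : Y ≤ Y * l := Nat.le_mul_of_pos_right _ h1
        rw [mul_assoc]
        omega
  calc _ ≤ ((240000 * Y * l : ℕ) : ℝ) := by exact_mod_cast h4
    _ = 240000 * Y * (l : ℝ) := by push_cast; ring
    _ ≤ 240000 * Y * (2 * Real.log ((D : ℝ) + 1)) := by gcongr
    _ = _ := by ring

theorem mainTheorem3 :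
    ∃ computeBound constructChannel constructProduct testFunctional : Prog,
      ComputesBound computeBound ∧ ConstructsChannel constructChannel ∧
      ConstructsProduct constructProduct ∧ DecidesFunctional testFunctional ∧
      ∃ C : ℝ, ∀ (Q : Type) [Fintype Q] (A : Automaton Q),
        (∃ u ∈ A.language, ∃ v ∈ A.language, u ≠ v) →
        ∀ σ : Mem, σ.HoldsAutomaton A →
          ∃ (τ : Mem) (t D : ℕ),
            (distErrDetect computeBound constructChannel constructProduct testFunctional).Runs
              σ τ t ∧
            τ.reg .result = languageEditDist A.language ∧
            τ.reg .bound = D ∧ IsShortestWordsBound A.language D ∧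
            (t : ℝ) ≤ C * (A.size : ℝ) ^ 4 * (A.alphabet.card : ℝ) ^ 4 * (D : ℝ) ^ 2 *
              Real.log ((D : ℝ) + 1) := by
  refine ⟨Prog.bound, Prog.channel, Prog.product, Prog.functional, Prog.computesBound_bound,
    Prog.constructsChannel_channel, Prog.constructsProduct_product,
    Prog.decidesFunctional_functional, 480000, fun Q _ A hL σ hA => ?_⟩
  obtain ⟨τ, s, hrun, hs, hbound⟩ := Prog.Ter.bound hA hL
  obtain ⟨D, hD⟩ : ∃ D, D = τ.reg .bound := ⟨_, rfl⟩
  rw [← hD] at hbound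
  have hdD := hbound.languageEditDist_le
  have hD1 : 1 ≤ D := (languageEditDist_pos hL).trans_le hdD
  obtain ⟨Y, hY⟩ : ∃ Y, Y = A.size ^ 4 * A.alphabet.card ^ 4 * D ^ 2 := ⟨_, rfl⟩
  have hr1 : 1 ≤ A.alphabet.card := (Automaton.alphabet_nonempty hL).card_pos
  have he1 : 1 ≤ A.size := Nat.le_add_right_of_le (Fintype.card_pos_iff.2 ⟨A.start⟩)
  have hY1 : 1 ≤ Y := hY ▸ Nat.mul_pos (Nat.mul_pos (by positivity) (by positivity))
    (by positivity)
  -- The alphabet is not empty, so `r + 1 ≤ 2 * r ^ 4`; the remaining factors of `Y` are at least 1.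
  have hs' : s ≤ 6000 * Y := hs.trans <| by
    calc 3000 * (A.size ^ 2 * (A.alphabet.card + 1))
        ≤ 3000 * (A.size ^ 4 * (2 * A.alphabet.card ^ 4)) := by
          gcongr
          · omega
          · have := Nat.le_self_pow (show 4 ≠ 0 by omega) A.alphabet.card
            omega
      _ = 6000 * (A.size ^ 4 * A.alphabet.card ^ 4 * 1) := by ring
      _ ≤ _ := by
        rw [hY]
        gcongr
        exact Nat.one_le_pow _ _ hD1
  have hA' := hA.of_sameInput (hrun.frame.sameInput Prog.keepsInput_bound)
  obtain ⟨υ, t, hrun', ht, hυ1, hυ2⟩ : (Prog.seq (.set .min (.const 1)) <|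
      .seq (.set .max (.sub (.reg .bound) (.const 1))) <|
      .seq (.while (.le (.reg .min) (.reg .max)) Prog.bisect) (.set .result (.reg .min))).Ter τ
      (2 + (4 + ((79000 * Y + 15) * Nat.log 2 (2 * (D - 1)) + 4 + 2)))
      (fun υ => υ.reg .bound = D ∧ υ.reg .result = languageEditDist A.language) := by
    refine Prog.Ter.seq (Prog.Ter.set fun F => Prog.Ter.seq (Prog.Ter.set fun F' =>
      Prog.Ter.seq (hY ▸ (Prog.Ter.binarySearch ?_ hL hdD ?_ ?_ ?_).imp ?_)))
    · exact (hA'.of_sameInput (F.sameInput (by decide))).of_sameInput (F'.sameInput (by decide))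
    · simp [hD]
    · simp
    · simp [hD]
    · rintro ρ - ⟨h1, h2⟩ -
      exact Prog.Ter.set (by simp [h1, h2])
  refine ⟨υ, s + t, D, .seq hrun hrun', hυ2, hυ1, hbound, ?_⟩
  have hle : ((s + t : ℕ) : ℝ) ≤ _ :=
    (Nat.cast_le.2 (show s + t ≤ 6000 * Y +
      (6 + ((79000 * Y + 15) * Nat.log 2 (2 * (D - 1)) + 4 + 2)) by omega)).trans
      (add_natLog_le_log hY1 hD1)
  refine hle.trans (le_of_eq ?_)
  rw [hY]
  push_cast
  ring
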